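/- **Setting.** Let $\sigma(z)=\max\{z,0\}$ and let $f(\cdot;\Theta):\mathbb R^d\to\mathbb R$ be a network with $L=L_C+L_F\ge 1$ hidden layers of widths $m_0=d,m_1,\dots,m_L=m$: $$f(\mathbf x;\Theta)=\frac1{m^p}\sum_{k=1}^m a_kz^{(L)}_k\ (p\ge 0),\qquad \mathbf z^{(l)}=\sigma(\mathbf A^{(l)\top}\mathbf z^{(l-1)})\ (L_C<l\le L),\qquad \mathbf z^{(0)}=\mathbf x ,$$ and for $l\le L_C$, with a kernel $\mathbf w^{(l)}\in\mathbb R^{s_l}$, $y^{(l)}_k=\sigma\big(\sum_{j=1}^{s_l}w^{(l)}_jz^{(l-1)}_{k+j-1}\big)$ for $1\le k\le m_ls_l$ (where $m_ls_l+s_l-1\le m_{l-1}$), and $z^{(l)}_k$ is the average, or the maximum (the choice may depend on $l$), of $y^{(l)}_{(k-1)s_l+1},\dots,y^{(l)}_{ks_l}$. Let $\Theta^{(l)}$, $1\le l\le L+1$, be the vector of the $q(l)$ parameters of layer $l$ ($\Theta^{(L+1)}=(a_k)$). Gradients are computed by the chain rule with $\sigma'(0)=0$, the first maximizer being selected in a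 max pooling. Put $C_{L,d}=\sqrt{2(L+1)\log 2}+1$ if $L_C=0$ and $C_{L,d}=2\sqrt{(L+2+\log d)d}$ otherwise. Let $\mu$ be a probability distribution of $(\mathbf x,y)$ with $\|\mathbf x\|_2\le 1$ and $|y|\le C_y\le 1$ almost surely, $(\mathbf x_i,y_i)_{i\le n}$ an i.i.d. sample from $\mu$, $\ell(\mathbf x,y;\Theta)=\frac12(f(\mathbf x;\Theta)-y)^2$, $\mathcal L_\mu(\Theta)=\mathbb E_\mu\,\ell$, $\mathcal L_n(\Theta)=\frac1n\sum_{i}\ell(\mathbf x_i,y_i;\Theta)$ and $\mathcal E_{\rm gen}=\mathcal L_\mu-\mathcal L_n$. The initialization is $\Theta^{(l)}(0)\sim\mathcal N(0,\frac{\kappa^2}{q(l)}I)$, independently over the layers and of the data ($\kappa>0$), and mini-batch SGD with batch size $B$ is $$\Theta(t+1)=\Theta(t)-\frac{\eta_t}{B}\sum_{i=1}^B\nabla\ell(\mathbf x_{\gamma^t_i},y_{\gamma^t_i};\Theta(t)),\qquad 0\le t<T,$$ where $\gamma^0,\dots,\gamma^{T-1}$ are independent, uniform on $[n]^B$, and independent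 of the data and of $\Theta(0)$. The learning rate is $\eta_t=\eta/\lceil\frac{t+1}{T_0}\rceil^{\alpha}$ with $T_0\in\mathbb N_{\ge1}$, $\alpha\in(\frac{L+1}{L+2},1]$, $\eta>0$. Put $$\mathsf{CL}(T)=\sum_{t=0}^{T-1}2\eta_t\sqrt{2\mathcal L_n(\Theta(t))}\Big(C_y-\sqrt{2\mathcal L_n(\Theta(t))}\Big),\qquad \mathbb E_T=\mathbb E_{\gamma^0,\dots,\gamma^{T-1}}[\,\cdot\mid(\mathbf x_i,y_i)_i,\Theta(0)].$$ For $C_f>0$, let $\mathcal B$ be the event that the data and $\Theta(0)$ are such that every network $f(\cdot;\Theta(t))$, $t\le T$, which SGD can reach from them (for any mini-batches) satisfies $|f(\mathbf x;\Theta(t))|\le C_f$ for $\mu$-almost all $\mathbf x$. **Theorem (SGD).** There are an absolute constant $K>0$, constants $c_\eta(L,\delta)>0$, and constants $c>0$ depending only on $C_f$ and $\delta_0$ (and on $L$ if some layer uses max pooling), such that the following holds for all networks and data as above. Let $0<\delta\le\delta_0<1$, $\rho>0$, and let $\varepsilon\in(0,1)$ with $\varepsilon\le(L+2)\alpha-(L+1)$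 (no restriction if $\alpha=1$). Suppose that $$\eta\le c_\eta(L,\delta)\min\Big\{\frac{m^pL^{\frac{L-1}2}\sqrt\varepsilon}{(C_f+C_y)T_0^{\frac{1+\varepsilon}2}\kappa^{L-1}},\ \frac{\kappa^2(1-\varepsilon)}{C_y^2T_0}\Big\}.$$ Then, with probability at least $\frac{\rho}{1+\rho}-\delta$ over data, initialization and mini-batches: if $\mathcal B$ occurs, then $$\mathcal E_{\rm gen}(\Theta(T))\le c\Big(\frac{C_{L,d}}{m^p\sqrt n}\,Q^{\frac{L+1}2}+\sqrt{\frac{\log(1/\delta)}n}\Big),$$ where $$Q=K(1+\rho)\kappa^2\Big(1+\max_{1\le l\le L+1}\frac{\log((L+1)/\delta)}{q(l)}\Big)+(1+\rho)\,\mathbb E_T[\mathsf{CL}(T)]\ \ge 0 .$$ In particular, if $\mathcal B$ holds almost surely, the bound holds with probability at least $\frac{\rho}{1+\rho}-\delta$. -/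

import Mathlib

open MeasureTheory ProbabilityTheory

noncomputable section

namespace DeepNet

/-- Architecture of a ReLU network: `LC` blocks `Conv → ReLU → Pooling`, followed by `LF`
fully-connected ReLU layers, followed by a linear output layer.  The hidden layers are numbered
`0, …, LC + LF - 1`; layer `l` maps a vector of dimension `width l` to one of dimension
`width (l + 1)`.  For `l < LC` the number `kernel l` is both the length of the convolution kernel
(stride one, no padding) and the size of the (disjoint) pooling windows, and `maxPool l` tells
whether the pooling of layer `l` is max pooling or average pooling. -/
structure Arch where
  LC : ℕ
  LF : ℕ
  width : ℕ → ℕ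
  kernel : ℕ → ℕ
  maxPool : ℕ → Bool
  width_pos : ∀ l, l ≤ LC + LF → 0 < width l
  kernel_pos : ∀ l, l < LC → 0 < kernel l
  /-- the windows `[k, k + kernel l)`, `k < width (l + 1) * kernel l`, fit into the layer below -/
  conv_fits : ∀ l, l < LC →
    width (l + 1) * kernel l + kernel l ≤ width l + 1

variable (N : Arch)

/-- The number `L` of hidden layers. -/
def Arch.L : ℕ := N.LC + N.LF

/-- The input dimension. -/
def Arch.d : ℕ := N.width 0

/-- The width of the last hidden layer. -/
def Arch.m : ℕ := N.width N.L

/-- The number of parameters of layer `l`; the output layer is `l = L`. -/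
def Arch.q (l : ℕ) : ℕ :=
  if l < N.LC then N.kernel l
  else if l < N.L then N.width l * N.width (l + 1)
  else N.width N.L

/-- Some convolutional block uses max pooling. -/
def Arch.HasMaxPool : Prop := ∃ l, l < N.LC ∧ N.maxPool l = true

/-- Index set of the parameters: layer, position inside the layer. -/
abbrev ParamIdx : Type := Σ l : Fin (N.L + 1), Fin (N.q l)

/-- The parameter vectors `Θ`. -/
abbrev Params : Type := ParamIdx N → ℝ

/-- Labelled data `(x, y)`. -/
abbrev Data : Type := EuclideanSpace ℝ (Fin N.d) × ℝ

variable {N}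

/-- The `j`-th parameter of layer `l` (zero out of range). -/
def coef (Θ : Params N) (l j : ℕ) : ℝ :=
  if h : l < N.L + 1 then
    (if h' : j < N.q l then Θ ⟨⟨l, h⟩, ⟨j, h'⟩⟩ else 0)
  else 0

/-- The ReLU function. -/
def relu (z : ℝ) : ℝ := max z 0

/-- The derivative of ReLU, with the usual convention `σ'(0) = 0`. -/
def relu' (z : ℝ) : ℝ := if 0 < z then 1 else 0

/-- The input vector, as a sequence. -/
def input (x : EuclideanSpace ℝ (Fin N.d)) (i : ℕ) : ℝ :=
  if h : i < N.d then x ⟨i, h⟩ else 0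

/-- Pre-activations of layer `l`: the convolution `∑ₐ wₐ z_{k+a}` for `l < LC`, and
`(Aᵀ z)_k = ∑ᵢ A_{ik} z_i` otherwise, `A` being stored column by column. -/
def preact (Θ : Params N) (l : ℕ) (z : ℕ → ℝ) (k : ℕ) : ℝ :=
  if l < N.LC then ∑ a ∈ Finset.range (N.kernel l), coef Θ l a * z (k + a)
  else ∑ i ∈ Finset.range (N.width l), coef Θ l (k * N.width l + i) * z i

variable (N) in
/-- Pooling over the windows `[k s, (k + 1) s)`, `s = kernel l`. -/
def pool (l : ℕ) (y : ℕ → ℝ) (k : ℕ) : ℝ :=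
  if N.maxPool l = true then ⨆ b : Fin (N.kernel l), y (k * N.kernel l + b)
  else (∑ b ∈ Finset.range (N.kernel l), y (k * N.kernel l + b)) / N.kernel l

/-- The hidden representation `z^{(l)}`. -/
def hidden (Θ : Params N) (x : EuclideanSpace ℝ (Fin N.d)) : ℕ → ℕ → ℝ
  | 0 => input x
  | l + 1 =>
    if l < N.LC then pool N l (fun k => relu (preact Θ l (hidden Θ x l) k))
    else fun k => relu (preact Θ l (hidden Θ x l) k)

/-- The network `f(x; Θ) = m^{-p} ∑ₖ aₖ z^{(L)}ₖ`. -/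
def net (p : ℝ) (Θ : Params N) (x : EuclideanSpace ℝ (Fin N.d)) : ℝ :=
  1 / (N.m : ℝ) ^ p * ∑ k ∈ Finset.range N.m, coef Θ N.L k * hidden Θ x N.L k

variable (N) in
open Classical in
/-- The derivative of the `k`-th output of pooling layer `l` with respect to the `b`-th entry of its
window: `1 / s` for average pooling, the indicator of the (first) maximizer for max pooling. -/
def poolWeight (l : ℕ) (y : ℕ → ℝ) (k b : ℕ) : ℝ :=
  if N.maxPool l = true then
    (if (∀ b', b' < N.kernel l → y (k * N.kernel l + b') ≤ y (k * N.kernel l + b)) ∧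
        (∀ b', b' < b → y (k * N.kernel l + b') < y (k * N.kernel l + b)) then 1 else 0)
  else 1 / N.kernel l

/-- The hidden representation computed with parameters `Θ`, where every ReLU and every pooling is
replaced by its linearization at the forward pass of `(Θ₀, x)`. -/
def frozenHidden (Θ₀ Θ : Params N) (x : EuclideanSpace ℝ (Fin N.d)) : ℕ → ℕ → ℝ
  | 0 => input x
  | l + 1 =>
    let u : ℕ → ℝ := preact Θ₀ l (hidden Θ₀ x l)
    let v : ℕ → ℝ := fun k => relu' (u k) * preact Θ l (frozenHidden Θ₀ Θ x l) k
    if l < N.LC then fun k => ∑ b ∈ Finset.range (N.kernel l),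
      poolWeight N l (fun j => relu (u j)) k b * v (k * N.kernel l + b)
    else v

/-- The network with the activation pattern frozen at `(Θ₀, x)`. -/
def frozenNet (p : ℝ) (Θ₀ Θ : Params N) (x : EuclideanSpace ℝ (Fin N.d)) : ℝ :=
  1 / (N.m : ℝ) ^ p * ∑ k ∈ Finset.range N.m, coef Θ N.L k * frozenHidden Θ₀ Θ x N.L k

/-- The partial derivative `∂f(x; Θ)/∂Θ_i` as given by the chain rule (backpropagation), with
`σ'(0) = 0`: the derivative at `Θ` of the network with activation pattern frozen at `(Θ, x)`, which
is polynomial in the parameters and agrees with the network near `Θ` off the kinks. -/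
def netGrad (p : ℝ) (Θ : Params N) (x : EuclideanSpace ℝ (Fin N.d)) (i : ParamIdx N) : ℝ :=
  deriv (fun s => frozenNet p Θ (Function.update Θ i s) x) (Θ i)

/-- The quadratic loss `ℓ(x, y; Θ)`. -/
def loss (p : ℝ) (Θ : Params N) (z : Data N) : ℝ := (net p Θ z.1 - z.2) ^ 2 / 2

/-- The gradient `∇ℓ(x, y; Θ) = (f(x; Θ) - y) ∇f(x; Θ)`. -/
def lossGrad (p : ℝ) (Θ : Params N) (z : Data N) (i : ParamIdx N) : ℝ :=
  (net p Θ z.1 - z.2) * netGrad p Θ z.1 i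

/-- The population risk. -/
def popRisk (p : ℝ) (μ : Measure (Data N)) (Θ : Params N) : ℝ := ∫ z, loss p Θ z ∂μ

/-- The empirical risk. -/
def empRisk (p : ℝ) {n : ℕ} (S : Fin n → Data N) (Θ : Params N) : ℝ :=
  (∑ i, loss p Θ (S i)) / n

/-- The generalization error. -/
def genError (p : ℝ) (μ : Measure (Data N)) {n : ℕ} (S : Fin n → Data N) (Θ : Params N) : ℝ :=
  popRisk p μ Θ - empRisk p S Θ

/-- The learning rate `η_t = η / ⌈(t + 1) / T₀⌉ ^ α`. -/
def learningRate (η α : ℝ) (T₀ t : ℕ) : ℝ := η / (⌈((t : ℝ) + 1) / T₀⌉₊ : ℝ) ^ α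

/-- The index tuples of the mini-batches used in the steps `0, …, T - 1`. -/
abbrev Batches (n B T : ℕ) : Type := Fin T → Fin B → Fin n

/-- The SGD iterates `Θ(t)`, `t ≤ T`, for the step sizes `rate`, the training data `S`, the
initial value `Θ₀` and the mini-batches `γ` (constant after time `T`). -/
def sgd (p : ℝ) (rate : ℕ → ℝ) {n B T : ℕ} (S : Fin n → Data N) (Θ₀ : Params N)
    (γ : Batches n B T) : ℕ → Params N
  | 0 => Θ₀
  | t + 1 => fun i =>
    if h : t < T then
      sgd p rate S Θ₀ γ t i
        - rate t / B * ∑ b : Fin B, lossGrad p (sgd p rate S Θ₀ γ t) (S (γ ⟨t, h⟩ b)) i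
    else sgd p rate S Θ₀ γ t i

/-- The discrete cumulative loss `CL(T)`. -/
def cumLoss (p Cy : ℝ) (rate : ℕ → ℝ) {n B T : ℕ} (S : Fin n → Data N) (Θ₀ : Params N)
    (γ : Batches n B T) : ℝ :=
  ∑ t ∈ Finset.range T, 2 * rate t * √(2 * empRisk p S (sgd p rate S Θ₀ γ t)) *
    (Cy - √(2 * empRisk p S (sgd p rate S Θ₀ γ t)))

/-- The law of the mini-batches: independent and uniform on the `B`-tuples in `[n]`. -/
def batchLaw (n B T : ℕ) : Measure (Batches n B T) := uniformOn Set.univ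

/-- `E_T[CL(T)]`: expectation over the mini-batches, for given data and initialization. -/
def meanCumLoss (p Cy : ℝ) (rate : ℕ → ℝ) {n : ℕ} (B T : ℕ) (S : Fin n → Data N)
    (Θ₀ : Params N) : ℝ :=
  ∫ γ, cumLoss p Cy rate S Θ₀ γ ∂(batchLaw n B T)

variable (N) in
/-- The random initialization: independent `N(0, κ² / q(l))` entries in layer `l`. -/
def initLaw (κ : ℝ) : Measure (Params N) :=
  Measure.pi fun i : ParamIdx N => gaussianReal 0 (Real.toNNReal (κ ^ 2 / N.q i.1))

/-- The joint law of the i.i.d. training sample, the initialization and the mini-batches. -/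
def trainLaw (κ : ℝ) (μ : Measure (Data N)) (n B T : ℕ) :
    Measure ((Fin n → Data N) × Params N × Batches n B T) :=
  (Measure.pi fun _ : Fin n => μ).prod ((initLaw N κ).prod (batchLaw n B T))

/-- Boundedness of the hypothesis space: all networks that SGD can reach up to time `T` from the
given data and initialization are bounded by `Cf` on the data distribution. -/
def BoundedOutputs (p Cf : ℝ) (rate : ℕ → ℝ) (μ : Measure (Data N)) {n : ℕ} (B T : ℕ)
    (S : Fin n → Data N) (Θ₀ : Params N) : Prop :=
  ∀ γ : Batches n B T, ∀ t ≤ T, ∀ᵐ z ∂μ, |net p (sgd p rate S Θ₀ γ t) z.1| ≤ Cf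

variable (N) in
/-- The constant `C_{L,d}` of the Rademacher complexity estimate. -/
def Arch.C : ℝ :=
  if N.LC = 0 then √(2 * (N.L + 1) * Real.log 2) + 1
  else 2 * √((N.L + 2 + Real.log N.d) * N.d)

variable (N) in
/-- The scale `κ² (1 + max_l log((L + 1) / δ) / q(l))` of the squared layer norms at
initialization. -/
def initScale (κ δ : ℝ) : ℝ :=
  κ ^ 2 * (1 + ⨆ l : Fin (N.L + 1), Real.log ((N.L + 1) / δ) / N.q l)

variable (N) in
open Classical in
/-- `L` if some layer uses max pooling, and `0` otherwise. -/
def Arch.maxPoolDepth : ℕ := if N.HasMaxPool then N.L else 0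

/-- The bound `K (1 + ρ) κ² (1 + …) + (1 + ρ) E_T[CL(T)]` for the squared layer norms. -/
def sqRadius (K ρ κ δ p Cy : ℝ) (rate : ℕ → ℝ) {n : ℕ} (B T : ℕ) (S : Fin n → Data N)
    (Θ₀ : Params N) : ℝ :=
  K * ((1 + ρ) * initScale N κ δ) + (1 + ρ) * meanCumLoss p Cy rate B T S Θ₀

end DeepNet

end

/-!
The proof combines a generalization bound that holds for all parameters at once, in terms of the
product `pathNorm Θ` of the Euclidean norms of the layers, with a bound for these norms along the
training.

**Generalization.** The Rademacher complexity of the networks with `pathNorm Θ ≤ G` is at most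
`C * G / m ^ p * √n` (`signAvg_loss_le`). It is proved for exponential moments of suprema over a
finite family of networks: Rademacher signs are introduced one at a time (`signAvg`), so that
Lipschitz functions of several linear forms, such as ReLU and pooling, can be removed by
contraction, and the layers are peeled off one by one. Dense layers are peeled in the Euclidean
norm; convolutional blocks are peeled in the maximum norm, where the number of positions in the
input is at most `d`. The bounded difference inequality and symmetrization
(`measure_exists_deviation_le`) turn this into a bound in probability for finite families. It
passes to all networks, because countably many pairs of a population risk and a parameter vector
are dense among all of them and the empirical risk is continuous. A union bound over
dyadic scales of `pathNorm Θ` then makes the bound adaptive, with a constant that depends on the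
bound for the outputs and on `δ₀` only (`measure_exists_genError_le_pathNorm`).

**Training.** Backpropagation is differentiation of the network with a frozen activation pattern,
which is linear in each layer. Hence the inner product of the parameters of a layer with the
gradient of `f` is `f` itself, for every layer (`sum_param_mul_netGrad`), and one step of gradient
descent changes all the squared layer norms by the same first order amount, `descentStep`, up to a
second order term. A bootstrap argument shows that the squared norms grow at most like
`κ ^ 2 * blockNum ^ β` with `β = (1 - ε) / (L + 2)`; under the condition on the learning rate the
second order terms then sum to at most `κ ^ 2` (`layerSq_sgd_le`). In expectation over the
mini-batches the first order increments are bounded by the cumulative loss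
(`integral_sum_descentStep_le`), so Markov's inequality, applied to a random variable that
dominates all squared layer norms at time `T`, gives the factor `1 + ρ` with probability
`ρ / (1 + ρ)` (`trainLaw_isTame_growth_le`).

**Conclusion.** The layer norms at initialization are controlled by Chernoff's bound
(`initLaw_exists_layerSq_le`). The exceptional probabilities are `δ / 2` for the generalization
bound, `δ / 2` for the initialization and `1 / (1 + ρ)` for Markov's inequality.
-/

noncomputable section

namespace DeepNet

variable {N : Arch}

/-! ### The network is linear in each layer once its activation pattern is frozen -/

/-- The parameters `Θ` with layer `l` replaced by that of `v`. -/
def mix (l : ℕ) (Θ v : Params N) : Params N := fun i => if (i.1 : ℕ) = l then v i else Θ i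

lemma coef_mix (l l' j : ℕ) (Θ v : Params N) :
    coef (mix l Θ v) l' j = if l' = l then coef v l' j else coef Θ l' j := by
  unfold coef mix
  split_ifs <;> simp_all

lemma coef_lin (a b : ℝ) (v w : Params N) (l j : ℕ) :
    coef (a • v + b • w) l j = a * coef v l j + b * coef w l j := by
  unfold coef
  split_ifs <;> simp

lemma mix_self (l : ℕ) (Θ : Params N) : mix l Θ Θ = Θ := by
  funext i; simp [mix]

lemma preact_congr {Θ Θ' : Params N} {l : ℕ} (h : ∀ j, coef Θ l j = coef Θ' l j) (z : ℕ → ℝ) :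
    preact Θ l z = preact Θ' l z := by
  funext k; simp [preact, h]

lemma preact_lin_param (a b : ℝ) (v w : Params N) (l : ℕ) (z : ℕ → ℝ) (k : ℕ) :
    preact (a • v + b • w) l z k = a * preact v l z k + b * preact w l z k := by
  simp only [preact, coef_lin]
  split_ifs <;> simp only [Finset.mul_sum, ← Finset.sum_add_distrib] <;>
    exact Finset.sum_congr rfl fun i _ => by ring

lemma preact_lin_vec (a b : ℝ) (Θ : Params N) (l : ℕ) {z z₁ z₂ : ℕ → ℝ}
    (hz : ∀ k, z k = a * z₁ k + b * z₂ k) (k : ℕ) :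
    preact Θ l z k = a * preact Θ l z₁ k + b * preact Θ l z₂ k := by
  simp only [preact, hz]
  split_ifs <;> simp only [Finset.mul_sum, ← Finset.sum_add_distrib] <;>
    exact Finset.sum_congr rfl fun i _ => by ring

/-- ReLU followed by pooling, linearized at the forward pass of `(Θ₀, x)`: the linear map that
sends the pre-activations of layer `l` to its output. -/
def frozenStep (Θ₀ : Params N) (x : EuclideanSpace ℝ (Fin N.d)) (l : ℕ) (u : ℕ → ℝ) (k : ℕ) : ℝ :=
  let u₀ : ℕ → ℝ := preact Θ₀ l (hidden Θ₀ x l)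
  if l < N.LC then ∑ b ∈ Finset.range (N.kernel l), poolWeight N l (fun j => relu (u₀ j)) k b *
      (relu' (u₀ (k * N.kernel l + b)) * u (k * N.kernel l + b))
  else relu' (u₀ k) * u k

lemma frozenHidden_succ (Θ₀ Θ : Params N) (x : EuclideanSpace ℝ (Fin N.d)) (l : ℕ) :
    frozenHidden Θ₀ Θ x (l + 1) =
      frozenStep Θ₀ x l (preact Θ l (frozenHidden Θ₀ Θ x l)) := by
  funext k
  rw [frozenHidden]
  simp only [frozenStep]
  split_ifs <;> rfl

lemma frozenStep_lin (a b : ℝ) (Θ₀ : Params N) (x : EuclideanSpace ℝ (Fin N.d)) (l : ℕ)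
    {u u₁ u₂ : ℕ → ℝ} (hu : ∀ k, u k = a * u₁ k + b * u₂ k) (k : ℕ) :
    frozenStep Θ₀ x l u k = a * frozenStep Θ₀ x l u₁ k + b * frozenStep Θ₀ x l u₂ k := by
  simp only [frozenStep, hu]
  split_ifs
  · simp only [Finset.mul_sum, ← Finset.sum_add_distrib]
    exact Finset.sum_congr rfl fun i _ => by ring
  · ring

lemma frozenHidden_mix_le (Θ₀ Θ v : Params N) (x : EuclideanSpace ℝ (Fin N.d)) {l j : ℕ}
    (h : j ≤ l) : frozenHidden Θ₀ (mix l Θ v) x j = frozenHidden Θ₀ Θ x j := by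
  induction j with
  | zero => simp [frozenHidden]
  | succ j ih =>
    rw [frozenHidden_succ, frozenHidden_succ, ih (by omega),
      preact_congr (Θ' := Θ) fun i => by rw [coef_mix, if_neg (by omega)]]

lemma frozenHidden_mix_lin (a b : ℝ) (Θ₀ Θ v w : Params N) (x : EuclideanSpace ℝ (Fin N.d))
    {l j : ℕ} (h : l < j) (k : ℕ) :
    frozenHidden Θ₀ (mix l Θ (a • v + b • w)) x j k =
      a * frozenHidden Θ₀ (mix l Θ v) x j k + b * frozenHidden Θ₀ (mix l Θ w) x j k := by
  induction j generalizing k with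
  | zero => omega
  | succ j ih =>
    simp only [frozenHidden_succ]
    apply frozenStep_lin
    intro k
    rcases (Nat.lt_succ_iff.1 h).eq_or_lt with rfl | hlt
    · simp only [frozenHidden_mix_le _ _ _ _ le_rfl]
      rw [preact_congr (Θ := mix l Θ (a • v + b • w)) (Θ' := a • v + b • w)
          fun i => by rw [coef_mix, if_pos rfl],
        preact_congr (Θ := mix l Θ v) (Θ' := v) fun i => by rw [coef_mix, if_pos rfl],
        preact_congr (Θ := mix l Θ w) (Θ' := w) fun i => by rw [coef_mix, if_pos rfl],
        preact_lin_param]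
    · have hc : ∀ u : Params N, ∀ i, coef (mix l Θ u) j i = coef Θ j i := fun u i => by
        rw [coef_mix, if_neg (by omega)]
      rw [preact_congr (hc _), preact_congr (hc _), preact_congr (hc _)]
      exact preact_lin_vec a b Θ j (ih hlt) k

lemma frozenNet_mix_lin (p a b : ℝ) (Θ₀ Θ v w : Params N) (x : EuclideanSpace ℝ (Fin N.d))
    {l : ℕ} (h : l ≤ N.L) :
    frozenNet p Θ₀ (mix l Θ (a • v + b • w)) x =
      a * frozenNet p Θ₀ (mix l Θ v) x + b * frozenNet p Θ₀ (mix l Θ w) x := by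
  simp only [frozenNet, Finset.mul_sum, ← Finset.sum_add_distrib]
  refine Finset.sum_congr rfl fun k _ => ?_
  rcases h.eq_or_lt with rfl | h
  · simp only [frozenHidden_mix_le _ _ _ _ le_rfl, coef_mix, if_true, coef_lin]
    ring
  · simp only [frozenHidden_mix_lin a b Θ₀ Θ v w x h, coef_mix, if_neg h.ne']
    ring

/-- The frozen network as a linear function of the parameters of layer `l`. -/
def frozenLin (p : ℝ) (Θ₀ Θ : Params N) (x : EuclideanSpace ℝ (Fin N.d)) (l : Fin (N.L + 1)) :
    Params N →ₗ[ℝ] ℝ where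
  toFun v := frozenNet p Θ₀ (mix l Θ v) x
  map_add' v w := by
    simpa using frozenNet_mix_lin p 1 1 Θ₀ Θ v w x (Nat.lt_succ_iff.1 l.2)
  map_smul' a v := by
    simpa using frozenNet_mix_lin p a 0 Θ₀ Θ v 0 x (Nat.lt_succ_iff.1 l.2)

lemma netGrad_eq (p : ℝ) (Θ : Params N) (x : EuclideanSpace ℝ (Fin N.d)) (i : ParamIdx N) :
    netGrad p Θ x i = frozenLin p Θ Θ x i.1 (Pi.single i 1) := by
  have key : ∀ s, frozenNet p Θ (Function.update Θ i s) x =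
      frozenLin p Θ Θ x i.1 Θ + (s - Θ i) * frozenLin p Θ Θ x i.1 (Pi.single i 1) := by
    intro s
    have : Function.update Θ i s = mix i.1 Θ (Θ + (s - Θ i) • Pi.single i 1) := by
      funext j
      by_cases hj : j = i
      · subst hj; simp [mix]
      · simp [mix, hj]
    rw [this, ← smul_eq_mul, ← map_smul, ← map_add]
    rfl
  unfold netGrad
  simp only [key]
  simp

/-- The derivative along `v` of the frozen network in the parameters of layer `l`. -/
lemma sum_mul_netGrad (p : ℝ) (Θ v : Params N) (x : EuclideanSpace ℝ (Fin N.d))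
    (l : Fin (N.L + 1)) :
    ∑ j : Fin (N.q l), v ⟨l, j⟩ * netGrad p Θ x ⟨l, j⟩ = frozenNet p Θ (mix l Θ v) x := by
  have h1 : mix l Θ v = mix l Θ (∑ j : Fin (N.q l), v ⟨l, j⟩ • Pi.single ⟨l, j⟩ (1 : ℝ)) := by
    funext i
    obtain ⟨l', j'⟩ := i
    by_cases h : l' = l
    · subst h
      simp [mix, Finset.sum_apply, Pi.single_apply]
    · simp [mix, Fin.val_inj, h]
  rw [h1]
  change _ = frozenLin p Θ Θ x l _
  rw [map_sum]
  exact Finset.sum_congr rfl fun j _ => by rw [map_smul, netGrad_eq, smul_eq_mul]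

/-! ### Pooling weights and the frozen network at its base point -/

lemma poolWeight_nonneg (l : ℕ) (y : ℕ → ℝ) (k b : ℕ) : 0 ≤ poolWeight N l y k b := by
  unfold poolWeight
  split_ifs <;> positivity

/-- A nonempty window has a unique first maximizer. -/
lemma exists_first_max (f : ℕ → ℝ) {s : ℕ} (hs : 0 < s) :
    ∃ b < s, (∀ b' < s, f b' ≤ f b) ∧ ∀ b' < b, f b' < f b := by
  classical
  have hex : ∃ b, b < s ∧ ∀ b' < s, f b' ≤ f b := by
    obtain ⟨b, hb, h⟩ := Finset.exists_max_image (Finset.range s) f ⟨0, by simpa using hs⟩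
    exact ⟨b, by simpa using hb, fun b' hb' => h b' (by simpa using hb')⟩
  refine ⟨Nat.find hex, (Nat.find_spec hex).1, (Nat.find_spec hex).2, fun b' hb' => ?_⟩
  have h1 := Nat.find_min hex hb'
  have hb's : b' < s := hb'.trans (Nat.find_spec hex).1
  push Not at h1
  obtain ⟨c, hc, hlt⟩ := h1 hb's
  exact hlt.trans_le ((Nat.find_spec hex).2 c hc)

lemma poolWeight_max_eq {l : ℕ} (hl : N.maxPool l = true) (y : ℕ → ℝ) (k : ℕ) {b₀ : ℕ}
    (h₀ : b₀ < N.kernel l)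
    (h1 : ∀ b' < N.kernel l, y (k * N.kernel l + b') ≤ y (k * N.kernel l + b₀))
    (h2 : ∀ b' < b₀, y (k * N.kernel l + b') < y (k * N.kernel l + b₀)) {b : ℕ}
    (hb : b < N.kernel l) : poolWeight N l y k b = if b = b₀ then 1 else 0 := by
  rw [poolWeight, if_pos hl]
  congr 1
  refine propext ⟨fun h => ?_, ?_⟩
  · rcases lt_trichotomy b b₀ with h' | h' | h'
    · exact absurd (h.1 b₀ h₀) (not_le.2 (h2 b h'))
    · exact h'
    · exact absurd (h1 b hb) (not_le.2 (h.2 b₀ h'))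
  · rintro rfl; exact ⟨h1, h2⟩

lemma sum_poolWeight {l : ℕ} (hl : 0 < N.kernel l) (y : ℕ → ℝ) (k : ℕ) :
    ∑ b ∈ Finset.range (N.kernel l), poolWeight N l y k b = 1 := by
  by_cases h : N.maxPool l = true
  · obtain ⟨b₀, h₀, h1, h2⟩ := exists_first_max (fun b => y (k * N.kernel l + b)) hl
    rw [Finset.sum_congr rfl fun b hb =>
      poolWeight_max_eq h y k h₀ h1 h2 (Finset.mem_range.1 hb)]
    simp [h₀]
  · simp only [poolWeight, if_neg h]
    simp
    field_simp

lemma sum_poolWeight_mul {l : ℕ} (hl : 0 < N.kernel l) (y : ℕ → ℝ) (k : ℕ) :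
    ∑ b ∈ Finset.range (N.kernel l), poolWeight N l y k b * y (k * N.kernel l + b) =
      pool N l y k := by
  by_cases h : N.maxPool l = true
  · obtain ⟨b₀, h₀, h1, h2⟩ := exists_first_max (fun b => y (k * N.kernel l + b)) hl
    rw [Finset.sum_congr rfl fun b hb => by
      rw [poolWeight_max_eq h y k h₀ h1 h2 (Finset.mem_range.1 hb)]]
    have : Nonempty (Fin (N.kernel l)) := ⟨⟨0, hl⟩⟩
    simp only [ite_mul, one_mul, zero_mul, Finset.sum_ite_eq', Finset.mem_range, h₀, if_true,
      pool, if_pos h]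
    exact le_antisymm (le_ciSup (f := fun b : Fin (N.kernel l) => y (k * N.kernel l + b))
      (Set.finite_range _).bddAbove ⟨b₀, h₀⟩) (ciSup_le fun b => h1 b b.2)
  · simp only [poolWeight, pool, if_neg h, Finset.sum_div]
    exact Finset.sum_congr rfl fun b _ => by ring

lemma relu'_mul_self (u : ℝ) : relu' u * u = relu u := by
  unfold relu' relu
  split_ifs with h
  · simp [h.le]
  · simp [not_lt.1 h]

lemma frozenHidden_self (Θ : Params N) (x : EuclideanSpace ℝ (Fin N.d)) (l : ℕ) :
    frozenHidden Θ Θ x l = hidden Θ x l := by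
  induction l with
  | zero => rfl
  | succ l ih =>
    funext k
    rw [frozenHidden_succ, ih, hidden]
    simp only [frozenStep, relu'_mul_self]
    split_ifs with h
    · exact sum_poolWeight_mul (N.kernel_pos l h)
        (fun j => relu (preact Θ l (hidden Θ x l) j)) k
    · rfl

lemma frozenNet_self (p : ℝ) (Θ : Params N) (x : EuclideanSpace ℝ (Fin N.d)) :
    frozenNet p Θ Θ x = net p Θ x := by
  simp only [frozenNet, net, frozenHidden_self]

/-- Euler's identity: the network is homogeneous of degree one in the parameters of each layer. -/
lemma sum_param_mul_netGrad (p : ℝ) (Θ : Params N) (x : EuclideanSpace ℝ (Fin N.d))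
    (l : Fin (N.L + 1)) :
    ∑ j : Fin (N.q l), Θ ⟨l, j⟩ * netGrad p Θ x ⟨l, j⟩ = net p Θ x := by
  rw [sum_mul_netGrad, mix_self, frozenNet_self]

/-! ### Norm bounds for the frozen network -/

/-- The squared Euclidean norm of the parameters of layer `l`. -/
def layerSq (Θ : Params N) (l : ℕ) : ℝ := ∑ j ∈ Finset.range (N.q l), coef Θ l j ^ 2

lemma layerSq_nonneg (Θ : Params N) (l : ℕ) : 0 ≤ layerSq Θ l :=
  Finset.sum_nonneg fun _ _ => sq_nonneg _

lemma coef_fin (Θ : Params N) (l : Fin (N.L + 1)) (j : Fin (N.q l)) :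
    coef Θ l j = Θ ⟨l, j⟩ := by
  rw [coef, dif_pos l.2, dif_pos j.2]

lemma layerSq_fin (Θ : Params N) (l : Fin (N.L + 1)) :
    layerSq Θ l = ∑ j : Fin (N.q l), Θ ⟨l, j⟩ ^ 2 := by
  rw [layerSq, Finset.sum_range]
  exact Finset.sum_congr rfl fun j _ => by rw [coef_fin]

lemma layerSq_mix (l l' : ℕ) (Θ v : Params N) :
    layerSq (mix l Θ v) l' = if l' = l then layerSq v l' else layerSq Θ l' := by
  simp only [layerSq, coef_mix]
  split_ifs <;> rfl

lemma sum_range_mul_eq (f : ℕ → ℝ) (m s : ℕ) :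
    ∑ j ∈ Finset.range (m * s), f j =
      ∑ k ∈ Finset.range m, ∑ c ∈ Finset.range s, f (k * s + c) := by
  induction m with
  | zero => simp
  | succ m ih => rw [Nat.succ_mul, Finset.sum_range_add, Finset.sum_range_succ, ih]

lemma Arch.q_conv {l : ℕ} (h : l < N.LC) : N.q l = N.kernel l := by simp [Arch.q, h]

lemma Arch.q_dense {l : ℕ} (h : ¬ l < N.LC) (h' : l < N.L) :
    N.q l = N.width (l + 1) * N.width l := by
  simp [Arch.q, h, h', mul_comm]

lemma Arch.q_out : N.q N.L = N.m := by
  simp [Arch.q, Arch.L, Arch.m]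

lemma Arch.q_pos {l : ℕ} (h : l ≤ N.L) : 0 < N.q l := by
  have hw : ∀ l, l ≤ N.L → 0 < N.width l := N.width_pos
  unfold Arch.q
  split_ifs with h1 h2
  · exact N.kernel_pos l h1
  · exact Nat.mul_pos (hw _ h) (hw _ h2)
  · exact hw _ le_rfl

lemma preact_conv_sq_le (Θ : Params N) {l : ℕ} (h : l < N.LC) (z : ℕ → ℝ) (k : ℕ) :
    preact Θ l z k ^ 2 ≤ layerSq Θ l * ∑ a ∈ Finset.range (N.kernel l), z (k + a) ^ 2 := by
  rw [preact, if_pos h, layerSq, Arch.q_conv h]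
  exact Finset.sum_mul_sq_le_sq_mul_sq _ _ _

lemma sum_preact_dense_sq_le (Θ : Params N) {l : ℕ} (h : ¬ l < N.LC) (h' : l < N.L)
    (z : ℕ → ℝ) :
    ∑ k ∈ Finset.range (N.width (l + 1)), preact Θ l z k ^ 2 ≤
      layerSq Θ l * ∑ i ∈ Finset.range (N.width l), z i ^ 2 := by
  rw [layerSq, Arch.q_dense h h', sum_range_mul_eq, Finset.sum_mul]
  refine Finset.sum_le_sum fun k _ => ?_
  rw [preact, if_neg h]
  exact Finset.sum_mul_sq_le_sq_mul_sq _ _ _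

lemma relu'_mul_sq_le (u v : ℝ) : (relu' u * v) ^ 2 ≤ v ^ 2 := by
  unfold relu'
  split_ifs
  · simp
  · simpa using sq_nonneg v

/-- The receptive fields `[k s, (k + 2) s - 1)` of the outputs of a convolutional block cover each
entry at most twice. -/
lemma sum_window_le {l : ℕ} (h : l < N.LC) {g : ℕ → ℝ} (hg : ∀ i, 0 ≤ g i) :
    ∑ k ∈ Finset.range (N.width (l + 1)),
        ∑ c ∈ Finset.range (2 * N.kernel l - 1), g (k * N.kernel l + c) ≤
      2 * ∑ i ∈ Finset.range (N.width l), g i := by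
  have hs := N.kernel_pos l h
  have hf := N.conv_fits l h
  set s := N.kernel l
  set w := N.width (l + 1)
  have hsplit : ∀ k, ∑ c ∈ Finset.range (2 * s - 1), g (k * s + c) =
      ∑ c ∈ Finset.range s, g (k * s + c) + ∑ c ∈ Finset.range (s - 1), g ((k * s + c) + s) := by
    intro k
    rw [show 2 * s - 1 = s + (s - 1) by omega, Finset.sum_range_add]
    congr 1
    exact Finset.sum_congr rfl fun c _ => by congr 1; ring
  simp only [hsplit, Finset.sum_add_distrib]
  rw [two_mul]
  have hsub : ∀ n ≤ N.width l, ∑ i ∈ Finset.range n, g i ≤ ∑ i ∈ Finset.range (N.width l), g i :=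
    fun n hn => Finset.sum_le_sum_of_subset_of_nonneg (Finset.range_mono hn) fun i _ _ => hg i
  refine add_le_add ?_ ?_
  · rw [← sum_range_mul_eq]
    exact hsub _ (by omega)
  · rcases Nat.eq_zero_or_pos w with hw | hw
    · rw [hw, Finset.range_zero, Finset.sum_empty]
      exact Finset.sum_nonneg fun i _ => hg i
    obtain ⟨w', hw'⟩ : ∃ w', w = w' + 1 := ⟨w - 1, by omega⟩
    rw [hw', Finset.sum_range_succ]
    have h1 : ∑ k ∈ Finset.range w', ∑ c ∈ Finset.range (s - 1), g (k * s + c + s) ≤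
        ∑ j ∈ Finset.range (w' * s), g (j + s) := by
      rw [sum_range_mul_eq (fun j => g (j + s))]
      exact Finset.sum_le_sum fun k _ => Finset.sum_le_sum_of_subset_of_nonneg
        (Finset.range_mono (by omega)) fun i _ _ => hg _
    have h2 : ∑ j ∈ Finset.range (w' * s), g (j + s) +
        ∑ c ∈ Finset.range (s - 1), g (w' * s + c + s) =
        ∑ j ∈ Finset.range (w' * s + (s - 1)), g (j + s) := by
      rw [Finset.sum_range_add]
    have h3 : ∑ j ∈ Finset.range (w' * s + (s - 1)), g (j + s) ≤
        ∑ i ∈ Finset.range (s + (w' * s + (s - 1))), g i := by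
      rw [Finset.sum_range_add g s]
      simp only [add_comm s]
      exact le_add_of_nonneg_left (Finset.sum_nonneg fun i _ => hg i)
    have h4 : s + (w' * s + (s - 1)) ≤ N.width l := by
      have : w * s = w' * s + s := by rw [hw']; ring
      omega
    linarith [hsub _ h4]

lemma sum_frozenStep_conv_sq_le (Θ₀ Θ : Params N) (x : EuclideanSpace ℝ (Fin N.d)) {l : ℕ}
    (h : l < N.LC) (z : ℕ → ℝ) :
    ∑ k ∈ Finset.range (N.width (l + 1)), frozenStep Θ₀ x l (preact Θ l z) k ^ 2 ≤
      2 * layerSq Θ l * ∑ i ∈ Finset.range (N.width l), z i ^ 2 := by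
  have hpt : ∀ k, frozenStep Θ₀ x l (preact Θ l z) k ^ 2 ≤
      layerSq Θ l * ∑ c ∈ Finset.range (2 * N.kernel l - 1), z (k * N.kernel l + c) ^ 2 := by
    intro k
    simp only [frozenStep, if_pos h]
    set u₀ := preact Θ₀ l (hidden Θ₀ x l)
    set pw := poolWeight N l (fun j => relu (u₀ j)) k
    set v : ℕ → ℝ := fun b => relu' (u₀ (k * N.kernel l + b)) * preact Θ l z (k * N.kernel l + b)
    have hpw : ∀ b, 0 ≤ pw b := fun b => poolWeight_nonneg _ _ _ _
    have hsum : ∑ b ∈ Finset.range (N.kernel l), pw b = 1 := sum_poolWeight (N.kernel_pos l h) _ _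
    set R := layerSq Θ l * ∑ c ∈ Finset.range (2 * N.kernel l - 1), z (k * N.kernel l + c) ^ 2
    have hv : ∀ b ∈ Finset.range (N.kernel l), v b ^ 2 ≤ R := by
      intro b hb
      refine (relu'_mul_sq_le _ _).trans ((preact_conv_sq_le Θ h z _).trans ?_)
      refine mul_le_mul_of_nonneg_left ?_ (layerSq_nonneg _ _)
      have hb := Finset.mem_range.1 hb
      have : Finset.range (b + N.kernel l) ⊆ Finset.range (2 * N.kernel l - 1) :=
        Finset.range_mono (by omega)
      refine le_trans ?_ (Finset.sum_le_sum_of_subset_of_nonneg this fun i _ _ => sq_nonneg _)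
      rw [Finset.sum_range_add]
      simp only [← add_assoc]
      exact le_add_of_nonneg_left (Finset.sum_nonneg fun i _ => sq_nonneg _)
    have hcs := (convexOn_pow 2).map_sum_le (t := Finset.range (N.kernel l)) (w := pw)
      (p := fun b => |v b|) (fun b _ => hpw b) hsum (fun b _ => Set.mem_Ici.2 (abs_nonneg _))
    simp only [smul_eq_mul, sq_abs] at hcs
    have habs : |∑ b ∈ Finset.range (N.kernel l), pw b * v b| ≤
        ∑ b ∈ Finset.range (N.kernel l), pw b * |v b| :=
      (Finset.abs_sum_le_sum_abs _ _).trans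
        (Finset.sum_le_sum fun b _ => by rw [abs_mul, abs_of_nonneg (hpw b)])
    calc (∑ b ∈ Finset.range (N.kernel l), pw b * v b) ^ 2
        ≤ (∑ b ∈ Finset.range (N.kernel l), pw b * |v b|) ^ 2 := by
          rw [← sq_abs]; gcongr
      _ ≤ _ := hcs
      _ ≤ ∑ b ∈ Finset.range (N.kernel l), pw b * R :=
          Finset.sum_le_sum fun b hb => mul_le_mul_of_nonneg_left (hv b hb) (hpw b)
      _ = R := by rw [← Finset.sum_mul, hsum, one_mul]
  refine (Finset.sum_le_sum fun k _ => hpt k).trans ?_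
  rw [← Finset.mul_sum, mul_comm 2 (layerSq Θ l), mul_assoc]
  exact mul_le_mul_of_nonneg_left (sum_window_le h fun i => sq_nonneg (z i)) (layerSq_nonneg _ _)

lemma sum_input_sq (x : EuclideanSpace ℝ (Fin N.d)) :
    ∑ i ∈ Finset.range (N.width 0), input x i ^ 2 = ‖x‖ ^ 2 := by
  change ∑ i ∈ Finset.range N.d, input x i ^ 2 = _
  rw [EuclideanSpace.norm_sq_eq, Finset.sum_range]
  exact Finset.sum_congr rfl fun i _ => by simp [input]

lemma sum_frozenHidden_sq_le (Θ₀ Θ : Params N) (x : EuclideanSpace ℝ (Fin N.d)) {j : ℕ}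
    (hj : j ≤ N.L) :
    ∑ k ∈ Finset.range (N.width j), frozenHidden Θ₀ Θ x j k ^ 2 ≤
      2 ^ j * (∏ l ∈ Finset.range j, layerSq Θ l) * ‖x‖ ^ 2 := by
  induction j with
  | zero => simpa [frozenHidden] using (sum_input_sq x).le
  | succ j ih =>
    have ih := ih (by omega)
    have hstep : ∑ k ∈ Finset.range (N.width (j + 1)), frozenHidden Θ₀ Θ x (j + 1) k ^ 2 ≤
        2 * layerSq Θ j * ∑ i ∈ Finset.range (N.width j), frozenHidden Θ₀ Θ x j i ^ 2 := by
      rw [frozenHidden_succ]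
      by_cases h : j < N.LC
      · exact sum_frozenStep_conv_sq_le Θ₀ Θ x h _
      · have h0 := sum_preact_dense_sq_le Θ h (by omega) (frozenHidden Θ₀ Θ x j)
        have h1 : 0 ≤ layerSq Θ j * ∑ i ∈ Finset.range (N.width j),
            frozenHidden Θ₀ Θ x j i ^ 2 :=
          mul_nonneg (layerSq_nonneg _ _) (Finset.sum_nonneg fun i _ => sq_nonneg _)
        calc _ ≤ ∑ k ∈ Finset.range (N.width (j + 1)),
              preact Θ j (frozenHidden Θ₀ Θ x j) k ^ 2 := by
              refine Finset.sum_le_sum fun k _ => ?_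
              simp only [frozenStep, if_neg h]
              exact relu'_mul_sq_le _ _
          _ ≤ _ := by linarith
    refine hstep.trans ((mul_le_mul_of_nonneg_left ih
      (mul_nonneg zero_le_two (layerSq_nonneg _ _))).trans (le_of_eq ?_))
    rw [Finset.prod_range_succ]
    ring

lemma frozenNet_sq_le (p : ℝ) (Θ₀ Θ : Params N) (x : EuclideanSpace ℝ (Fin N.d)) :
    frozenNet p Θ₀ Θ x ^ 2 ≤
      (1 / (N.m : ℝ) ^ p) ^ 2 *
        (2 ^ N.L * (∏ l ∈ Finset.range (N.L + 1), layerSq Θ l) * ‖x‖ ^ 2) := by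
  rw [frozenNet, mul_pow]
  refine mul_le_mul_of_nonneg_left ?_ (sq_nonneg _)
  refine (Finset.sum_mul_sq_le_sq_mul_sq _ _ _).trans ?_
  have h1 : ∑ i ∈ Finset.range N.m, coef Θ N.L i ^ 2 = layerSq Θ N.L := by
    rw [layerSq, Arch.q_out]
  rw [h1, Finset.prod_range_succ]
  refine (mul_le_mul_of_nonneg_left (sum_frozenHidden_sq_le Θ₀ Θ x le_rfl)
    (layerSq_nonneg _ _)).trans (le_of_eq ?_)
  ring

/-- The gradient with respect to one layer is controlled by the norms of the other layers. -/
lemma sum_netGrad_sq_le (p : ℝ) (Θ : Params N) (x : EuclideanSpace ℝ (Fin N.d))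
    (hx : ‖x‖ ≤ 1) (l : Fin (N.L + 1)) {R : ℝ} (hR : ∀ l' ≤ N.L, layerSq Θ l' ≤ R) :
    ∑ j : Fin (N.q l), netGrad p Θ x ⟨l, j⟩ ^ 2 ≤
      (1 / (N.m : ℝ) ^ p) ^ 2 * (2 ^ N.L * R ^ N.L) := by
  set g : Params N := fun i => netGrad p Θ x i
  set G := ∑ j : Fin (N.q l), netGrad p Θ x ⟨l, j⟩ ^ 2
  have hG0 : 0 ≤ G := Finset.sum_nonneg fun _ _ => sq_nonneg _
  have h1 : G = frozenNet p Θ (mix l Θ g) x := by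
    rw [← sum_mul_netGrad]
    exact Finset.sum_congr rfl fun j _ => sq _
  have h2 := frozenNet_sq_le p Θ (mix l Θ g) x
  have hlG : layerSq g l = G := layerSq_fin _ _
  have hl : (l : ℕ) ∈ Finset.range (N.L + 1) := Finset.mem_range.2 l.2
  have hprod : ∏ l' ∈ Finset.range (N.L + 1), layerSq (mix l Θ g) l' ≤ G * R ^ N.L := by
    rw [← Finset.mul_prod_erase _ _ hl, layerSq_mix, if_pos rfl, hlG]
    refine mul_le_mul_of_nonneg_left ?_ hG0
    calc ∏ l' ∈ (Finset.range (N.L + 1)).erase l, layerSq (mix l Θ g) l'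
        ≤ ∏ l' ∈ (Finset.range (N.L + 1)).erase (l : ℕ), R := by
          refine Finset.prod_le_prod (fun _ _ => layerSq_nonneg _ _) fun l' hl' => ?_
          rw [layerSq_mix, if_neg (Finset.ne_of_mem_erase hl')]
          exact hR l' (Nat.lt_succ_iff.1 (Finset.mem_range.1 (Finset.mem_of_mem_erase hl')))
      _ = R ^ N.L := by
          rw [Finset.prod_const, Finset.card_erase_of_mem hl, Finset.card_range]; rfl
  have hR0 : 0 ≤ R := (layerSq_nonneg Θ 0).trans (hR 0 (Nat.zero_le _))
  have hx2 : ‖x‖ ^ 2 ≤ 1 := by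
    have := norm_nonneg x
    nlinarith
  have h3 : G ^ 2 ≤ G * ((1 / (N.m : ℝ) ^ p) ^ 2 * (2 ^ N.L * R ^ N.L)) := by
    rw [← h1] at h2
    refine h2.trans ?_
    have h4 : 2 ^ N.L * (∏ l' ∈ Finset.range (N.L + 1), layerSq (mix l Θ g) l') * ‖x‖ ^ 2 ≤
        2 ^ N.L * (G * R ^ N.L) * 1 := by
      gcongr
    calc _ ≤ (1 / (N.m : ℝ) ^ p) ^ 2 * (2 ^ N.L * (G * R ^ N.L) * 1) := by gcongr
      _ = _ := by ring
  rcases hG0.eq_or_lt with h0 | h0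
  · rw [← h0]; positivity
  · rw [sq] at h3
    exact le_of_mul_le_mul_left h3 h0

/-! ### Rademacher averages along a list of vectors -/

/-- The average of `Ψ (v ± F₁ ± ⋯ ± Fₖ)` over all choices of signs, for the list
`l = [F₁, …, Fₖ]`. -/
def signAvg {V : Type*} [AddCommGroup V] : List V → (V → ℝ) → V → ℝ
  | [], Ψ, v => Ψ v
  | F :: l, Ψ, v => (signAvg l Ψ (v + F) + signAvg l Ψ (v - F)) / 2

section signAvg

variable {V W : Type*} [AddCommGroup V] [AddCommGroup W]

lemma signAvg_mono {Ψ Ψ' : V → ℝ} (h : ∀ v, Ψ v ≤ Ψ' v) (l : List V) (v : V) :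
    signAvg l Ψ v ≤ signAvg l Ψ' v := by
  induction l generalizing v with
  | nil => exact h v
  | cons F l ih => simp only [signAvg]; linarith [ih (v + F), ih (v - F)]

lemma signAvg_append (l₁ l₂ : List V) (Ψ : V → ℝ) (v : V) :
    signAvg (l₁ ++ l₂) Ψ v = signAvg l₁ (signAvg l₂ Ψ) v := by
  induction l₁ generalizing v with
  | nil => rfl
  | cons F l ih => simp only [List.cons_append, signAvg, ih]

lemma signAvg_cons (F : V) (l : List V) (Ψ : V → ℝ) (v : V) :
    signAvg (F :: l) Ψ v = signAvg [F] (signAvg l Ψ) v := rfl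

lemma signAvg_singleton_comm (F : V) (l : List V) (Ψ : V → ℝ) (v : V) :
    signAvg l (signAvg [F] Ψ) v = signAvg [F] (signAvg l Ψ) v := by
  induction l generalizing v with
  | nil => rfl
  | cons G l ih =>
    simp only [signAvg] at ih ⊢
    rw [ih, ih, add_right_comm v G F, sub_add_eq_add_sub v G F, add_sub_right_comm v G F,
      sub_right_comm v G F]
    ring

lemma signAvg_comm (l l' : List V) (Ψ : V → ℝ) (v : V) :
    signAvg l (signAvg l' Ψ) v = signAvg l' (signAvg l Ψ) v := by
  induction l' generalizing v with
  | nil => rfl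
  | cons G l' ih =>
    rw [show signAvg (G :: l') Ψ = signAvg [G] (signAvg l' Ψ) from rfl, signAvg_singleton_comm,
      show signAvg l (signAvg l' Ψ) = signAvg l' (signAvg l Ψ) from funext ih]
    rfl

lemma signAvg_add (l : List V) (Ψ Ψ' : V → ℝ) (v : V) :
    signAvg l (fun w => Ψ w + Ψ' w) v = signAvg l Ψ v + signAvg l Ψ' v := by
  induction l generalizing v with
  | nil => rfl
  | cons G l ih => simp only [signAvg, ih]; ring

lemma signAvg_const_mul (l : List V) (c : ℝ) (Ψ : V → ℝ) (v : V) :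
    signAvg l (fun w => c * Ψ w) v = c * signAvg l Ψ v := by
  induction l generalizing v with
  | nil => rfl
  | cons G l ih => simp only [signAvg, ih]; ring

lemma signAvg_const (l : List V) (c : ℝ) (v : V) : signAvg l (fun _ => c) v = c := by
  induction l generalizing v with
  | nil => rfl
  | cons G l ih => simp only [signAvg, ih]; ring

lemma signAvg_sum {ι : Type*} (s : Finset ι) (l : List V) (Ψ : ι → V → ℝ) (v : V) :
    signAvg l (fun w => ∑ i ∈ s, Ψ i w) v = ∑ i ∈ s, signAvg l (Ψ i) v := by
  induction l generalizing v with
  | nil => rfl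
  | cons G l ih =>
    simp only [signAvg, ih, ← Finset.sum_add_distrib, Finset.sum_div]

lemma signAvg_neg (l : List V) (Ψ : V → ℝ) (v : V) :
    signAvg l (fun w => Ψ (-w)) v = signAvg l Ψ (-v) := by
  induction l generalizing v with
  | nil => rfl
  | cons G l ih =>
    simp only [signAvg, ih]
    rw [neg_add, neg_sub, add_comm, ← sub_eq_add_neg, sub_eq_add_neg G v, add_comm G]

lemma signAvg_map (f : V →+ W) (l : List V) (Ψ : W → ℝ) (v : V) :
    signAvg (l.map f) Ψ (f v) = signAvg l (fun w => Ψ (f w)) v := by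
  induction l generalizing v with
  | nil => rfl
  | cons G l ih => simp only [List.map_cons, signAvg, ← ih, map_add, map_sub]

/-- Linear images of a list of vectors, compared through functionals `Ψ ∘ f ≤ Ψ'`. -/
lemma signAvg_map_le (f : V →+ W) (l : List V) {Ψ : W → ℝ} {Ψ' : V → ℝ}
    (h : ∀ v, Ψ (f v) ≤ Ψ' v) : signAvg (l.map f) Ψ 0 ≤ signAvg l Ψ' 0 := by
  rw [← map_zero f, signAvg_map]
  exact signAvg_mono h _ _

/-- If each vector `F j` may be replaced by the block `T j`, then all of them may be replaced
simultaneously. -/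
lemma signAvg_blocks {α : Type*} (js : List α) (F : α → V) (T : α → List V) {Φ : V → ℝ}
    (h : ∀ j ∈ js, ∀ v, signAvg [F j] Φ v ≤ signAvg (T j) Φ v) (v : V) :
    signAvg (js.map F) Φ v ≤ signAvg (js.flatMap T) Φ v := by
  induction js generalizing v with
  | nil => rfl
  | cons j js ih =>
    rw [List.map_cons, List.flatMap_cons, signAvg_append, signAvg_cons]
    calc signAvg [F j] (signAvg (js.map F) Φ) v
        = signAvg (js.map F) (signAvg [F j] Φ) v := (signAvg_singleton_comm _ _ _ _).symm
      _ ≤ signAvg (js.map F) (signAvg (T j) Φ) v := signAvg_mono (h j (by simp)) _ _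
      _ = signAvg (T j) (signAvg (js.map F) Φ) v := signAvg_comm _ _ _ _
      _ ≤ _ := signAvg_mono (ih fun j hj => h j (by simp [hj])) _ _

end signAvg

/-! ### Contraction for exponential moments of suprema -/

section expSup

variable {I : Type*} [Finite I] [Nonempty I]

/-- The exponential of the supremum of a finite family. -/
def expSup (v : I → ℝ) : ℝ := Real.exp (⨆ τ, v τ)

/-- The exponential of the supremum of the absolute values of a finite family. -/
def expSupAbs (v : I → ℝ) : ℝ := Real.exp (⨆ τ, |v τ|)

omit [Nonempty I] in
lemma le_iSup_fin (v : I → ℝ) (τ : I) : v τ ≤ ⨆ τ, v τ :=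
  le_ciSup (Set.finite_range v).bddAbove τ

lemma exists_eq_iSup_fin (v : I → ℝ) : ∃ τ, v τ = ⨆ τ, v τ :=
  exists_eq_ciSup_of_finite

omit [Nonempty I] in
lemma exp_le_expSup (v : I → ℝ) (τ : I) : Real.exp (v τ) ≤ expSup v :=
  Real.exp_le_exp.2 (le_iSup_fin v τ)

lemma exists_exp_eq_expSup (v : I → ℝ) : ∃ τ, expSup v = Real.exp (v τ) := by
  obtain ⟨τ, h⟩ := exists_eq_iSup_fin v
  exact ⟨τ, by rw [expSup, h]⟩

lemma expSup_comb_le {v w u : I → ℝ} {a b : ℝ} (ha : 0 ≤ a) (hb : 0 ≤ b) (hab : a + b = 1)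
    (hu : ∀ τ, u τ = a * v τ + b * w τ) : expSup u ≤ a * expSup v + b * expSup w := by
  obtain ⟨τ, h⟩ := exists_exp_eq_expSup u
  rw [h, hu]
  have := convexOn_exp.2 (Set.mem_univ (v τ)) (Set.mem_univ (w τ)) ha hb hab
  simp only [smul_eq_mul] at this
  refine this.trans ?_
  gcongr
  · exact exp_le_expSup v τ
  · exact exp_le_expSup w τ

omit [Finite I] [Nonempty I] in
lemma exp_sub_exp_le {a b a' b' : ℝ} (h1 : b ≤ b') (h2 : 0 ≤ a - b) (h3 : a - b ≤ a' - b') :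
    Real.exp a - Real.exp b ≤ Real.exp a' - Real.exp b' := by
  have e1 : Real.exp a = Real.exp b * Real.exp (a - b) := by rw [← Real.exp_add]; ring_nf
  have e2 : Real.exp a' = Real.exp b' * Real.exp (a' - b') := by rw [← Real.exp_add]; ring_nf
  have h4 : Real.exp (a - b) ≤ Real.exp (a' - b') := Real.exp_le_exp.2 h3
  have h5 : 1 ≤ Real.exp (a - b) := Real.one_le_exp h2
  have h6 : Real.exp b ≤ Real.exp b' := Real.exp_le_exp.2 h1
  rw [e1, e2]
  nlinarith [Real.exp_pos b]

/-- The Ledoux–Talagrand contraction principle for one random sign. -/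
lemma signAvg_contraction {F T : I → ℝ} (hlip : ∀ τ τ', |F τ - F τ'| ≤ |T τ - T τ'|)
    (hzero : ∀ τ, |F τ| ≤ |T τ|) (A : I → ℝ) :
    signAvg [F] expSup A ≤ signAvg [T] expSup A := by
  simp only [signAvg]
  obtain ⟨t, ht⟩ := exists_eq_iSup_fin (A + F)
  obtain ⟨s, hs⟩ := exists_eq_iSup_fin (A - F)
  have h1 : A s + F s ≤ A t + F t := by
    have := le_iSup_fin (A + F) s; rw [← ht] at this; simpa using this
  have h2 : A t - F t ≤ A s - F s := by
    have := le_iSup_fin (A - F) t; rw [← hs] at this; simpa using this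
  have pl : ∀ τ, Real.exp (A τ + T τ) ≤ expSup (A + T) := fun τ => exp_le_expSup (A + T) τ
  have mi : ∀ τ, Real.exp (A τ - T τ) ≤ expSup (A - T) := fun τ => exp_le_expSup (A - T) τ
  have e1 : expSup (A + F) = Real.exp (A t + F t) := by rw [expSup, ← ht]; rfl
  have e2 : expSup (A - F) = Real.exp (A s - F s) := by rw [expSup, ← hs]; rfl
  rw [e1, e2]
  have hl := abs_le.1 (hlip t s)
  have zt := abs_le.1 (hzero t)
  have zs := abs_le.1 (hzero s)
  suffices h : Real.exp (A t + F t) + Real.exp (A s - F s) ≤ expSup (A + T) + expSup (A - T) by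
    linarith
  have case1 : ∀ x y : ℝ, Real.exp x + Real.exp y ≤
      Real.exp (A t + T t) + Real.exp (A s - T s) →
      Real.exp x + Real.exp y ≤ expSup (A + T) + expSup (A - T) := fun x y h => by
    linarith [pl t, mi s]
  have case2 : ∀ x y : ℝ, Real.exp x + Real.exp y ≤
      Real.exp (A t - T t) + Real.exp (A s + T s) →
      Real.exp x + Real.exp y ≤ expSup (A + T) + expSup (A - T) := fun x y h => by
    linarith [pl s, mi t]
  rcases le_total 0 (T t) with ht0 | ht0 <;> rcases le_total 0 (T s) with hs0 | hs0
  · rw [abs_of_nonneg ht0] at zt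
    rw [abs_of_nonneg hs0] at zs
    rcases le_total (T s) (T t) with hc | hc
    · rw [abs_of_nonneg (sub_nonneg.2 hc)] at hl
      apply case1
      have := exp_sub_exp_le (a := A s - F s) (b := A s - T s) (a' := A t + T t)
        (b' := A t + F t) (by linarith) (by linarith) (by linarith)
      linarith
    · rw [abs_of_nonpos (sub_nonpos.2 hc)] at hl
      apply case2
      have := exp_sub_exp_le (a := A t + F t) (b := A t - T t) (a' := A s + T s)
        (b' := A s - F s) (by linarith) (by linarith) (by linarith)
      linarith
  · rw [abs_of_nonneg ht0] at zt
    rw [abs_of_nonpos hs0] at zs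
    apply case1
    have h3 : Real.exp (A t + F t) ≤ Real.exp (A t + T t) := Real.exp_le_exp.2 (by linarith)
    have h4 : Real.exp (A s - F s) ≤ Real.exp (A s - T s) := Real.exp_le_exp.2 (by linarith)
    linarith
  · rw [abs_of_nonpos ht0] at zt
    rw [abs_of_nonneg hs0] at zs
    apply case2
    have h3 : Real.exp (A t + F t) ≤ Real.exp (A t - T t) := Real.exp_le_exp.2 (by linarith)
    have h4 : Real.exp (A s - F s) ≤ Real.exp (A s + T s) := Real.exp_le_exp.2 (by linarith)
    linarith
  · rw [abs_of_nonpos ht0] at zt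
    rw [abs_of_nonpos hs0] at zs
    rcases le_total (T s) (T t) with hc | hc
    · rw [abs_of_nonneg (sub_nonneg.2 hc)] at hl
      apply case1
      have := exp_sub_exp_le (a := A t + F t) (b := A t + T t) (a' := A s - T s)
        (b' := A s - F s) (by linarith) (by linarith) (by linarith)
      linarith
    · rw [abs_of_nonpos (sub_nonpos.2 hc)] at hl
      apply case2
      have := exp_sub_exp_le (a := A s - F s) (b := A s + T s) (a' := A t - T t)
        (b' := A t + F t) (by linarith) (by linarith) (by linarith)
      linarith

/-- A sign on a convex combination of two vectors may be replaced by independent signs. -/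
lemma signAvg_comb_le (U V W : I → ℝ) {a b : ℝ} (ha : 0 ≤ a) (hb : 0 ≤ b) (hab : a + b = 1)
    (hW : ∀ τ, W τ = a * U τ + b * V τ) (A : I → ℝ) :
    signAvg [W] expSup A ≤ signAvg [U, V] expSup A := by
  have key : ∀ A U V : I → ℝ, expSup (A + U) ≤ (expSup (A + U + V) + expSup (A + U - V)) / 2 := by
    intro A U V
    have := expSup_comb_le (u := A + U) (v := A + U + V) (w := A + U - V) (a := 1 / 2)
      (b := 1 / 2) (by norm_num) (by norm_num) (by norm_num) fun τ => by
        simp only [Pi.add_apply, Pi.sub_apply]; ring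
    linarith
  have e1 : expSup (A + W) ≤ a * expSup (A + U) + b * expSup (A + V) :=
    expSup_comb_le ha hb hab fun τ => by
      simp only [Pi.add_apply, hW]
      linear_combination (-A τ) * hab
  have e2 : expSup (A - W) ≤ a * expSup (A - U) + b * expSup (A - V) :=
    expSup_comb_le ha hb hab fun τ => by
      simp only [Pi.sub_apply, hW]
      linear_combination (-A τ) * hab
  have k1 := key A U V
  have k2 := key A V U
  have k3 := key A (-U) V
  have k4 := key A (-V) U
  simp only [← sub_eq_add_neg] at k3 k4
  rw [add_right_comm] at k2
  rw [show A + V - U = A - U + V by abel] at k2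
  rw [show A - V + U = A + U - V by abel, sub_right_comm] at k4
  simp only [signAvg]
  set X1 := expSup (A + U + V)
  set X2 := expSup (A + U - V)
  set X3 := expSup (A - U + V)
  set X4 := expSup (A - U - V)
  have hU : expSup (A + U) + expSup (A - U) ≤ (X1 + X2) / 2 + (X3 + X4) / 2 := by linarith
  have hV : expSup (A + V) + expSup (A - V) ≤ (X1 + X2) / 2 + (X3 + X4) / 2 := by linarith
  have := mul_le_mul_of_nonneg_left hU ha
  have := mul_le_mul_of_nonneg_left hV hb
  have e3 : expSup (A + W) + expSup (A - W) ≤ (a + b) * ((X1 + X2) / 2 + (X3 + X4) / 2) := by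
    linarith
  rw [hab] at e3
  linarith

/-- A sign on the maximum of two vectors may be replaced by independent signs: write
`max u v = (u + v) / 2 + |u - v| / 2`, and use that `ε₁ u + ε₂ v` is `ε (u + v)` or `ε (u - v)`
with equal probabilities. -/
lemma signAvg_max_le (U V : I → ℝ) (A : I → ℝ) :
    signAvg [fun τ => max (U τ) (V τ)] expSup A ≤ signAvg [U, V] expSup A := by
  set W : I → ℝ := fun τ => max (U τ) (V τ)
  have hW : ∀ τ, W τ = 1 / 2 * (U τ + V τ) + 1 / 2 * |U τ - V τ| := fun τ => by
    simp only [W]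
    rcases le_total (U τ) (V τ) with h | h
    · rw [max_eq_right h, abs_of_nonpos (sub_nonpos.2 h)]; ring
    · rw [max_eq_left h, abs_of_nonneg (sub_nonneg.2 h)]; ring
  set D : I → ℝ := fun τ => |U τ - V τ|
  have hc := signAvg_contraction (F := D) (T := U - V)
    (fun τ τ' => abs_abs_sub_abs_le _ _) (fun τ => (abs_abs _).le) A
  have e1 : expSup (A + W) ≤ 1 / 2 * expSup (A + (U + V)) + 1 / 2 * expSup (A + D) :=
    expSup_comb_le (by norm_num) (by norm_num) (by norm_num) fun τ => by
      simp only [Pi.add_apply, hW, D]; ring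
  have e2 : expSup (A - W) ≤ 1 / 2 * expSup (A - (U + V)) + 1 / 2 * expSup (A - D) :=
    expSup_comb_le (by norm_num) (by norm_num) (by norm_num) fun τ => by
      simp only [Pi.add_apply, Pi.sub_apply, hW, D]; ring
  simp only [signAvg] at hc ⊢
  rw [show A + U + V = A + (U + V) by abel, show A - U - V = A - (U + V) by abel,
    show A + U - V = A + (U - V) by abel, show A - U + V = A - (U - V) by abel]
  linarith

/-- Pooling a nonempty window: the sign of the pooled entry may be replaced by independent signs
of all the entries of the window. -/
lemma signAvg_iSup_le {s : ℕ} (hs : 0 < s) (y : Fin s → I → ℝ) (A : I → ℝ) :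
    signAvg [fun τ => ⨆ b, y b τ] expSup A ≤ signAvg (List.ofFn y) expSup A := by
  induction s, hs using Nat.le_induction generalizing A with
  | base => simp [List.ofFn_succ]
  | succ s hs ih =>
    have : NeZero s := ⟨by omega⟩
    have e : (fun τ => ⨆ b, y b τ) = fun τ => max (y 0 τ) (⨆ b : Fin s, y b.succ τ) := by
      funext τ
      refine le_antisymm (ciSup_le fun b => ?_) (max_le (le_iSup_fin (fun b => y b τ) 0)
        (ciSup_le fun b => le_iSup_fin (fun b => y b τ) b.succ))
      refine Fin.cases (le_max_left _ _) (fun b => ?_) b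
      exact (le_iSup_fin (fun b : Fin s => y b.succ τ) b).trans (le_max_right _ _)
    rw [e, List.ofFn_succ, signAvg_cons]
    exact (signAvg_max_le _ _ A).trans (signAvg_mono (l := [y 0]) (ih _) A)

lemma signAvg_avg_le {s : ℕ} (hs : 0 < s) (y : Fin s → I → ℝ) (A : I → ℝ) :
    signAvg [fun τ => (∑ b, y b τ) / s] expSup A ≤ signAvg (List.ofFn y) expSup A := by
  induction s, hs using Nat.le_induction generalizing A with
  | base => simp [List.ofFn_succ]
  | succ s hs ih =>
    have hs' : (s : ℝ) ≠ 0 := by positivity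
    rw [List.ofFn_succ, signAvg_cons]
    refine (signAvg_comb_le (y 0) (fun τ => (∑ b : Fin s, y b.succ τ) / s) _
      (a := 1 / (s + 1)) (b := s / (s + 1)) (by positivity) (by positivity) (by field_simp; ring)
      (fun τ => ?_) A).trans (signAvg_mono (l := [y 0]) (ih _) A)
    rw [Fin.sum_univ_succ]
    push_cast
    field_simp

lemma expSupAbs_le (v : I → ℝ) : expSupAbs v ≤ expSup v + expSup (-v) := by
  obtain ⟨τ, h⟩ := exists_eq_iSup_fin (fun τ => |v τ|)
  rw [expSupAbs, ← h]
  rcases le_total 0 (v τ) with h0 | h0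
  · rw [abs_of_nonneg h0]
    exact (exp_le_expSup v τ).trans (le_add_of_nonneg_right (Real.exp_pos _).le)
  · rw [abs_of_nonpos h0]
    exact (exp_le_expSup (-v) τ).trans (le_add_of_nonneg_left (Real.exp_pos _).le)

lemma signAvg_expSupAbs_le (l : List (I → ℝ)) :
    signAvg l expSupAbs 0 ≤ 2 * signAvg l expSup 0 := by
  refine (signAvg_mono expSupAbs_le l 0).trans (le_of_eq ?_)
  rw [signAvg_add, signAvg_neg, neg_zero, two_mul]

end expSup

/-! ### Exponential moments of Rademacher sums -/

lemma signAvg_exp_le (l : List ℝ) (v : ℝ) :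
    signAvg l Real.exp v ≤ Real.exp v * Real.exp ((l.map fun c => c ^ 2 / 2).sum) := by
  induction l generalizing v with
  | nil => simp [signAvg]
  | cons c l ih =>
    simp only [signAvg, List.map_cons, List.sum_cons]
    set E := Real.exp ((l.map fun c => c ^ 2 / 2).sum)
    have hE : 0 < E := Real.exp_pos _
    have hc := Real.cosh_le_exp_half_sq c
    have h1 := ih (v + c)
    have h2 := ih (v - c)
    rw [Real.exp_add] at h1
    rw [sub_eq_add_neg, Real.exp_add, ← sub_eq_add_neg] at h2
    have h3 : (Real.exp v * Real.exp c * E + Real.exp v * Real.exp (-c) * E) / 2 =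
        Real.exp v * E * Real.cosh c := by rw [Real.cosh_eq]; ring
    calc _ ≤ Real.exp v * E * Real.cosh c := by linarith
      _ ≤ Real.exp v * E * Real.exp (c ^ 2 / 2) := by gcongr
      _ = _ := by rw [Real.exp_add]; ring

lemma pow_add_pow_le_of_abs_le {a c θ : ℝ} (hc : 2 * c ≤ a) (hθ : |θ| ≤ c) (n : ℕ) :
    (a + 2 * θ) ^ n + (a - 2 * θ) ^ n ≤ (a + 2 * c) ^ n + (a - 2 * c) ^ n := by
  obtain ⟨h1, h2⟩ := abs_le.1 hθ
  have hc0 : 0 ≤ c := (abs_nonneg θ).trans hθ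
  rcases hc0.eq_or_lt with h0 | h0
  · have : θ = 0 := by linarith
    rw [this, ← h0]
  set s := (c + θ) / (2 * c)
  set t := (c - θ) / (2 * c)
  have hs : 0 ≤ s := div_nonneg (by linarith) (by linarith)
  have ht : 0 ≤ t := div_nonneg (by linarith) (by linarith)
  have hst : s + t = 1 := by simp only [s, t]; field_simp; ring
  have hx : (a + 2 * c) ∈ Set.Ici (0 : ℝ) := Set.mem_Ici.2 (by linarith)
  have hy : (a - 2 * c) ∈ Set.Ici (0 : ℝ) := Set.mem_Ici.2 (by linarith)
  have e1 := (convexOn_pow n).2 hx hy hs ht hst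
  have e2 := (convexOn_pow n).2 hx hy ht hs (by rw [add_comm]; exact hst)
  simp only [smul_eq_mul] at e1 e2
  have e3 : s * (a + 2 * c) + t * (a - 2 * c) = a + 2 * θ := by simp only [s, t]; field_simp; ring
  have e4 : t * (a + 2 * c) + s * (a - 2 * c) = a - 2 * θ := by simp only [s, t]; field_simp; ring
  rw [e3] at e1
  rw [e4] at e2
  have e5 : s * (a + 2 * c) ^ n + t * (a - 2 * c) ^ n + (t * (a + 2 * c) ^ n + s * (a - 2 * c) ^ n)
      = (a + 2 * c) ^ n + (a - 2 * c) ^ n := by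
    linear_combination ((a + 2 * c) ^ n + (a - 2 * c) ^ n) * hst
  linarith

/-- In a Hilbert space `cosh ‖·‖` behaves under a random sign as on the line: `cosh √·` is a power
series with nonnegative coefficients, so that the left-hand side is largest for parallel vectors. -/
lemma cosh_norm_add_le {E : Type*} [NormedAddCommGroup E] [InnerProductSpace ℝ E] (u v : E) :
    Real.cosh ‖u + v‖ + Real.cosh ‖u - v‖ ≤ 2 * (Real.cosh ‖u‖ * Real.cosh ‖v‖) := by
  have hrhs : 2 * (Real.cosh ‖u‖ * Real.cosh ‖v‖) =
      Real.cosh (‖u‖ + ‖v‖) + Real.cosh (‖u‖ - ‖v‖) := by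
    rw [Real.cosh_add, Real.cosh_sub]; ring
  rw [hrhs]
  refine hasSum_le (fun n => ?_) ((Real.hasSum_cosh _).add (Real.hasSum_cosh _))
    ((Real.hasSum_cosh _).add (Real.hasSum_cosh _))
  rw [← add_div, ← add_div]
  gcongr ?_ / _
  simp only [pow_mul]
  have h := pow_add_pow_le_of_abs_le (a := ‖u‖ ^ 2 + ‖v‖ ^ 2) (c := ‖u‖ * ‖v‖)
    (θ := inner ℝ u v) (by nlinarith [sq_nonneg (‖u‖ - ‖v‖)]) (abs_real_inner_le_norm u v) n
  have e1 : ‖u + v‖ ^ 2 = ‖u‖ ^ 2 + ‖v‖ ^ 2 + 2 * inner ℝ u v := by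
    rw [norm_add_sq_real]; ring
  have e2 : ‖u - v‖ ^ 2 = ‖u‖ ^ 2 + ‖v‖ ^ 2 - 2 * inner ℝ u v := by
    rw [norm_sub_sq_real]; ring
  have e3 : (‖u‖ + ‖v‖) ^ 2 = ‖u‖ ^ 2 + ‖v‖ ^ 2 + 2 * (‖u‖ * ‖v‖) := by ring
  have e4 : (‖u‖ - ‖v‖) ^ 2 = ‖u‖ ^ 2 + ‖v‖ ^ 2 - 2 * (‖u‖ * ‖v‖) := by ring
  rw [e1, e2, e3, e4]
  exact h

lemma signAvg_cosh_norm_le {E : Type*} [NormedAddCommGroup E] [InnerProductSpace ℝ E] {M : ℝ}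
    (l : List E) (hl : ∀ x ∈ l, ‖x‖ ≤ 1) (v : E) :
    signAvg l (fun v => Real.cosh (M * ‖v‖)) v ≤
      Real.cosh (M * ‖v‖) * Real.exp (M ^ 2 * l.length / 2) := by
  have hM : ∀ w : E, Real.cosh (M * ‖w‖) = Real.cosh ‖M • w‖ := fun w => by
    rw [norm_smul, Real.norm_eq_abs, ← Real.cosh_abs, abs_mul, abs_norm]
  induction l generalizing v with
  | nil => simp [signAvg]
  | cons x l ih =>
    have ih := ih fun y hy => hl y (by simp [hy])
    simp only [signAvg]
    set E := Real.exp (M ^ 2 * l.length / 2)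
    have hE : 0 < E := Real.exp_pos _
    have h1 := cosh_norm_add_le (M • v) (M • x)
    rw [← smul_add, ← smul_sub, ← hM, ← hM, ← hM, ← hM] at h1
    have h2 : Real.cosh (M * ‖x‖) ≤ Real.exp (M ^ 2 / 2) := by
      refine (Real.cosh_le_exp_half_sq _).trans (Real.exp_le_exp.2 ?_)
      have hx := hl x (by simp)
      have : ‖x‖ ^ 2 ≤ 1 := pow_le_one₀ (norm_nonneg _) hx
      rw [mul_pow]
      nlinarith [sq_nonneg M]
    have h3 : Real.exp (M ^ 2 * ((x :: l).length : ℕ) / 2) = Real.exp (M ^ 2 / 2) * E := by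
      rw [← Real.exp_add, List.length_cons]; push_cast; ring_nf
    rw [h3]
    have h4 : Real.cosh (M * ‖v‖) * Real.cosh (M * ‖x‖) ≤
        Real.cosh (M * ‖v‖) * Real.exp (M ^ 2 / 2) :=
      mul_le_mul_of_nonneg_left h2 (Real.cosh_pos _).le
    have h5 := mul_le_mul_of_nonneg_right h4 hE.le
    have h6 := mul_le_mul_of_nonneg_right h1 hE.le
    linarith [ih (v + x), ih (v - x)]

/-! ### Peeling off dense layers -/

section Peeling

variable {I : Type} [Finite I] [Nonempty I]

/-- The exponential of the largest Euclidean norm in a finite family of vectors. -/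
def expSupNorm {m : ℕ} (v : I × Fin m → ℝ) : ℝ := Real.exp (⨆ τ, √(∑ k, v (τ, k) ^ 2))

omit [Nonempty I] in
lemma exp_norm_le_expSupNorm {m : ℕ} (v : I × Fin m → ℝ) (τ : I) :
    Real.exp (√(∑ k, v (τ, k) ^ 2)) ≤ expSupNorm v :=
  Real.exp_le_exp.2 (le_iSup_fin (fun τ => √(∑ k, v (τ, k) ^ 2)) τ)

lemma expSup_le_exp {κ : Type*} [Finite κ] [Nonempty κ] {v : κ → ℝ} {B : ℝ} (h : ∀ q, v q ≤ B) :
    expSup v ≤ Real.exp B := Real.exp_le_exp.2 (ciSup_le h)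

lemma signAvg_map_contraction {α κ : Type*} [Finite κ] [Nonempty κ] (js : List α)
    {F T : α → κ → ℝ} (hlip : ∀ j ∈ js, ∀ τ τ', |F j τ - F j τ'| ≤ |T j τ - T j τ'|)
    (hzero : ∀ j ∈ js, ∀ τ, |F j τ| ≤ |T j τ|) (A : κ → ℝ) :
    signAvg (js.map F) expSup A ≤ signAvg (js.map T) expSup A := by
  have := signAvg_blocks js F (fun j => [T j]) (Φ := expSup)
    (fun j hj v => signAvg_contraction (hlip j hj) (hzero j hj) v) A
  rwa [← List.map_eq_flatMap] at this

lemma abs_relu_sub_le (a b : ℝ) : |relu a - relu b| ≤ |a - b| := by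
  simpa [relu] using abs_max_sub_max_le_abs a b 0

lemma abs_relu_le (a : ℝ) : |relu a| ≤ |a| := by
  simpa [relu] using abs_max_sub_max_le_abs a 0 0

lemma mul_relu {c : ℝ} (hc : 0 ≤ c) (a : ℝ) : c * relu a = relu (c * a) := by
  rw [relu, relu, mul_max_of_nonneg _ _ hc, mul_zero]

/-- The weighted outputs of layer `l` at the input `x`, for a finite family of networks. -/
def denseVec (Θ : I → Params N) (ρ : I → ℝ) (l : ℕ) (x : EuclideanSpace ℝ (Fin N.d))
    (q : I × Fin (N.width l)) : ℝ := ρ q.1 * hidden (Θ q.1) x l q.2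

/-- Peeling off a dense layer: after normalizing the rows of the weight matrix, the supremum of
the norm is attained at a single row, to which the contraction principle applies. -/
lemma signAvg_denseVec_succ_le (Θ : I → Params N) {ρ : I → ℝ} (hρ : ∀ τ, 0 ≤ ρ τ) {l : ℕ}
    (hl : N.LC ≤ l) (hL : l < N.L) (xs : List (EuclideanSpace ℝ (Fin N.d))) :
    signAvg (xs.map (denseVec Θ ρ (l + 1))) expSupNorm 0 ≤
      2 * signAvg (xs.map (denseVec Θ (fun τ => ρ τ * √(layerSq (Θ τ) l)) l)) expSupNorm 0 := by
  have hnc : ¬ l < N.LC := not_lt.2 hl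
  have hne : Nonempty (Fin (N.width (l + 1))) := ⟨⟨0, N.width_pos _ hL⟩⟩
  set W := N.width l
  set c : I → ℝ := fun τ => √(layerSq (Θ τ) l) with hc
  set α : I → ℕ → ℝ := fun τ k => √(∑ i ∈ Finset.range W, coef (Θ τ) l (k * W + i) ^ 2) with hα
  have hα2 : ∀ τ k, α τ k ^ 2 = ∑ i ∈ Finset.range W, coef (Θ τ) l (k * W + i) ^ 2 := fun τ k =>
    Real.sq_sqrt (Finset.sum_nonneg fun _ _ => sq_nonneg _)
  have hc2 : ∀ τ, c τ ^ 2 = ∑ k : Fin (N.width (l + 1)), α τ k ^ 2 := fun τ => by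
    rw [hc, Real.sq_sqrt (layerSq_nonneg _ _), layerSq, Arch.q_dense hnc hL, sum_range_mul_eq,
      Finset.sum_range]
    exact Finset.sum_congr rfl fun k _ => (hα2 τ k).symm
  have hα0 : ∀ τ k, 0 ≤ α τ k := fun τ k => Real.sqrt_nonneg _
  have hc0 : ∀ τ, 0 ≤ c τ := fun τ => Real.sqrt_nonneg _
  -- the pre-activations for normalized rows
  let f : (I × Fin W → ℝ) →+ (I × Fin (N.width (l + 1)) → ℝ) := AddMonoidHom.mk'
    (fun v q => ∑ i : Fin W, coef (Θ q.1) l (q.2 * W + i) / α q.1 q.2 * v (q.1, i))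
    (fun v w => by funext q; simp [mul_add, Finset.sum_add_distrib])
  let g : (I × Fin (N.width (l + 1)) → ℝ) →+ (I × Fin (N.width (l + 1)) → ℝ) := AddMonoidHom.mk'
    (fun v q => α q.1 q.2 / c q.1 * v q) (fun v w => by funext q; simp [mul_add])
  let t : EuclideanSpace ℝ (Fin N.d) → I × Fin (N.width (l + 1)) → ℝ := fun x =>
    f (denseVec Θ (fun τ => ρ τ * c τ) l x)
  let u : EuclideanSpace ℝ (Fin N.d) → I × Fin (N.width (l + 1)) → ℝ := fun x q => relu (t x q)
  have ht : ∀ x q, t x q = ρ q.1 * c q.1 / α q.1 q.2 *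
      preact (Θ q.1) l (hidden (Θ q.1) x l) q.2 := by
    intro x q
    change ∑ i : Fin W, _ = _
    rw [preact, if_neg hnc, Finset.sum_range, Finset.mul_sum]
    refine Finset.sum_congr rfl fun i _ => ?_
    simp only [denseVec]
    ring
  have hg : ∀ x, denseVec Θ ρ (l + 1) x = g (u x) := by
    intro x
    funext q
    change ρ q.1 * hidden (Θ q.1) x (l + 1) q.2 = α q.1 q.2 / c q.1 * relu (t x q)
    rw [ht, ← mul_relu (div_nonneg (mul_nonneg (hρ _) (hc0 _)) (hα0 _ _)), hidden, if_neg hnc]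
    rcases (hα0 q.1 q.2).eq_or_lt with h0 | h0
    · have hz : ∀ i ∈ Finset.range W, coef (Θ q.1) l (q.2 * W + i) = 0 := by
        have h2 := hα2 q.1 q.2
        rw [← h0, zero_pow two_ne_zero, eq_comm,
          Finset.sum_eq_zero_iff_of_nonneg fun _ _ => sq_nonneg _] at h2
        exact fun i hi => pow_eq_zero_iff two_ne_zero |>.1 (h2 i hi)
      have : preact (Θ q.1) l (hidden (Θ q.1) x l) q.2 = 0 := by
        rw [preact, if_neg hnc]
        exact Finset.sum_eq_zero fun i hi => by rw [hz i hi, zero_mul]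
      simp [this, relu]
    · have hcp : 0 < c q.1 := by
        have : 0 < c q.1 ^ 2 := by
          rw [hc2]
          exact (pow_pos h0 2).trans_le (Finset.single_le_sum
            (f := fun k : Fin (N.width (l + 1)) => α q.1 k ^ 2) (fun _ _ => sq_nonneg _)
            (Finset.mem_univ q.2))
        exact lt_of_le_of_ne (hc0 _) fun h => by rw [← h] at this; simp at this
      field_simp
  calc signAvg (xs.map (denseVec Θ ρ (l + 1))) expSupNorm 0
      = signAvg ((xs.map u).map g) expSupNorm 0 := by
        rw [List.map_map]; congr 1; exact List.map_congr_left fun x _ => hg x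
    _ ≤ signAvg (xs.map u) expSupAbs 0 := by
        refine signAvg_map_le g _ fun v => Real.exp_le_exp.2 (ciSup_le fun τ => ?_)
        set M := ⨆ q, |v q|
        have hM0 : 0 ≤ M := Real.iSup_nonneg fun q => abs_nonneg _
        rw [Real.sqrt_le_iff]
        refine ⟨hM0, ?_⟩
        calc ∑ k : Fin (N.width (l + 1)), (α τ k / c τ * v (τ, k)) ^ 2
            ≤ ∑ k : Fin (N.width (l + 1)), (α τ k / c τ) ^ 2 * M ^ 2 := by
              refine Finset.sum_le_sum fun k _ => ?_
              rw [mul_pow]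
              refine mul_le_mul_of_nonneg_left ?_ (sq_nonneg _)
              rw [← sq_abs]
              have := le_iSup_fin (fun q => |v q|) (τ, k)
              gcongr
          _ = (c τ ^ 2 / c τ ^ 2) * M ^ 2 := by
              rw [← Finset.sum_mul]
              simp only [div_pow, ← Finset.sum_div]
              rw [← hc2]
          _ ≤ 1 * M ^ 2 := by gcongr; exact div_self_le_one _
          _ = M ^ 2 := one_mul _
    _ ≤ 2 * signAvg (xs.map u) expSup 0 := signAvg_expSupAbs_le _
    _ ≤ 2 * signAvg (xs.map t) expSup 0 := by
        gcongr
        exact signAvg_map_contraction xs (fun x _ q q' => abs_relu_sub_le _ _)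
          (fun x _ q => abs_relu_le _) 0
    _ ≤ 2 * signAvg (xs.map (denseVec Θ (fun τ => ρ τ * c τ) l)) expSupNorm 0 := by
        gcongr
        rw [show xs.map t = (xs.map (denseVec Θ (fun τ => ρ τ * c τ) l)).map f by
          rw [List.map_map]; rfl]
        refine signAvg_map_le f _ fun v => ?_
        obtain ⟨q, hq⟩ := exists_exp_eq_expSup (f v)
        rw [hq]
        refine le_trans (Real.exp_le_exp.2 ?_) (exp_norm_le_expSupNorm v q.1)
        change ∑ i : Fin W, coef (Θ q.1) l (q.2 * W + i) / α q.1 q.2 * v (q.1, i) ≤ _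
        refine (Real.sum_mul_le_sqrt_mul_sqrt _ _ _).trans ?_
        refine mul_le_of_le_one_left (Real.sqrt_nonneg _) (Real.sqrt_le_one.2 ?_)
        simp only [div_pow, ← Finset.sum_div]
        rw [← Finset.sum_range (fun i => coef (Θ q.1) l (q.2 * W + i) ^ 2), ← hα2]
        exact div_self_le_one _

/-- Peeling off the output layer. -/
lemma signAvg_net_le (Θ : I → Params N) (p r : ℝ)
    (xs : List (EuclideanSpace ℝ (Fin N.d))) :
    signAvg (xs.map fun x τ => r * net p (Θ τ) x) expSup 0 ≤
      signAvg (xs.map (denseVec Θ (fun τ => r * (1 / (N.m : ℝ) ^ p) * √(layerSq (Θ τ) N.L)) N.L))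
        expSupNorm 0 := by
  set c : I → ℝ := fun τ => √(layerSq (Θ τ) N.L) with hc
  have hc2 : ∀ τ, c τ ^ 2 = ∑ k : Fin (N.width N.L), coef (Θ τ) N.L k ^ 2 := fun τ => by
    rw [hc, Real.sq_sqrt (layerSq_nonneg _ _), layerSq, Arch.q_out, Arch.m, Finset.sum_range]
  let f : (I × Fin (N.width N.L) → ℝ) →+ (I → ℝ) := AddMonoidHom.mk'
    (fun v τ => ∑ k : Fin (N.width N.L), coef (Θ τ) N.L k / c τ * v (τ, k))
    (fun v w => by funext q; simp [mul_add, Finset.sum_add_distrib])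
  have hf : ∀ x, (fun τ => r * net p (Θ τ) x) =
      f (denseVec Θ (fun τ => r * (1 / (N.m : ℝ) ^ p) * c τ) N.L x) := by
    intro x
    funext τ
    change _ = ∑ k : Fin (N.width N.L), _
    rw [net, Arch.m, Finset.sum_range, Finset.mul_sum, Finset.mul_sum]
    refine Finset.sum_congr rfl fun k _ => ?_
    simp only [denseVec]
    have hk : coef (Θ τ) N.L k / c τ * c τ = coef (Θ τ) N.L k := by
      refine div_mul_cancel_of_imp fun h => ?_
      have h2 := hc2 τ
      rw [h, zero_pow two_ne_zero, eq_comm,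
        Finset.sum_eq_zero_iff_of_nonneg fun _ _ => sq_nonneg _] at h2
      exact pow_eq_zero_iff two_ne_zero |>.1 (h2 k (Finset.mem_univ _))
    linear_combination (-(r * (1 / (N.width N.L : ℝ) ^ p) * hidden (Θ τ) x N.L k)) * hk
  rw [show (fun x τ => r * net p (Θ τ) x) = fun x => _ from funext hf]
  rw [show (xs.map fun x => f (denseVec Θ (fun τ => r * (1 / (N.m : ℝ) ^ p) * c τ) N.L x)) =
    (xs.map (denseVec Θ (fun τ => r * (1 / (N.m : ℝ) ^ p) * c τ) N.L)).map f by
      rw [List.map_map]; rfl]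
  refine signAvg_map_le f _ fun v => ?_
  obtain ⟨τ, hq⟩ := exists_exp_eq_expSup (f v)
  rw [hq]
  refine le_trans (Real.exp_le_exp.2 ?_) (exp_norm_le_expSupNorm v τ)
  change ∑ k : Fin (N.width N.L), coef (Θ τ) N.L k / c τ * v (τ, k) ≤ _
  refine (Real.sum_mul_le_sqrt_mul_sqrt _ _ _).trans ?_
  refine mul_le_of_le_one_left (Real.sqrt_nonneg _) (Real.sqrt_le_one.2 ?_)
  simp only [div_pow, ← Finset.sum_div]
  rw [← hc2]
  exact div_self_le_one _

/-- All dense layers above layer `l` are peeled off, each at the cost of a factor two. -/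
lemma signAvg_denseVec_le (Θ : I → Params N) {ρ : I → ℝ} (hρ : ∀ τ, 0 ≤ ρ τ) {j l : ℕ}
    (hl : N.LC ≤ l) (hL : l + j ≤ N.L) (xs : List (EuclideanSpace ℝ (Fin N.d))) :
    signAvg (xs.map (denseVec Θ ρ (l + j))) expSupNorm 0 ≤
      2 ^ j * signAvg (xs.map (denseVec Θ
        (fun τ => ρ τ * ∏ i ∈ Finset.range j, √(layerSq (Θ τ) (l + i))) l)) expSupNorm 0 := by
  induction j generalizing ρ with
  | zero => simp
  | succ j ih =>
    refine (signAvg_denseVec_succ_le Θ hρ (l := l + j) (by omega) (by omega) xs).trans ?_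
    have := ih (ρ := fun τ => ρ τ * √(layerSq (Θ τ) (l + j)))
      (fun τ => mul_nonneg (hρ τ) (Real.sqrt_nonneg _)) (by omega)
    rw [pow_succ', mul_assoc]
    refine mul_le_mul_of_nonneg_left (this.trans (le_of_eq ?_)) zero_le_two
    simp only [Finset.prod_range_succ, mul_assoc, mul_comm (√(layerSq _ (l + j)))]

omit [Finite I] [Nonempty I] in
lemma input_add (v w : EuclideanSpace ℝ (Fin N.d)) (i : ℕ) :
    input (v + w) i = input v i + input w i := by
  unfold input
  split_ifs <;> simp

omit [Finite I] in
lemma signAvg_denseVec_zero_le (Θ : I → Params N) {ρ : I → ℝ} (hρ : ∀ τ, 0 ≤ ρ τ) {M : ℝ}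
    (hM : ∀ τ, ρ τ ≤ M) (xs : List (EuclideanSpace ℝ (Fin N.d))) (hxs : ∀ x ∈ xs, ‖x‖ ≤ 1) :
    signAvg (xs.map (denseVec Θ ρ 0)) expSupNorm 0 ≤ 2 * Real.exp (M ^ 2 * xs.length / 2) := by
  let f : EuclideanSpace ℝ (Fin N.d) →+ (I × Fin (N.width 0) → ℝ) := AddMonoidHom.mk'
    (fun x q => ρ q.1 * input x q.2)
    (fun v w => by funext q; simp only [input_add, Pi.add_apply, mul_add])
  have hf : denseVec Θ ρ 0 = f := by
    rfl
  rw [hf]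
  refine (signAvg_map_le f xs (Ψ' := fun x => 2 * Real.cosh (M * ‖x‖)) fun x => ?_).trans ?_
  · have : expSupNorm (f x) ≤ Real.exp (M * ‖x‖) := by
      refine Real.exp_le_exp.2 (ciSup_le fun τ => ?_)
      have hM0 : 0 ≤ M := (hρ τ).trans (hM τ)
      rw [Real.sqrt_le_iff]
      refine ⟨mul_nonneg hM0 (norm_nonneg _), ?_⟩
      change ∑ k : Fin (N.width 0), (ρ τ * input x k) ^ 2 ≤ _
      have hx : ∑ k : Fin (N.width 0), input x k ^ 2 = ‖x‖ ^ 2 := by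
        rw [← sum_input_sq, Finset.sum_range]
      simp only [mul_pow, ← Finset.mul_sum]
      rw [hx]
      have := hρ τ
      have := hM τ
      gcongr
    rw [Real.cosh_eq]
    linarith [Real.exp_pos (-(M * ‖x‖))]
  · rw [signAvg_const_mul]
    have := signAvg_cosh_norm_le (M := M) xs hxs 0
    simp at this
    linarith

/-! ### Peeling off convolutional blocks -/

/-- The weighted entries of layer `l` at the input `j.1` and the positions `j.2`, for a finite
family of networks and of positions. -/
def convVec {P : Type} (Θ : I → Params N) (ρ : I → ℝ) (l : ℕ)
    (j : EuclideanSpace ℝ (Fin N.d) × (P → ℕ)) (q : I × P) : ℝ :=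
  ρ q.1 * hidden (Θ q.1) j.1 l (j.2 q.2)

/-- The pairs of inputs and positions of the pre-activations that enter the pooled entries `js` of
layer `l + 1`. -/
def windowList {P : Type} (l : ℕ) (js : List (EuclideanSpace ℝ (Fin N.d) × (P → ℕ))) :
    List (EuclideanSpace ℝ (Fin N.d) × (P → ℕ)) :=
  js.flatMap fun j => List.ofFn fun b : Fin (N.kernel l) =>
    (j.1, fun p => j.2 p * N.kernel l + b)

/-- A pooled entry, as a vector indexed by networks and positions, is dominated by the
corresponding pre-activations. -/
lemma signAvg_convVec_le_preact {P : Type} [Finite P] [Nonempty P] (Θ : I → Params N)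
    {ρ : I → ℝ} (hρ : ∀ τ, 0 ≤ ρ τ) {l : ℕ} (hl : l < N.LC)
    (js : List (EuclideanSpace ℝ (Fin N.d) × (P → ℕ))) :
    signAvg (js.map (convVec Θ ρ (l + 1))) expSup 0 ≤
      signAvg ((windowList l js).map fun j (q : I × P) =>
        ρ q.1 * preact (Θ q.1) l (hidden (Θ q.1) j.1 l) (j.2 q.2)) expSup 0 := by
  have hs := N.kernel_pos l hl
  let y : EuclideanSpace ℝ (Fin N.d) × (P → ℕ) → I × P → ℝ := fun j q =>
    ρ q.1 * relu (preact (Θ q.1) l (hidden (Θ q.1) j.1 l) (j.2 q.2))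
  calc signAvg (js.map (convVec Θ ρ (l + 1))) expSup 0
      ≤ signAvg (js.flatMap fun j => List.ofFn fun b : Fin (N.kernel l) =>
          y (j.1, fun p => j.2 p * N.kernel l + b)) expSup 0 := by
        refine signAvg_blocks js _ _ (fun j _ v => ?_) 0
        by_cases hm : N.maxPool l = true
        · have e : convVec Θ ρ (l + 1) j = fun q => ⨆ b : Fin (N.kernel l),
              y (j.1, fun p => j.2 p * N.kernel l + b) q := by
            funext q
            simp only [convVec, hidden, if_pos hl, pool, if_pos hm, y]
            exact Real.mul_iSup_of_nonneg (hρ _) _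
          rw [e]
          exact signAvg_iSup_le hs _ v
        · have e : convVec Θ ρ (l + 1) j = fun q => (∑ b : Fin (N.kernel l),
              y (j.1, fun p => j.2 p * N.kernel l + b) q) / N.kernel l := by
            funext q
            simp only [convVec, hidden, if_pos hl, pool, if_neg hm, y, Finset.sum_range,
              ← Finset.mul_sum]
            ring
          rw [e]
          exact signAvg_avg_le hs _ v
    _ = signAvg ((windowList l js).map y) expSup 0 := by
        rw [windowList, List.map_flatMap]
        simp only [List.map_ofFn]
        rfl
    _ ≤ _ := by
        refine signAvg_map_contraction _ (fun j _ q q' => ?_) (fun j _ q => ?_) 0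
        · simp only [y, mul_relu (hρ _)]
          exact abs_relu_sub_le _ _
        · simp only [y, mul_relu (hρ _)]
          exact abs_relu_le _

/-- The pairs of inputs and positions that enter the pre-activations `js`; positions are now indexed
also by the entries of the kernel. -/
def shiftList {P : Type} (s : ℕ) (js : List (EuclideanSpace ℝ (Fin N.d) × (P → ℕ))) :
    List (EuclideanSpace ℝ (Fin N.d) × (P × Fin s → ℕ)) :=
  js.map fun j => (j.1, fun q => j.2 q.1 + q.2)

lemma signAvg_preact_le {P : Type} [Finite P] [Nonempty P] (Θ : I → Params N) (ρ : I → ℝ)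
    {l : ℕ} (hl : l < N.LC) (js : List (EuclideanSpace ℝ (Fin N.d) × (P → ℕ))) :
    signAvg (js.map fun j (q : I × P) =>
        ρ q.1 * preact (Θ q.1) l (hidden (Θ q.1) j.1 l) (j.2 q.2)) expSup 0 ≤
      signAvg ((shiftList (N.kernel l) js).map
        (convVec Θ (fun τ => ρ τ * (√(N.kernel l) * √(layerSq (Θ τ) l))) l)) expSupAbs 0 := by
  have hs := N.kernel_pos l hl
  have hne : Nonempty (Fin (N.kernel l)) := ⟨⟨0, hs⟩⟩
  set c : I → ℝ := fun τ => √(N.kernel l) * √(layerSq (Θ τ) l) with hc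
  have hsum : ∀ τ, ∑ a : Fin (N.kernel l), |coef (Θ τ) l a| ≤ c τ := fun τ => by
    have h1 := Real.sum_mul_le_sqrt_mul_sqrt (Finset.univ : Finset (Fin (N.kernel l)))
      (fun _ => (1 : ℝ)) (fun a => |coef (Θ τ) l a|)
    simp only [one_mul, one_pow, Finset.sum_const, Finset.card_univ, Fintype.card_fin,
      nsmul_eq_mul, mul_one, sq_abs] at h1
    rwa [← Finset.sum_range (fun a => coef (Θ τ) l a ^ 2), ← Arch.q_conv hl, ← layerSq,
      Arch.q_conv hl] at h1
  have hc0 : ∀ τ, 0 ≤ c τ := fun τ => mul_nonneg (Real.sqrt_nonneg _) (Real.sqrt_nonneg _)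
  let f : (I × (P × Fin (N.kernel l)) → ℝ) →+ (I × P → ℝ) := AddMonoidHom.mk'
    (fun v q => ∑ a : Fin (N.kernel l), coef (Θ q.1) l a / c q.1 * v (q.1, (q.2, a)))
    (fun v w => by funext q; simp [mul_add, Finset.sum_add_distrib])
  have hf : ∀ j : EuclideanSpace ℝ (Fin N.d) × (P → ℕ), (fun q : I × P =>
      ρ q.1 * preact (Θ q.1) l (hidden (Θ q.1) j.1 l) (j.2 q.2)) =
      f (convVec Θ (fun τ => ρ τ * c τ) l (j.1, fun q => j.2 q.1 + q.2)) := by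
    intro j
    funext q
    change _ = ∑ a : Fin (N.kernel l), coef (Θ q.1) l a / c q.1 *
      (ρ q.1 * c q.1 * hidden (Θ q.1) j.1 l (j.2 q.2 + a))
    rw [preact, if_pos hl, Finset.sum_range, Finset.mul_sum]
    refine Finset.sum_congr rfl fun a _ => ?_
    have hk : coef (Θ q.1) l a / c q.1 * c q.1 = coef (Θ q.1) l a := by
      refine div_mul_cancel_of_imp fun h => ?_
      have h1 := hsum q.1
      rw [h] at h1
      have h2 := Finset.single_le_sum (f := fun a : Fin (N.kernel l) => |coef (Θ q.1) l a|)
        (fun _ _ => abs_nonneg _) (Finset.mem_univ a)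
      exact abs_nonpos_iff.1 (h2.trans h1)
    linear_combination (-(ρ q.1 * hidden (Θ q.1) j.1 l (j.2 q.2 + a))) * hk
  rw [show (fun (j : EuclideanSpace ℝ (Fin N.d) × (P → ℕ)) (q : I × P) =>
      ρ q.1 * preact (Θ q.1) l (hidden (Θ q.1) j.1 l) (j.2 q.2)) = fun j => _ from funext hf,
    show (js.map fun j => f (convVec Θ (fun τ => ρ τ * c τ) l (j.1, fun q => j.2 q.1 + q.2))) =
      ((shiftList (N.kernel l) js).map (convVec Θ (fun τ => ρ τ * c τ) l)).map f by
        rw [shiftList, List.map_map, List.map_map]; rfl]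
  refine signAvg_map_le f _ fun v => expSup_le_exp fun q => ?_
  set M := ⨆ q, |v q|
  have hM0 : 0 ≤ M := Real.iSup_nonneg fun q => abs_nonneg _
  change ∑ a : Fin (N.kernel l), coef (Θ q.1) l a / c q.1 * v (q.1, (q.2, a)) ≤ M
  calc ∑ a : Fin (N.kernel l), coef (Θ q.1) l a / c q.1 * v (q.1, (q.2, a))
      ≤ ∑ a : Fin (N.kernel l), |coef (Θ q.1) l a| / c q.1 * M := by
        refine Finset.sum_le_sum fun a _ => ?_
        refine (le_abs_self _).trans ?_
        rw [abs_mul, abs_div, abs_of_nonneg (hc0 _)]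
        exact mul_le_mul_of_nonneg_left (le_iSup_fin (fun q => |v q|) (q.1, (q.2, a)))
          (div_nonneg (abs_nonneg _) (hc0 _))
    _ = (∑ a : Fin (N.kernel l), |coef (Θ q.1) l a|) / c q.1 * M := by
        rw [← Finset.sum_mul, Finset.sum_div]
    _ ≤ 1 * M := by
        gcongr
        exact div_le_one_of_le₀ (hsum _) (hc0 _)
    _ = M := one_mul _

omit [Finite I] [Nonempty I] in
lemma sum_windowList {P : Type} (l : ℕ) (js : List (EuclideanSpace ℝ (Fin N.d) × (P → ℕ)))
    (g : EuclideanSpace ℝ (Fin N.d) → ℕ → ℝ) (p : P) (a : ℕ) :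
    ((windowList l js).map fun j => g j.1 (j.2 p + a)).sum =
      (js.map fun j =>
        ∑ b ∈ Finset.range (N.kernel l), g j.1 (j.2 p * N.kernel l + b + a)).sum := by
  rw [windowList, List.map_flatMap]
  induction js with
  | nil => simp
  | cons j js ih =>
    rw [List.flatMap_cons, List.sum_append, ih, List.map_cons, List.sum_cons, List.map_ofFn,
      List.sum_ofFn, Finset.sum_range]
    rfl

/-- Exponential moments of the convolutional part of the network in the maximum norm.
The hypothesis `hjs` says that, for fixed `p`, no entry of layer `l` occurs twice in the list. It
passes from a block to the one below it because pooling windows are disjoint. -/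
lemma signAvg_convVec_le (Θ : I → Params N) (M : ℝ) (xs : List (EuclideanSpace ℝ (Fin N.d)))
    (hxs : ∀ x ∈ xs, ‖x‖ ≤ 1) {l : ℕ} (hl : l ≤ N.LC) {P : Type} [Fintype P] [Nonempty P]
    (js : List (EuclideanSpace ℝ (Fin N.d) × (P → ℕ)))
    (hjs : ∀ g : EuclideanSpace ℝ (Fin N.d) → ℕ → ℝ, (∀ x k, 0 ≤ g x k) → ∀ p,
      (js.map fun j => g j.1 (j.2 p)).sum ≤
        (xs.map fun x => ∑ k ∈ Finset.range (N.width l), g x k).sum)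
    {ρ : I → ℝ} (hρ : ∀ τ, 0 ≤ ρ τ)
    (hM : ∀ τ, ρ τ * ∏ i ∈ Finset.range l, (√(N.kernel i) * √(layerSq (Θ τ) i)) ≤ M) :
    signAvg (js.map (convVec Θ ρ l)) expSupAbs 0 ≤
      2 ^ (l + 1) * (Fintype.card P * ∏ i ∈ Finset.range l, (N.kernel i : ℝ)) *
        Real.exp (M ^ 2 * xs.length / 2) := by
  induction l generalizing P ρ with
  | zero =>
    let f : (P → ℝ) →+ (I × P → ℝ) := AddMonoidHom.mk' (fun v q => ρ q.1 * v q.2)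
      (fun v w => by funext q; simp [mul_add])
    have e : js.map (convVec Θ ρ 0) =
        (js.map fun j p => input j.1 (j.2 p)).map f := by
      rw [List.map_map]; rfl
    rw [e]
    simp only [Finset.range_zero, Finset.prod_empty, mul_one] at hM ⊢
    refine (signAvg_map_le f _ (Ψ' := fun v => ∑ p, (Real.exp (M * v p) + Real.exp (-M * v p)))
      fun v => ?_).trans ?_
    · obtain ⟨q, hq⟩ := exists_eq_iSup_fin (fun q => |f v q|)
      rw [expSupAbs, ← hq]
      have h1 : |f v q| ≤ |M * v q.2| := by
        change |ρ q.1 * v q.2| ≤ _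
        rw [abs_mul, abs_mul]
        gcongr
        · exact hρ _
        · exact hM _
      have h2 : Real.exp |M * v q.2| ≤ Real.exp (M * v q.2) + Real.exp (-M * v q.2) := by
        rw [neg_mul]
        rcases abs_cases (M * v q.2) with ⟨h, _⟩ | ⟨h, _⟩ <;> rw [h]
        · linarith [Real.exp_pos (-(M * v q.2))]
        · linarith [Real.exp_pos (M * v q.2)]
      exact (Real.exp_le_exp.2 h1).trans (h2.trans (Finset.single_le_sum
        (f := fun p => Real.exp (M * v p) + Real.exp (-M * v p))
        (fun _ _ => by positivity) (Finset.mem_univ q.2)))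
    · rw [signAvg_sum]
      have hb : ∀ (p : P) (m : ℝ), m ^ 2 = M ^ 2 →
          signAvg (js.map fun j p => input j.1 (j.2 p)) (fun v => Real.exp (m * v p)) 0 ≤
          Real.exp (M ^ 2 * xs.length / 2) := by
        intro p m hm
        let ev : (P → ℝ) →+ ℝ := AddMonoidHom.mk' (fun v => m * v p)
          (fun v w => by simp [mul_add])
        have h1 := signAvg_map ev (js.map fun j p => input j.1 (j.2 p)) Real.exp 0
        rw [map_zero] at h1
        refine (le_of_eq h1.symm).trans ((signAvg_exp_le _ _).trans ?_)
        rw [Real.exp_zero, one_mul, Real.exp_le_exp, List.map_map, List.map_map]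
        have h2 := hjs (fun x k => M ^ 2 * input x k ^ 2 / 2) (fun x k => by positivity) p
        refine (le_of_eq ?_).trans (h2.trans ?_)
        · congr 1
          refine List.map_congr_left fun j _ => ?_
          change (m * input j.1 (j.2 p)) ^ 2 / 2 = _
          rw [mul_pow, hm]
        · have h3 : (xs.map fun x => ∑ k ∈ Finset.range (N.width 0),
              M ^ 2 * input x k ^ 2 / 2).sum ≤ (xs.map fun _ => M ^ 2 / 2).sum := by
            refine List.sum_le_sum fun x hx => ?_
            rw [← Finset.sum_div, ← Finset.mul_sum, sum_input_sq]
            have : ‖x‖ ^ 2 ≤ 1 := pow_le_one₀ (norm_nonneg _) (hxs x hx)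
            nlinarith [sq_nonneg M]
          refine h3.trans (le_of_eq ?_)
          simp
          ring
      calc _ ≤ ∑ p : P, 2 * Real.exp (M ^ 2 * xs.length / 2) := by
            refine Finset.sum_le_sum fun p _ => ?_
            rw [signAvg_add]
            linarith [hb p M rfl, hb p (-M) (neg_sq M)]
        _ = _ := by simp; ring
  | succ l ih =>
    have hl' : l < N.LC := hl
    have hs := N.kernel_pos l hl'
    have hf := N.conv_fits l hl'
    have hne : Nonempty (Fin (N.kernel l)) := ⟨⟨0, hs⟩⟩
    refine (signAvg_expSupAbs_le _).trans ((mul_le_mul_of_nonneg_left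
      ((signAvg_convVec_le_preact Θ hρ hl' js).trans (signAvg_preact_le Θ ρ hl' _))
      zero_le_two).trans ?_)
    have key := ih hl'.le (shiftList (N.kernel l) (windowList l js)) (fun g hg q => ?_)
      (ρ := fun τ => ρ τ * (√(N.kernel l) * √(layerSq (Θ τ) l)))
      (fun τ => mul_nonneg (hρ τ) (mul_nonneg (Real.sqrt_nonneg _) (Real.sqrt_nonneg _)))
      (fun τ => ?_)
    · refine (mul_le_mul_of_nonneg_left key zero_le_two).trans (le_of_eq ?_)
      rw [Finset.prod_range_succ, Fintype.card_prod, Fintype.card_fin]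
      push_cast
      ring
    · rw [shiftList, List.map_map]
      change ((windowList l js).map fun j => g j.1 (j.2 q.1 + q.2)).sum ≤ _
      rw [sum_windowList]
      refine (hjs (fun x k => ∑ b ∈ Finset.range (N.kernel l), g x (k * N.kernel l + b + q.2))
        (fun x k => Finset.sum_nonneg fun _ _ => hg _ _) q.1).trans ?_
      refine List.sum_le_sum fun x _ => ?_
      rw [← sum_range_mul_eq (fun i => g x (i + q.2))]
      have hq : (q.2 : ℕ) < N.kernel l := q.2.2
      calc ∑ j ∈ Finset.range (N.width (l + 1) * N.kernel l), g x (j + q.2)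
          ≤ ∑ i ∈ Finset.range (q.2 + N.width (l + 1) * N.kernel l), g x i := by
            rw [Finset.sum_range_add]
            simp only [add_comm _ (q.2 : ℕ)]
            exact le_add_of_nonneg_left (Finset.sum_nonneg fun _ _ => hg _ _)
        _ ≤ _ := Finset.sum_le_sum_of_subset_of_nonneg (Finset.range_mono (by omega))
            fun _ _ _ => hg _ _
    · refine le_trans (le_of_eq ?_) (hM τ)
      rw [Finset.prod_range_succ]
      ring

omit [Finite I] [Nonempty I] in
/-- The number of paths from the last convolutional layer down to the input is at most `d`. -/
lemma Arch.width_mul_prod_kernel_le (N : Arch) {l : ℕ} (hl : l ≤ N.LC) :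
    N.width l * ∏ i ∈ Finset.range l, N.kernel i ≤ N.d := by
  induction l with
  | zero => simp [Arch.d]
  | succ l ih =>
    refine le_trans ?_ (ih (by omega))
    have hf := N.conv_fits l (by omega)
    have hs := N.kernel_pos l (by omega)
    rw [Finset.prod_range_succ]
    calc _ = N.width (l + 1) * N.kernel l * ∏ i ∈ Finset.range l, N.kernel i := by ring
      _ ≤ _ := Nat.mul_le_mul_right _ (by omega)

lemma signAvg_denseVec_le_convVec (Θ : I → Params N) (ρ : I → ℝ) (l : ℕ)
    (hl : 0 < N.width l) (xs : List (EuclideanSpace ℝ (Fin N.d))) :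
    signAvg (xs.map (denseVec Θ ρ l)) expSupNorm 0 ≤
      signAvg ((xs.map fun x => (x, fun k : Fin (N.width l) => (k : ℕ))).map
        (convVec Θ (fun τ => ρ τ * √(N.width l)) l)) expSupAbs 0 := by
  have hw : √(N.width l : ℝ) ≠ 0 := by positivity
  have hne : Nonempty (Fin (N.width l)) := ⟨⟨0, hl⟩⟩
  let f : (I × Fin (N.width l) → ℝ) →+ (I × Fin (N.width l) → ℝ) := AddMonoidHom.mk'
    (fun v q => v q / √(N.width l)) (fun v w => by funext q; simp [add_div])
  have e : xs.map (denseVec Θ ρ l) =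
      ((xs.map fun x => (x, fun k : Fin (N.width l) => (k : ℕ))).map
        (convVec Θ (fun τ => ρ τ * √(N.width l)) l)).map f := by
    rw [List.map_map, List.map_map]
    refine List.map_congr_left fun x _ => ?_
    funext q
    change ρ q.1 * hidden (Θ q.1) x l q.2 =
      ρ q.1 * √(N.width l) * hidden (Θ q.1) x l q.2 / √(N.width l)
    field_simp
  rw [e]
  refine signAvg_map_le f _ fun v => Real.exp_le_exp.2 (ciSup_le fun τ => ?_)
  set M := ⨆ q, |v q|
  have hM0 : 0 ≤ M := Real.iSup_nonneg fun q => abs_nonneg _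
  rw [Real.sqrt_le_iff]
  refine ⟨hM0, ?_⟩
  calc ∑ k : Fin (N.width l), (v (τ, k) / √(N.width l)) ^ 2
      ≤ ∑ k : Fin (N.width l), M ^ 2 / N.width l := by
        refine Finset.sum_le_sum fun k _ => ?_
        rw [div_pow, Real.sq_sqrt (Nat.cast_nonneg _), ← sq_abs]
        have := le_iSup_fin (fun q => |v q|) (τ, k)
        gcongr
    _ = M ^ 2 := by
        rw [Finset.sum_const, Finset.card_univ, Fintype.card_fin, nsmul_eq_mul]
        field_simp

/-! ### The Rademacher complexity of networks with bounded product of layer norms -/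

/-- The product of the Euclidean norms of the layers. -/
def pathNorm (Θ : Params N) : ℝ := ∏ l ∈ Finset.range (N.L + 1), √(layerSq Θ l)

variable (N) in
/-- The logarithm of the factors lost in peeling off all layers. -/
def Arch.logLoss : ℝ :=
  if N.LC = 0 then (N.L + 1) * Real.log 2 else (N.L + 1) * Real.log 2 + Real.log N.d

variable (N) in
/-- The dimensional factor lost by passing to the maximum norm in the convolutional part. -/
def Arch.dimLoss : ℝ := if N.LC = 0 then 1 else √N.d

lemma Arch.d_pos (N : Arch) : 0 < N.d := N.width_pos 0 (Nat.zero_le _)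

lemma Arch.m_pos (N : Arch) : 0 < N.m := N.width_pos _ le_rfl

/-- Exponential moments of the Rademacher sums of the networks with product of layer norms at most
`G`. -/
lemma signAvg_net_exp_le (Θ : I → Params N) (p : ℝ) {G : ℝ} (hG : ∀ τ, pathNorm (Θ τ) ≤ G)
    {r : ℝ} (hr : 0 ≤ r) (xs : List (EuclideanSpace ℝ (Fin N.d))) (hxs : ∀ x ∈ xs, ‖x‖ ≤ 1) :
    signAvg (xs.map fun x τ => r * net p (Θ τ) x) expSup 0 ≤
      Real.exp (N.logLoss + (r * (N.dimLoss * (G / (N.m : ℝ) ^ p))) ^ 2 * xs.length / 2) := by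
  have hm : (0 : ℝ) < N.m := by exact_mod_cast N.m_pos
  have hd : (0 : ℝ) < N.d := by exact_mod_cast N.d_pos
  have hmp : 0 < (N.m : ℝ) ^ p := Real.rpow_pos_of_pos hm p
  have hL : N.LC + N.LF = N.L := rfl
  have h2 : ∀ k : ℕ, Real.exp (k * Real.log 2) = 2 ^ k := fun k => by
    rw [Real.exp_nat_mul, Real.exp_log two_pos]
  refine (signAvg_net_le Θ p r xs).trans ?_
  set ρ : I → ℝ := fun τ => r * (1 / (N.m : ℝ) ^ p) * √(layerSq (Θ τ) N.L) with hρdef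
  have hρ : ∀ τ, 0 ≤ ρ τ := fun τ => by positivity
  have h1 := signAvg_denseVec_le Θ hρ (j := N.LF) (l := N.LC) le_rfl hL.le xs
  rw [hL] at h1
  refine h1.trans ?_
  set ρ' : I → ℝ := fun τ => ρ τ * ∏ i ∈ Finset.range N.LF, √(layerSq (Θ τ) (N.LC + i)) with hρ'def
  have hρ' : ∀ τ, 0 ≤ ρ' τ := fun τ =>
    mul_nonneg (hρ τ) (Finset.prod_nonneg fun _ _ => Real.sqrt_nonneg _)
  have hprod : ∀ τ, ρ' τ * ∏ i ∈ Finset.range N.LC, √(layerSq (Θ τ) i) ≤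
      r * (G / (N.m : ℝ) ^ p) := fun τ => by
    have e : ρ' τ * ∏ i ∈ Finset.range N.LC, √(layerSq (Θ τ) i) =
        r * (pathNorm (Θ τ) / (N.m : ℝ) ^ p) := by
      rw [pathNorm, Finset.prod_range_succ, ← hL, Finset.prod_range_add]
      simp only [ρ', ρ, ← hL]
      ring
    rw [e]
    have := hG τ
    gcongr
  by_cases h0 : N.LC = 0
  · rw [Arch.logLoss, if_pos h0, Arch.dimLoss, if_pos h0, one_mul]
    have hM : ∀ τ, ρ' τ ≤ r * (G / (N.m : ℝ) ^ p) := fun τ => by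
      have := hprod τ
      rwa [h0, Finset.range_zero, Finset.prod_empty, mul_one] at this
    have h3 := signAvg_denseVec_zero_le Θ hρ' hM xs hxs
    have hLF : N.LF = N.L := by omega
    rw [h0, hLF]
    calc _ ≤ 2 ^ N.L * (2 * Real.exp ((r * (G / (N.m : ℝ) ^ p)) ^ 2 * xs.length / 2)) := by
          gcongr
      _ = _ := by
          rw [Real.exp_add, show ((N.L : ℝ) + 1) * Real.log 2 = ((N.L + 1 : ℕ) : ℝ) * Real.log 2 by
            push_cast; ring, h2, pow_succ]
          ring
  · have hwp : 0 < N.width N.LC := N.width_pos _ (by omega)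
    have hne : Nonempty (Fin (N.width N.LC)) := ⟨⟨0, hwp⟩⟩
    rw [Arch.logLoss, if_neg h0, Arch.dimLoss, if_neg h0]
    have hcount := N.width_mul_prod_kernel_le le_rfl
    have hcount' : (N.width N.LC : ℝ) * ∏ i ∈ Finset.range N.LC, (N.kernel i : ℝ) ≤ N.d := by
      exact_mod_cast hcount
    have h3 := signAvg_denseVec_le_convVec Θ ρ' N.LC hwp xs
    have h4 := signAvg_convVec_le Θ (r * (√N.d * (G / (N.m : ℝ) ^ p))) xs hxs le_rfl
      (xs.map fun x => (x, fun k : Fin (N.width N.LC) => (k : ℕ)))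
      (fun g hg k => by
        rw [List.map_map]
        refine List.sum_le_sum fun x _ => ?_
        exact Finset.single_le_sum (f := fun k => g x k) (fun _ _ => hg _ _)
          (Finset.mem_range.2 k.2))
      (ρ := fun τ => ρ' τ * √(N.width N.LC))
      (fun τ => mul_nonneg (hρ' τ) (Real.sqrt_nonneg _))
      (fun τ => by
        rw [Finset.prod_mul_distrib]
        have e1 : √(N.width N.LC) * ∏ i ∈ Finset.range N.LC, √(N.kernel i : ℝ) ≤ √N.d := by
          rw [← Real.sqrt_prod _ (fun _ _ => Nat.cast_nonneg _),
            ← Real.sqrt_mul (Nat.cast_nonneg _)]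
          exact Real.sqrt_le_sqrt hcount'
        have e2 := mul_le_mul e1 (hprod τ) (mul_nonneg (hρ' τ)
          (Finset.prod_nonneg fun _ _ => Real.sqrt_nonneg _)) (Real.sqrt_nonneg _)
        linarith)
    rw [Fintype.card_fin] at h4
    calc _ ≤ 2 ^ N.LF * (2 ^ (N.LC + 1) * N.d * Real.exp ((r * (√N.d * (G / (N.m : ℝ) ^ p))) ^ 2 *
            xs.length / 2)) := by
          refine mul_le_mul_of_nonneg_left ((h3.trans h4).trans ?_) (by positivity)
          gcongr
      _ = _ := by
          rw [Real.exp_add, Real.exp_add, Real.exp_log hd,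
            show ((N.L : ℝ) + 1) * Real.log 2 = ((N.L + 1 : ℕ) : ℝ) * Real.log 2 by
              push_cast; ring, h2, ← hL]
          ring

lemma signAvg_iSup_add_const {α : Type*} (zs : List α) (F : α → I → ℝ) (c : α → ℝ) (v : I → ℝ)
    (a : ℝ) : signAvg (zs.map fun z τ => F z τ + c z) (fun v => ⨆ τ, v τ) (fun τ => v τ + a) =
      signAvg (zs.map F) (fun v => ⨆ τ, v τ) v + a := by
  induction zs generalizing v a with
  | nil =>
    change (⨆ τ, (v τ + a)) = (⨆ τ, v τ) + a
    rw [ciSup_add (Set.finite_range v).bddAbove]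
  | cons z zs ih =>
    simp only [List.map_cons, signAvg]
    have h1 := ih (v + F z) (a + c z)
    have h2 := ih (v - F z) (a - c z)
    rw [show ((fun τ => v τ + a) + fun τ => F z τ + c z) = fun τ => (v + F z) τ + (a + c z) by
        funext τ; simp only [Pi.add_apply]; ring,
      show ((fun τ => v τ + a) - fun τ => F z τ + c z) = fun τ => (v - F z) τ + (a - c z) by
        funext τ; simp only [Pi.sub_apply]; ring, h1, h2]
    ring

lemma Arch.logLoss_pos (N : Arch) : 0 < N.logLoss := by
  have h1 : 0 < ((N.L : ℝ) + 1) * Real.log 2 := mul_pos (by positivity) (Real.log_pos one_lt_two)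
  have h2 : 0 ≤ Real.log N.d := Real.log_natCast_nonneg _
  unfold Arch.logLoss
  split_ifs <;> linarith

lemma Arch.dimLoss_pos (N : Arch) : 0 < N.dimLoss := by
  have := N.d_pos
  unfold Arch.dimLoss
  split_ifs <;> positivity

lemma Arch.sqrt_logLoss_mul_dimLoss_le (N : Arch) : √(2 * N.logLoss) * N.dimLoss ≤ N.C := by
  unfold Arch.logLoss Arch.dimLoss Arch.C
  split_ifs with h
  · rw [mul_one, ← mul_assoc]; linarith
  · have h1 : Real.log 2 ≤ 1 := by linarith [Real.log_two_lt_d9]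
    have h2 : 0 ≤ Real.log N.d := Real.log_natCast_nonneg _
    rw [← Real.sqrt_mul' _ (Nat.cast_nonneg _), show (2 : ℝ) = √(2 ^ 2) by simp,
      ← Real.sqrt_mul (by positivity)]
    apply Real.sqrt_le_sqrt
    simp only [Nat.ofNat_nonneg, Real.sqrt_sq]
    rw [← mul_assoc]
    have : (0 : ℝ) ≤ N.L := Nat.cast_nonneg _
    gcongr
    · norm_num
    · nlinarith [mul_nonneg this (sub_nonneg.2 h1)]

lemma Arch.C_pos (N : Arch) : 0 < N.C :=
  lt_of_lt_of_le (mul_pos (Real.sqrt_pos.2 (mul_pos two_pos N.logLoss_pos)) N.dimLoss_pos)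
    N.sqrt_logLoss_mul_dimLoss_le

/-- The empirical Rademacher complexity of the loss class. -/
lemma signAvg_loss_le (Θ : I → Params N) (p : ℝ) {G Cf : ℝ} (hG0 : 0 < G) (hCf : 0 ≤ Cf)
    (hG : ∀ τ, pathNorm (Θ τ) ≤ G) (zs : List (Data N)) (hn : 0 < zs.length)
    (hz : ∀ z ∈ zs, ‖z.1‖ ≤ 1 ∧ |z.2| ≤ 1 ∧ ∀ τ, |net p (Θ τ) z.1| ≤ Cf) :
    signAvg (zs.map fun z τ => loss p (Θ τ) z) (fun v => ⨆ τ, v τ) 0 ≤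
      (Cf + 1) * (N.C * (G / (N.m : ℝ) ^ p)) * √zs.length := by
  have hm : (0 : ℝ) < N.m := by exact_mod_cast N.m_pos
  have hmp : 0 < (N.m : ℝ) ^ p := Real.rpow_pos_of_pos hm p
  have hn' : (0 : ℝ) < zs.length := by exact_mod_cast hn
  let F : Data N → I → ℝ := fun z τ => net p (Θ τ) z.1 ^ 2 / 2 - net p (Θ τ) z.1 * z.2
  have e0 : (zs.map fun z τ => loss p (Θ τ) z) = zs.map fun z τ => F z τ + z.2 ^ 2 / 2 := by
    refine List.map_congr_left fun z _ => ?_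
    funext τ
    simp only [loss, F]; ring
  have e1 := signAvg_iSup_add_const zs F (fun z => z.2 ^ 2 / 2) 0 0
  rw [e0]
  simp only [Pi.zero_apply, add_zero] at e1
  change signAvg _ _ (fun _ => 0) ≤ _
  rw [e1]
  -- exponential moments
  set B := N.dimLoss * (G / (N.m : ℝ) ^ p) with hB
  have hBpos : 0 < B := mul_pos N.dimLoss_pos (div_pos hG0 hmp)
  have hA := N.logLoss_pos
  have hexp : ∀ r : ℝ, 0 ≤ r → signAvg (zs.map fun z τ => r * F z τ) expSup 0 ≤
      Real.exp (N.logLoss + (r * (Cf + 1) * B) ^ 2 * zs.length / 2) := by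
    intro r hr
    have h1 := signAvg_map_contraction zs (F := fun z τ => r * F z τ)
      (T := fun z τ => r * (Cf + 1) * net p (Θ τ) z.1) (fun z hz' τ τ' => ?_) (fun z hz' τ => ?_) 0
    · refine h1.trans ?_
      have h2 := signAvg_net_exp_le Θ p hG (r := r * (Cf + 1)) (by positivity)
        (zs.map Prod.fst) (fun x hx => by
          obtain ⟨z, hz', rfl⟩ := List.mem_map.1 hx
          exact (hz z hz').1)
      rw [List.map_map, List.length_map] at h2
      exact h2
    · obtain ⟨-, hy, hf⟩ := hz z hz'
      have e : r * F z τ - r * F z τ' = r * ((net p (Θ τ) z.1 + net p (Θ τ') z.1) / 2 - z.2) *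
          (net p (Θ τ) z.1 - net p (Θ τ') z.1) := by simp only [F]; ring
      rw [e, ← mul_sub, abs_mul, abs_mul (r * (Cf + 1)), abs_mul r, abs_mul r,
        abs_of_nonneg hr, abs_of_nonneg (by positivity : 0 ≤ Cf + 1)]
      gcongr
      have a1 := abs_le.1 (hf τ)
      have a2 := abs_le.1 (hf τ')
      have a3 := abs_le.1 hy
      exact abs_le.2 ⟨by linarith, by linarith⟩
    · obtain ⟨-, hy, hf⟩ := hz z hz'
      have e : r * F z τ = r * (net p (Θ τ) z.1 / 2 - z.2) * net p (Θ τ) z.1 := by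
        simp only [F]; ring
      simp only [e]
      rw [abs_mul, abs_mul (r * (Cf + 1)), abs_mul r, abs_mul r,
        abs_of_nonneg hr, abs_of_nonneg (by positivity : 0 ≤ Cf + 1)]
      gcongr
      have a1 := abs_le.1 (hf τ)
      have a3 := abs_le.1 hy
      exact abs_le.2 ⟨by linarith, by linarith⟩
  -- optimize over the scale of the exponential moment
  set S := signAvg (zs.map F) (fun v => ⨆ τ, v τ) 0
  have hlin : ∀ r : ℝ, 0 < r →
      r * S ≤ N.logLoss + (r * (Cf + 1) * B) ^ 2 * zs.length / 2 := by
    intro r hr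
    set a := N.logLoss + (r * (Cf + 1) * B) ^ 2 * zs.length / 2
    let sm : (I → ℝ) →+ (I → ℝ) := AddMonoidHom.mk' (fun v τ => r * v τ)
      (fun v w => by funext q; simp [mul_add])
    have h1 : signAvg (zs.map fun z τ => r * F z τ) expSup 0 =
        signAvg (zs.map F) (fun v => expSup (fun τ => r * v τ)) 0 := by
      have := signAvg_map sm (zs.map F) expSup 0
      rw [map_zero, List.map_map] at this
      exact this
    have h2 : r * S ≤ signAvg (zs.map F)
        (fun v => Real.exp (-a) * expSup (fun τ => r * v τ) + (a - 1)) 0 := by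
      rw [← signAvg_const_mul]
      refine signAvg_mono (fun v => ?_) _ _
      rw [expSup, ← Real.mul_iSup_of_nonneg hr.le, ← Real.exp_add]
      linarith [Real.add_one_le_exp (-a + r * ⨆ τ, v τ)]
    rw [signAvg_add, signAvg_const, signAvg_const_mul, ← h1] at h2
    have h3 := mul_le_mul_of_nonneg_left (hexp r hr.le) (Real.exp_pos (-a)).le
    rw [← Real.exp_add, neg_add_cancel, Real.exp_zero] at h3
    linarith
  set A := N.logLoss
  obtain ⟨D, hD⟩ : ∃ D, D = (Cf + 1) * B * √zs.length := ⟨_, rfl⟩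
  have hDpos : 0 < D := by rw [hD]; positivity
  have hD2 : D ^ 2 = ((Cf + 1) * B) ^ 2 * zs.length := by
    rw [hD, mul_pow, Real.sq_sqrt hn'.le]
  have hS : S ≤ √(2 * A) * D := by
    have hq : 0 < √(2 * A) := Real.sqrt_pos.2 (by positivity)
    have hq2 : √(2 * A) ^ 2 = 2 * A := Real.sq_sqrt (by positivity)
    have h := hlin (√(2 * A) / D) (by positivity)
    have e : A + (√(2 * A) / D * (Cf + 1) * B) ^ 2 * zs.length / 2 = 2 * A := by
      have : (√(2 * A) / D * (Cf + 1) * B) ^ 2 * zs.length = √(2 * A) ^ 2 := by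
        rw [show (√(2 * A) / D * (Cf + 1) * B) ^ 2 * (zs.length : ℝ) =
          √(2 * A) ^ 2 * (((Cf + 1) * B) ^ 2 * zs.length) / D ^ 2 by ring, ← hD2]
        field_simp
      rw [this, hq2]; ring
    rw [e, div_mul_eq_mul_div, div_le_iff₀ hDpos, ← hq2, sq, Real.sqrt_mul_self hq.le,
      mul_assoc] at h
    exact le_of_mul_le_mul_left h hq
  refine hS.trans ?_
  have := N.sqrt_logLoss_mul_dimLoss_le
  calc √(2 * A) * D = (Cf + 1) * ((√(2 * A) * N.dimLoss) * (G / (N.m : ℝ) ^ p)) * √zs.length := by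
        rw [hD, hB]; ring
    _ ≤ _ := by gcongr

end Peeling

/-! ### Uniform deviations of empirical means: symmetrization and bounded differences -/

section Deviation

variable {X : Type*} [MeasurableSpace X] (μ : Measure X) [IsProbabilityMeasure μ]

lemma integrable_of_measurable_of_abs_le {Ω : Type*} [MeasurableSpace Ω] {P : Measure Ω}
    [IsFiniteMeasure P] {f : Ω → ℝ} (hf : Measurable f) {B : ℝ} (hB : ∀ ω, |f ω| ≤ B) :
    Integrable f P :=
  Integrable.of_bound hf.aestronglyMeasurable B (Filter.Eventually.of_forall hB)

omit [IsProbabilityMeasure μ] in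
lemma measurable_fin_cons {n : ℕ} :
    Measurable fun z : X × (Fin n → X) => (Fin.cons z.1 z.2 : Fin (n + 1) → X) := by
  refine measurable_pi_lambda _ fun i => ?_
  refine Fin.cases ?_ (fun j => ?_) i
  · simpa using measurable_fst
  · exact (measurable_pi_apply j).comp (measurable_snd (α := X) (β := Fin n → X))

lemma integral_pi_succ {n : ℕ} {f : (Fin (n + 1) → X) → ℝ} (hf : Measurable f) {B : ℝ}
    (hB : ∀ S, |f S| ≤ B) :
    ∫ S, f S ∂(Measure.pi fun _ : Fin (n + 1) => μ) =
      ∫ x, ∫ S, f (Fin.cons x S) ∂(Measure.pi fun _ : Fin n => μ) ∂μ := by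
  have h := (measurePreserving_piFinSuccAbove (fun _ : Fin (n + 1) => μ) 0).symm
  rw [← h.integral_comp (MeasurableEquiv.measurableEmbedding _)]
  have e : ∀ z : X × (Fin n → X),
      (MeasurableEquiv.piFinSuccAbove (fun _ : Fin (n + 1) => X) 0).symm z = Fin.cons z.1 z.2 := by
    intro z
    simp [MeasurableEquiv.piFinSuccAbove, Fin.insertNthEquiv]
  simp only [e]
  rw [integral_prod]
  exact integrable_of_measurable_of_abs_le (hf.comp measurable_fin_cons) fun z => hB _

/-- Exponential moments of functions with bounded differences (the martingale part of McDiarmid's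
inequality), by induction on the number of coordinates from Hoeffding's lemma. -/
lemma integral_exp_le_of_bounded_diff (n : ℕ) {g : (Fin n → X) → ℝ} (hg : Measurable g) {B c : ℝ}
    (hc0 : 0 ≤ c) (hB : ∀ S, |g S| ≤ B) (hc : ∀ S i x, |g (Function.update S i x) - g S| ≤ c)
    (t : ℝ) :
    ∫ S, Real.exp (t * (g S - ∫ S', g S' ∂(Measure.pi fun _ : Fin n => μ)))
      ∂(Measure.pi fun _ : Fin n => μ) ≤ Real.exp (n * c ^ 2 / 4 * t ^ 2 / 2) := by
  induction n with
  | zero =>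
    have e : ∀ S : Fin 0 → X, g S = g default := fun S => by rw [Subsingleton.elim S default]
    simp [e]
  | succ n ih =>
    set ν := Measure.pi fun _ : Fin n => μ
    have hgc : ∀ x, Measurable fun S : Fin n → X => g (Fin.cons x S) := fun x =>
      hg.comp (measurable_fin_cons.comp measurable_prodMk_left)
    set G : X → ℝ := fun x => ∫ S, g (Fin.cons x S) ∂ν with hG
    have hGm : Measurable G :=
      ((hg.comp measurable_fin_cons).stronglyMeasurable.integral_prod_right').measurable
    have hint : ∀ x, Integrable (fun S => g (Fin.cons x S)) ν := fun x =>
      integrable_of_measurable_of_abs_le (hgc x) fun S => hB _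
    have hGB : ∀ x, |G x| ≤ B := fun x => by
      have := norm_integral_le_of_norm_le_const (μ := ν) (f := fun S => g (Fin.cons x S))
        (Filter.Eventually.of_forall fun S => hB _)
      simpa using this
    have hGc : ∀ x y, G x ≤ G y + c := fun x y => by
      rw [← sub_le_iff_le_add', hG, ← integral_sub (hint x) (hint y)]
      have : ∀ S, g (Fin.cons x S) - g (Fin.cons y S) ≤ c := fun S => by
        have := hc (Fin.cons y S) 0 x
        rw [Fin.update_cons_zero] at this
        exact (abs_le.1 this).2
      refine (integral_mono ((hint x).sub (hint y)) (integrable_const c) this).trans ?_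
      simp
    have hE : ∫ S, g S ∂(Measure.pi fun _ : Fin (n + 1) => μ) = ∫ x, G x ∂μ :=
      integral_pi_succ μ hg hB
    set m := ∫ x, G x ∂μ
    rw [hE]
    have hmB : |m| ≤ B := by
      have := norm_integral_le_of_norm_le_const (μ := μ) (f := G)
        (Filter.Eventually.of_forall fun S => hGB _)
      simpa using this
    have hbd : ∀ S, |Real.exp (t * (g S - m))| ≤ Real.exp (|t| * (B + B)) := fun S => by
      rw [abs_of_pos (Real.exp_pos _), Real.exp_le_exp]
      refine (le_abs_self _).trans ?_
      rw [abs_mul]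
      gcongr
      exact (abs_sub _ _).trans (add_le_add (hB S) hmB)
    rw [integral_pi_succ μ (by fun_prop) hbd]
    have hinner : ∀ x, ∫ S, Real.exp (t * (g (Fin.cons x S) - m)) ∂ν ≤
        Real.exp (t * (G x - m)) * Real.exp (n * c ^ 2 / 4 * t ^ 2 / 2) := fun x => by
      have h1 := ih (g := fun S => g (Fin.cons x S)) (hgc x) (fun S => hB _) (fun S i y => by
        have := hc (Fin.cons x S) i.succ y
        rwa [← Fin.cons_update] at this)
      refine le_trans (le_of_eq ?_) (mul_le_mul_of_nonneg_left h1 (Real.exp_pos (t * (G x - m))).le)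
      rw [← integral_const_mul]
      congr 1
      funext S
      rw [← Real.exp_add]
      congr 1
      ring
    have hne : Nonempty X := nonempty_of_isProbabilityMeasure μ
    have hbdd : BddBelow (Set.range G) := ⟨-B, by
      rintro _ ⟨x, rfl⟩; exact (abs_le.1 (hGB x)).1⟩
    have hH := hasSubgaussianMGF_of_mem_Icc (μ := μ) (X := G) (a := ⨅ x, G x) (b := (⨅ x, G x) + c)
      hGm.aemeasurable (Filter.Eventually.of_forall fun x => ⟨ciInf_le hbdd x, by
        rw [← sub_le_iff_le_add]
        exact le_ciInf fun y => by linarith [hGc x y]⟩)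
    have hmgf := hH.mgf_le t
    have hcc : ((‖(⨅ x, G x) + c - ⨅ x, G x‖₊ / 2) ^ 2 : NNReal) = (c ^ 2 / 4 : ℝ) := by
      rw [add_sub_cancel_left]
      push_cast
      rw [Real.norm_eq_abs, abs_of_nonneg hc0]
      ring
    rw [hcc, mgf] at hmgf
    have i1 : Integrable (fun x => ∫ S, Real.exp (t * (g (Fin.cons x S) - m)) ∂ν) μ := by
      refine integrable_of_measurable_of_abs_le (B := Real.exp (|t| * (B + B))) ?_ fun x => ?_
      · have : Measurable fun z : X × (Fin n → X) => Real.exp (t * (g (Fin.cons z.1 z.2) - m)) :=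
          Real.measurable_exp.comp (((hg.comp measurable_fin_cons).sub_const m).const_mul t)
        exact (this.stronglyMeasurable.integral_prod_right').measurable
      · have := norm_integral_le_of_norm_le_const (μ := ν)
          (f := fun S => Real.exp (t * (g (Fin.cons x S) - m)))
          (Filter.Eventually.of_forall fun S => hbd _)
        simpa using this
    have i2 : Integrable (fun x => Real.exp (t * (G x - m))) μ :=
      hH.integrable_exp_mul t
    refine (integral_mono i1 (i2.mul_const _) hinner).trans ?_
    rw [integral_mul_const]
    refine (mul_le_mul_of_nonneg_right hmgf (Real.exp_pos _).le).trans (le_of_eq ?_)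
    rw [← Real.exp_add]
    congr 1
    push_cast
    ring

/-- McDiarmid's bounded difference inequality. -/
lemma measure_ge_le_of_bounded_diff {n : ℕ} (hn : 0 < n) {g : (Fin n → X) → ℝ} (hg : Measurable g)
    {B c : ℝ} (hc0 : 0 < c) (hB : ∀ S, |g S| ≤ B)
    (hc : ∀ S i x, |g (Function.update S i x) - g S| ≤ c) {t : ℝ} (ht : 0 ≤ t) :
    (Measure.pi fun _ : Fin n => μ).real
      {S | (∫ S', g S' ∂(Measure.pi fun _ : Fin n => μ)) + t ≤ g S} ≤
        Real.exp (-2 * t ^ 2 / (n * c ^ 2)) := by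
  set ν := Measure.pi fun _ : Fin n => μ
  set m := ∫ S', g S' ∂ν
  have hsub : HasSubgaussianMGF (fun S => g S - m) (Real.toNNReal (n * c ^ 2 / 4)) ν := by
    refine ⟨fun s => ?_, fun s => ?_⟩
    · refine integrable_of_measurable_of_abs_le (B := Real.exp (|s| * (B + |m|))) (by fun_prop)
        fun S => ?_
      rw [abs_of_pos (Real.exp_pos _), Real.exp_le_exp]
      refine (le_abs_self _).trans ?_
      rw [abs_mul]
      gcongr
      exact (abs_sub _ _).trans (add_le_add (hB S) le_rfl)
    · rw [Real.coe_toNNReal _ (by positivity)]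
      exact integral_exp_le_of_bounded_diff μ n hg hc0.le hB hc s
  have h := hsub.measure_ge_le ht
  rw [Real.coe_toNNReal _ (by positivity)] at h
  have hn' : (0 : ℝ) < n := by exact_mod_cast hn
  have e : -t ^ 2 / (2 * (n * c ^ 2 / 4)) = -2 * t ^ 2 / (n * c ^ 2) := by
    field_simp
    norm_num
  rw [e] at h
  refine le_trans (le_of_eq ?_) h
  congr 1
  ext S
  simp only [Set.mem_ofPred_eq]
  constructor <;> intro h <;> linarith

variable {I : Type} [Fintype I] [Nonempty I]

/-- The supremum of a finite family. -/
def finSup (v : I → ℝ) : ℝ := ⨆ τ, v τ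

lemma finSup_lipschitz (v w : I → ℝ) : |finSup v - finSup w| ≤ ‖v - w‖ := by
  have key : ∀ v w : I → ℝ, finSup v ≤ finSup w + ‖v - w‖ := fun v w => ciSup_le fun τ => by
    have h1 := (le_abs_self _).trans (norm_le_pi_norm (v - w) τ)
    have h2 := le_iSup_fin w τ
    simp only [Pi.sub_apply] at h1
    simp only [finSup]
    linarith
  rw [abs_le]
  constructor
  · have := key w v; rw [norm_sub_rev] at this; linarith
  · linarith [key v w]

lemma finSup_convex : ConvexOn ℝ Set.univ (finSup : (I → ℝ) → ℝ) := by
  refine ⟨convex_univ, fun v _ w _ a b ha hb _ => ciSup_le fun τ => ?_⟩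
  simp only [Pi.add_apply, Pi.smul_apply, smul_eq_mul]
  have h1 := le_iSup_fin v τ
  have h2 := le_iSup_fin w τ
  simp only [finSup]
  gcongr

omit [Nonempty I] in
lemma signAvg_lipschitz (l : List (I → ℝ)) {Ψ : (I → ℝ) → ℝ}
    (h : ∀ v w, |Ψ v - Ψ w| ≤ ‖v - w‖) (v w : I → ℝ) :
    |signAvg l Ψ v - signAvg l Ψ w| ≤ ‖v - w‖ := by
  induction l generalizing v w with
  | nil => exact h v w
  | cons F l ih =>
    simp only [signAvg]
    have h1 := abs_le.1 (ih (v + F) (w + F))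
    have h2 := abs_le.1 (ih (v - F) (w - F))
    rw [add_sub_add_right_eq_sub] at h1
    rw [sub_sub_sub_cancel_right] at h2
    exact abs_le.2 ⟨by linarith, by linarith⟩

omit [Fintype I] [Nonempty I] in
lemma signAvg_convex (l : List (I → ℝ)) {Ψ : (I → ℝ) → ℝ} (h : ConvexOn ℝ Set.univ Ψ) :
    ConvexOn ℝ Set.univ (signAvg l Ψ) := by
  induction l with
  | nil => exact h
  | cons F l ih =>
    refine ⟨convex_univ, fun v _ w _ a b ha hb hab => ?_⟩
    simp only [signAvg, smul_eq_mul]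
    have h1 := ih.2 (Set.mem_univ (v + F)) (Set.mem_univ (w + F)) ha hb hab
    have h2 := ih.2 (Set.mem_univ (v - F)) (Set.mem_univ (w - F)) ha hb hab
    have e1 : a • (v + F) + b • (w + F) = a • v + b • w + F := by
      rw [smul_add, smul_add, add_add_add_comm, ← add_smul, hab, one_smul]
    have e2 : a • (v - F) + b • (w - F) = a • v + b • w - F := by
      rw [smul_sub, smul_sub, sub_add_sub_comm, ← add_smul, hab, one_smul]
    rw [e1, smul_eq_mul, smul_eq_mul] at h1
    rw [e2, smul_eq_mul, smul_eq_mul] at h2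
    linarith

omit [Nonempty I] in
lemma abs_signAvg_ofFn_le {Ψ : (I → ℝ) → ℝ} (hlip : ∀ v w, |Ψ v - Ψ w| ≤ ‖v - w‖) {n : ℕ}
    {F : Fin n → I → ℝ} {b : ℝ} (hF : ∀ i, ‖F i‖ ≤ b) (v : I → ℝ) :
    |signAvg (List.ofFn F) Ψ v| ≤ |Ψ v| + n * b := by
  induction n generalizing v with
  | zero => simp [signAvg]
  | succ n ih =>
    simp only [List.ofFn_succ, signAvg]
    have h1 := ih (fun i => hF i.succ) (v + F 0)
    have h2 := ih (fun i => hF i.succ) (v - F 0)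
    have h3 := hlip (v + F 0) v
    have h4 := hlip (v - F 0) v
    have h5 := hF 0
    rw [add_sub_cancel_left] at h3
    rw [sub_sub_cancel_left, norm_neg] at h4
    have h6 := abs_sub_abs_le_abs_sub (Ψ (v + F 0)) (Ψ v)
    have h7 := abs_sub_abs_le_abs_sub (Ψ (v - F 0)) (Ψ v)
    have h8 := abs_le.1 h1
    have h9 := abs_le.1 h2
    push_cast
    exact abs_le.2 ⟨by linarith, by linarith⟩

omit [Nonempty I] in
lemma measurable_of_lipschitz {Ψ : (I → ℝ) → ℝ} (h : ∀ v w, |Ψ v - Ψ w| ≤ ‖v - w‖) :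
    Measurable Ψ := by
  have : LipschitzWith 1 Ψ := LipschitzWith.of_dist_le_mul fun v w => by
    rw [NNReal.coe_one, one_mul, dist_eq_norm, dist_eq_norm]; exact h v w
  exact this.continuous.measurable

omit [Fintype I] [Nonempty I] in
lemma measurable_signAvg_ofFn {Ω : Type*} [MeasurableSpace Ω] {n : ℕ} {F : Fin n → Ω → I → ℝ}
    (hF : ∀ i, Measurable (F i)) {Ψ : (I → ℝ) → ℝ} (hΨ : Measurable Ψ) {v : Ω → I → ℝ}
    (hv : Measurable v) : Measurable fun ω => signAvg (List.ofFn fun i => F i ω) Ψ (v ω) := by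
  induction n generalizing v with
  | zero => exact hΨ.comp hv
  | succ n ih =>
    simp only [List.ofFn_succ, signAvg]
    exact ((ih (fun i => hF i.succ) (hv.add (hF 0))).add
      (ih (fun i => hF i.succ) (hv.sub (hF 0)))).div_const 2

omit [Nonempty I] in
/-- Symmetrization of one summand. -/
lemma integral_symmetrize {ℓ : X → I → ℝ} (hℓ : Measurable ℓ) {b : ℝ} (hb : ∀ x, ‖ℓ x‖ ≤ b)
    {Ψ : (I → ℝ) → ℝ} (hlip : ∀ v w, |Ψ v - Ψ w| ≤ ‖v - w‖) (hconv : ConvexOn ℝ Set.univ Ψ)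
    (v : I → ℝ) :
    ∫ x, Ψ (v + ((∫ y, ℓ y ∂μ) - ℓ x)) ∂μ ≤ ∫ x, signAvg [(2 : ℝ) • ℓ x] Ψ v ∂μ := by
  have hm := measurable_of_lipschitz hlip
  have hint : ∀ (f : X → I → ℝ), Measurable f → (∃ B, ∀ x, ‖f x‖ ≤ B) →
      Integrable (fun x => Ψ (v + f x)) μ := by
    rintro f hf ⟨B, hB⟩
    refine integrable_of_measurable_of_abs_le (B := |Ψ v| + B) (hm.comp (hf.const_add v))
      fun x => ?_
    have h1 := hlip (v + f x) v
    rw [add_sub_cancel_left] at h1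
    have h2 := hB x
    have h3 := abs_sub_abs_le_abs_sub (Ψ (v + f x)) (Ψ v)
    linarith
  have hℓi : Integrable ℓ μ :=
    Integrable.of_bound hℓ.aestronglyMeasurable b (Filter.Eventually.of_forall hb)
  set E := ∫ y, ℓ y ∂μ with hE
  have i1 : Integrable (fun x => Ψ (v + (E - ℓ x))) μ :=
    hint _ (hℓ.const_sub E) ⟨‖E‖ + b, fun x => (norm_sub_le _ _).trans (by gcongr; exact hb x)⟩
  have hb2 : ∃ B, ∀ x, ‖(2 : ℝ) • ℓ x‖ ≤ B := ⟨2 * b, fun x => by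
    rw [norm_smul, Real.norm_ofNat]; gcongr; exact hb x⟩
  have i2 : Integrable (fun x => Ψ (v + (2 : ℝ) • ℓ x)) μ :=
    hint (fun x => (2 : ℝ) • ℓ x) (hℓ.const_smul (2 : ℝ)) hb2
  have i3 : Integrable (fun x => Ψ (v - (2 : ℝ) • ℓ x)) μ := by
    simp only [sub_eq_add_neg]
    exact hint (fun x => -((2 : ℝ) • ℓ x)) (hℓ.const_smul (2 : ℝ)).neg (by simpa using hb2)
  have hcont : Continuous Ψ := by
    have : LipschitzWith 1 Ψ := LipschitzWith.of_dist_le_mul fun v w => by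
      rw [NNReal.coe_one, one_mul, dist_eq_norm, dist_eq_norm]; exact hlip v w
    exact this.continuous
  have hjensen : Ψ (v + (2 : ℝ) • E) ≤ ∫ x, Ψ (v + (2 : ℝ) • ℓ x) ∂μ := by
    have h := hconv.map_integral_le (μ := μ) (f := fun x => v + (2 : ℝ) • ℓ x) hcont.continuousOn
      isClosed_univ (Filter.Eventually.of_forall fun _ => Set.mem_univ _)
      ((integrable_const v).add (hℓi.smul (2 : ℝ))) i2
    have e : ∫ x, (v + (2 : ℝ) • ℓ x) ∂μ = v + (2 : ℝ) • E := by
      rw [integral_add (f := fun _ => v) (g := fun x => (2 : ℝ) • ℓ x) (integrable_const v)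
        (hℓi.smul (2 : ℝ)), integral_smul, integral_const, probReal_univ, one_smul]
    rwa [e] at h
  have hpt : ∀ x, Ψ (v + (E - ℓ x)) ≤
      1 / 2 * Ψ (v + (2 : ℝ) • E) + 1 / 2 * Ψ (v - (2 : ℝ) • ℓ x) := fun x => by
    have h := hconv.2 (Set.mem_univ (v + (2 : ℝ) • E)) (Set.mem_univ (v - (2 : ℝ) • ℓ x))
      (by norm_num : (0 : ℝ) ≤ 1 / 2) (by norm_num : (0 : ℝ) ≤ 1 / 2) (by norm_num)
    rw [show (1 / 2 : ℝ) • (v + (2 : ℝ) • E) + (1 / 2 : ℝ) • (v - (2 : ℝ) • ℓ x) =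
      v + (E - ℓ x) by module] at h
    simpa using h
  calc _ ≤ ∫ x, (1 / 2 * Ψ (v + (2 : ℝ) • E) + 1 / 2 * Ψ (v - (2 : ℝ) • ℓ x)) ∂μ :=
        integral_mono i1 ((integrable_const _).add (i3.const_mul _)) hpt
    _ = 1 / 2 * Ψ (v + (2 : ℝ) • E) + 1 / 2 * ∫ x, Ψ (v - (2 : ℝ) • ℓ x) ∂μ := by
        rw [integral_add (integrable_const _) (i3.const_mul _), integral_const, probReal_univ,
          one_smul, integral_const_mul]
    _ ≤ 1 / 2 * (∫ x, Ψ (v + (2 : ℝ) • ℓ x) ∂μ) + 1 / 2 * ∫ x, Ψ (v - (2 : ℝ) • ℓ x) ∂μ := by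
        gcongr
    _ = _ := by
        simp only [signAvg]
        rw [integral_div, integral_add i2 i3]
        ring

omit [Nonempty I] in
/-- Symmetrization: centred sums are dominated by twice the sums with random signs. -/
lemma integral_pi_symmetrize {ℓ : X → I → ℝ} (hℓ : Measurable ℓ) {b : ℝ} (hb : ∀ x, ‖ℓ x‖ ≤ b)
    {Ψ : (I → ℝ) → ℝ} (hlip : ∀ v w, |Ψ v - Ψ w| ≤ ‖v - w‖) (hconv : ConvexOn ℝ Set.univ Ψ)
    (n : ℕ) (v : I → ℝ) :
    ∫ S : Fin n → X, Ψ (v + ∑ i, ((∫ y, ℓ y ∂μ) - ℓ (S i))) ∂(Measure.pi fun _ : Fin n => μ) ≤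
      ∫ S : Fin n → X, signAvg (List.ofFn fun i => (2 : ℝ) • ℓ (S i)) Ψ v
        ∂(Measure.pi fun _ : Fin n => μ) := by
  have hm := measurable_of_lipschitz hlip
  set E := ∫ y, ℓ y ∂μ with hE
  have hb0 : 0 ≤ b := by
    obtain ⟨x⟩ := nonempty_of_isProbabilityMeasure μ
    exact (norm_nonneg _).trans (hb x)
  -- boundedness of the integrands
  have hbd1 : ∀ (n : ℕ) (v : I → ℝ) (S : Fin n → X),
      |Ψ (v + ∑ i, (E - ℓ (S i)))| ≤ |Ψ v| + n * (‖E‖ + b) := fun n v S => by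
    have h1 := hlip (v + ∑ i, (E - ℓ (S i))) v
    rw [add_sub_cancel_left] at h1
    have h2 : ‖∑ i, (E - ℓ (S i))‖ ≤ n * (‖E‖ + b) := by
      refine (norm_sum_le _ _).trans ((Finset.sum_le_sum fun i _ =>
        (norm_sub_le E (ℓ (S i))).trans (add_le_add le_rfl (hb _))).trans ?_)
      simp [mul_add]
    have h3 := abs_sub_abs_le_abs_sub (Ψ (v + ∑ i, (E - ℓ (S i)))) (Ψ v)
    linarith
  have hb2 : ∀ x, ‖(2 : ℝ) • ℓ x‖ ≤ 2 * b := fun x => by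
    rw [norm_smul, Real.norm_ofNat]; gcongr; exact hb x
  have hbd2 : ∀ (n : ℕ) (v : I → ℝ) (S : Fin n → X),
      |signAvg (List.ofFn fun i => (2 : ℝ) • ℓ (S i)) Ψ v| ≤ |Ψ v| + n * (2 * b) := fun n v S =>
    abs_signAvg_ofFn_le hlip (fun i => hb2 (S i)) v
  have hms : ∀ n, Measurable fun z : (I → ℝ) × (Fin n → X) =>
      signAvg (List.ofFn fun i => (2 : ℝ) • ℓ (z.2 i)) Ψ z.1 := fun n =>
    measurable_signAvg_ofFn (F := fun i (z : (I → ℝ) × (Fin n → X)) => (2 : ℝ) • ℓ (z.2 i))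
      (fun i => (hℓ.const_smul (2 : ℝ)).comp ((measurable_pi_apply i).comp measurable_snd)) hm
      measurable_fst
  have hmv : ∀ n (v : I → ℝ), Measurable fun S : Fin n → X => Ψ (v + ∑ i, (E - ℓ (S i))) :=
    fun n v => hm.comp ((Finset.measurable_sum _ fun i _ =>
      (hℓ.comp (measurable_pi_apply i)).const_sub E).const_add v)
  induction n generalizing v with
  | zero => simp [signAvg]
  | succ n ih =>
    set ν := Measure.pi fun _ : Fin n => μ
    rw [integral_pi_succ μ (hmv (n + 1) v) (hbd1 (n + 1) v),
      integral_pi_succ μ (f := fun S => signAvg (List.ofFn fun i => (2 : ℝ) • ℓ (S i)) Ψ v)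
        ((hms (n + 1)).comp measurable_prodMk_left) (hbd2 (n + 1) v)]
    simp only [Fin.sum_univ_succ, Fin.cons_zero, Fin.cons_succ, List.ofFn_succ, ← add_assoc]
    have hR : ∀ x : X, |Ψ (v + (E - ℓ x))| ≤ |Ψ v| + (‖E‖ + b) := fun x => by
      have := hbd1 1 v (fun _ => x)
      simpa using this
    have hjm : Measurable fun z : X × (Fin n → X) =>
        signAvg (List.ofFn fun i => (2 : ℝ) • ℓ (z.2 i)) Ψ (v + (E - ℓ z.1)) :=
      (hms n).comp ((((hℓ.comp measurable_fst).const_sub E).const_add v).prodMk measurable_snd)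
    have hji : Integrable (fun z : X × (Fin n → X) =>
        signAvg (List.ofFn fun i => (2 : ℝ) • ℓ (z.2 i)) Ψ (v + (E - ℓ z.1))) (μ.prod ν) :=
      integrable_of_measurable_of_abs_le (B := |Ψ v| + (‖E‖ + b) + n * (2 * b)) hjm fun z =>
        (hbd2 n _ _).trans (by linarith [hR z.1])
    have hjm2 : Measurable fun z : X × (Fin n → X) =>
        signAvg ((2 : ℝ) • ℓ z.1 :: List.ofFn fun i => (2 : ℝ) • ℓ (z.2 i)) Ψ v := by
      have := (hms (n + 1)).comp
        ((measurable_const (a := v)).prodMk (measurable_fin_cons (X := X) (n := n)))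
      refine (congrArg Measurable (funext fun z => ?_)).mp this
      simp [List.ofFn_succ]
    have hji2 : Integrable (fun z : X × (Fin n → X) =>
        signAvg ((2 : ℝ) • ℓ z.1 :: List.ofFn fun i => (2 : ℝ) • ℓ (z.2 i)) Ψ v) (μ.prod ν) :=
      integrable_of_measurable_of_abs_le (B := |Ψ v| + (n + 1 : ℕ) * (2 * b)) hjm2 fun z => by
        have := hbd2 (n + 1) v (Fin.cons z.1 z.2)
        simpa [List.ofFn_succ] using this
    have hlm : Integrable
        (fun x => ∫ S : Fin n → X, Ψ (v + (E - ℓ x) + ∑ i, (E - ℓ (S i))) ∂ν) μ := by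
      have hmm : Measurable fun z : X × (Fin n → X) =>
          Ψ (v + (E - ℓ z.1) + ∑ i, (E - ℓ (z.2 i))) :=
        hm.comp ((((hℓ.comp measurable_fst).const_sub E).const_add v).add
          (Finset.measurable_sum _ fun i _ =>
            (hℓ.comp ((measurable_pi_apply i).comp measurable_snd)).const_sub E))
      have : Integrable (fun z : X × (Fin n → X) =>
          Ψ (v + (E - ℓ z.1) + ∑ i, (E - ℓ (z.2 i)))) (μ.prod ν) :=
        integrable_of_measurable_of_abs_le (B := |Ψ v| + (‖E‖ + b) + n * (‖E‖ + b)) hmm fun z =>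
          (hbd1 n _ _).trans (by linarith [hR z.1])
      exact this.integral_prod_left
    have hadd : ∀ x (S : Fin n → X), v + E - ℓ x = v + (E - ℓ x) := fun x S => by abel
    calc ∫ x, ∫ S, Ψ (v + (E - ℓ x) + ∑ i, (E - ℓ (S i))) ∂ν ∂μ
        ≤ ∫ x, ∫ S, signAvg (List.ofFn fun i => (2 : ℝ) • ℓ (S i)) Ψ (v + (E - ℓ x)) ∂ν ∂μ :=
          integral_mono hlm hji.integral_prod_left fun x => ih _
      _ = ∫ S, ∫ x, signAvg (List.ofFn fun i => (2 : ℝ) • ℓ (S i)) Ψ (v + (E - ℓ x)) ∂μ ∂ν :=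
          integral_integral_swap hji
      _ ≤ ∫ S, ∫ x, signAvg ((2 : ℝ) • ℓ x :: List.ofFn fun i => (2 : ℝ) • ℓ (S i)) Ψ v ∂μ ∂ν :=
          integral_mono hji.integral_prod_right hji2.integral_prod_right fun S =>
            integral_symmetrize μ hℓ hb (signAvg_lipschitz _ hlip) (signAvg_convex _ hconv) v
      _ = _ := (integral_integral_swap hji2).symm

/-- Uniform deviation of empirical means over a finite class with values in `[0, b]`, whose
empirical Rademacher sums are bounded by `R`. -/
lemma measure_exists_deviation_le {n : ℕ} (hn : 0 < n) {ℓ : X → I → ℝ} (hℓ : Measurable ℓ) {b : ℝ}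
    (hb0 : 0 < b) (hb : ∀ x τ, 0 ≤ ℓ x τ ∧ ℓ x τ ≤ b) {R : ℝ}
    (hR : ∀ S : Fin n → X, signAvg (List.ofFn fun i => ℓ (S i)) finSup 0 ≤ R) {δ : ℝ}
    (hδ : 0 < δ) (hδ1 : δ ≤ 1) :
    (Measure.pi fun _ : Fin n => μ) {S | ∃ τ, 2 * R + b * √(n * Real.log (1 / δ) / 2) <
      n * (∫ x, ℓ x τ ∂μ) - ∑ i, ℓ (S i) τ} ≤ ENNReal.ofReal δ := by
  set ν := Measure.pi fun _ : Fin n => μ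
  have hnorm : ∀ x, ‖ℓ x‖ ≤ b := fun x => (pi_norm_le_iff_of_nonneg hb0.le).2 fun τ => by
    rw [Real.norm_eq_abs, abs_of_nonneg (hb x τ).1]; exact (hb x τ).2
  have hℓi : Integrable ℓ μ :=
    Integrable.of_bound hℓ.aestronglyMeasurable b (Filter.Eventually.of_forall hnorm)
  have hn' : (0 : ℝ) < n := by exact_mod_cast hn
  set E := ∫ y, ℓ y ∂μ with hE
  have hEτ : ∀ τ, E τ = ∫ x, ℓ x τ ∂μ := fun τ => by
    rw [hE, eval_integral (fun i => hℓi.eval i)]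
  set g : (Fin n → X) → ℝ := fun S => finSup (∑ i, (E - ℓ (S i))) with hg
  have hgm : Measurable g := (measurable_of_lipschitz finSup_lipschitz).comp
    (Finset.measurable_sum _ fun i _ => (hℓ.comp (measurable_pi_apply i)).const_sub E)
  have hgB : ∀ S, |g S| ≤ n * (‖E‖ + b) := fun S => by
    have h1 := finSup_lipschitz (∑ i, (E - ℓ (S i))) 0
    have h0 : finSup (0 : I → ℝ) = 0 := by simp [finSup]
    rw [h0, sub_zero, sub_zero] at h1
    refine h1.trans ((norm_sum_le _ _).trans ((Finset.sum_le_sum fun i _ =>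
        (norm_sub_le E (ℓ (S i))).trans (add_le_add le_rfl (hnorm _))).trans ?_))
    simp [mul_add]
  have hgc : ∀ S i x, |g (Function.update S i x) - g S| ≤ b := fun S i x => by
    refine (finSup_lipschitz _ _).trans ?_
    have e : ∑ j, (E - ℓ (Function.update S i x j)) - ∑ j, (E - ℓ (S j)) = ℓ (S i) - ℓ x := by
      rw [← Finset.sum_sub_distrib, Finset.sum_eq_single i]
      · simp
      · intro j _ hj; simp [Function.update_of_ne hj]
      · simp
    rw [e]
    refine (pi_norm_le_iff_of_nonneg hb0.le).2 fun τ => ?_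
    have h1 := hb x τ
    have h2 := hb (S i) τ
    exact abs_le.2 ⟨by simp only [Pi.sub_apply]; linarith, by simp only [Pi.sub_apply]; linarith⟩
  have hmean : ∫ S, g S ∂ν ≤ 2 * R := by
    have h1 := integral_pi_symmetrize μ hℓ hnorm finSup_lipschitz finSup_convex n (0 : I → ℝ)
    simp only [zero_add] at h1
    have h2 : ∀ S : Fin n → X,
        signAvg (List.ofFn fun i => (2 : ℝ) • ℓ (S i)) finSup 0 ≤ 2 * R := fun S => by
      let f : (I → ℝ) →+ (I → ℝ) := AddMonoidHom.mk' (fun v => (2 : ℝ) • v) (smul_add 2)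
      have h3 := signAvg_map f (List.ofFn fun i => ℓ (S i)) finSup 0
      rw [map_zero, List.map_ofFn] at h3
      have h4 : (fun w : I → ℝ => finSup (f w)) = fun w => 2 * finSup w := by
        funext w
        exact (Real.mul_iSup_of_nonneg zero_le_two _).symm
      rw [h4, signAvg_const_mul] at h3
      have h5 : (⇑f ∘ fun i => ℓ (S i)) = fun i => (2 : ℝ) • ℓ (S i) := rfl
      rw [h5] at h3
      rw [h3]
      linarith [hR S]
    have h6 : Integrable (fun S : Fin n → X =>
        signAvg (List.ofFn fun i => (2 : ℝ) • ℓ (S i)) finSup 0) ν := by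
      refine integrable_of_measurable_of_abs_le (B := |finSup (0 : I → ℝ)| + n * (2 * b))
        (measurable_signAvg_ofFn (F := fun i (S : Fin n → X) => (2 : ℝ) • ℓ (S i))
          (fun i => (hℓ.const_smul (2 : ℝ)).comp (measurable_pi_apply i))
          (measurable_of_lipschitz finSup_lipschitz) measurable_const) fun S => ?_
      refine abs_signAvg_ofFn_le finSup_lipschitz (fun i => ?_) 0
      rw [norm_smul, Real.norm_ofNat]; gcongr; exact hnorm _
    refine h1.trans ((integral_mono h6 (integrable_const (2 * R)) h2).trans ?_)
    simp
  set t := b * √(n * Real.log (1 / δ) / 2) with ht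
  have ht0 : 0 ≤ t := by positivity
  have hlog : 0 ≤ Real.log (1 / δ) := Real.log_nonneg (by rw [le_div_iff₀ hδ]; linarith)
  have htail := measure_ge_le_of_bounded_diff μ hn hgm hb0 hgB hgc ht0
  have e : Real.exp (-2 * t ^ 2 / (n * b ^ 2)) = δ := by
    rw [ht, mul_pow, Real.sq_sqrt (by positivity)]
    have : -2 * (b ^ 2 * (n * Real.log (1 / δ) / 2)) / (n * b ^ 2) = Real.log δ := by
      rw [one_div, Real.log_inv]
      field_simp
    rw [this, Real.exp_log hδ]
  rw [e] at htail
  have hsub : {S | ∃ τ, 2 * R + t < n * (∫ x, ℓ x τ ∂μ) - ∑ i, ℓ (S i) τ} ⊆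
      {S | (∫ S', g S' ∂ν) + t ≤ g S} := by
    rintro S ⟨τ, hτ⟩
    have h1 := le_iSup_fin (∑ i, (E - ℓ (S i))) τ
    have h2 : (∑ i, (E - ℓ (S i))) τ = n * (∫ x, ℓ x τ ∂μ) - ∑ i, ℓ (S i) τ := by
      simp [Finset.sum_apply, hEτ]
    rw [h2] at h1
    have h3 : (⨆ τ, (∑ i, (E - ℓ (S i))) τ) = g S := rfl
    rw [h3] at h1
    simp only [Set.mem_ofPred_eq]
    linarith
  refine (measure_mono hsub).trans ?_
  rw [← ofReal_measureReal]
  exact ENNReal.ofReal_le_ofReal htail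

end Deviation

/-! ### Continuity of the network -/

lemma continuous_coef (l j : ℕ) : Continuous fun Θ : Params N => coef Θ l j := by
  unfold coef
  split_ifs
  · exact continuous_apply _
  · exact continuous_const
  · exact continuous_const

lemma continuous_input (i : ℕ) : Continuous fun x : EuclideanSpace ℝ (Fin N.d) => input x i := by
  unfold input
  split_ifs
  · fun_prop
  · exact continuous_const

lemma continuous_preact {Ω : Type*} [TopologicalSpace Ω] {Θ : Ω → Params N} (hΘ : Continuous Θ)
    (l : ℕ) {z : Ω → ℕ → ℝ} (hz : ∀ k, Continuous fun ω => z ω k) (k : ℕ) :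
    Continuous fun ω => preact (Θ ω) l (z ω) k := by
  unfold preact
  split_ifs
  · exact continuous_finsetSum _ fun a _ => ((continuous_coef l a).comp hΘ).mul (hz _)
  · exact continuous_finsetSum _ fun a _ => ((continuous_coef l _).comp hΘ).mul (hz _)

lemma continuous_relu : Continuous relu := continuous_id.max continuous_const

lemma continuous_hidden (l : ℕ) (hl : l ≤ N.L) (k : ℕ) :
    Continuous fun z : Params N × EuclideanSpace ℝ (Fin N.d) => hidden z.1 z.2 l k := by
  induction l generalizing k with
  | zero => exact (continuous_input k).comp continuous_snd
  | succ l ih =>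
    have hy : ∀ k, Continuous fun z : Params N × EuclideanSpace ℝ (Fin N.d) =>
        relu (preact z.1 l (hidden z.1 z.2 l) k) := fun k =>
      continuous_relu.comp (continuous_preact continuous_fst l (fun k => ih (by omega) k) k)
    by_cases h : l < N.LC
    · simp only [hidden, if_pos h, pool]
      by_cases hm : N.maxPool l = true
      · simp only [if_pos hm]
        have hne : (Finset.univ : Finset (Fin (N.kernel l))).Nonempty :=
          ⟨⟨0, N.kernel_pos l h⟩, Finset.mem_univ _⟩
        have : Nonempty (Fin (N.kernel l)) := ⟨⟨0, N.kernel_pos l h⟩⟩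
        simp only [← Finset.sup'_univ_eq_ciSup]
        exact Continuous.finset_sup'_apply hne fun b _ => hy _
      · simp only [if_neg hm]
        exact (continuous_finsetSum _ fun b _ => hy _).div_const _
    · simp only [hidden, if_neg h]
      exact hy k

lemma continuous_net (p : ℝ) :
    Continuous fun z : Params N × EuclideanSpace ℝ (Fin N.d) => net p z.1 z.2 := by
  unfold net
  exact continuous_const.mul (continuous_finsetSum _ fun k _ =>
    ((continuous_coef _ _).comp continuous_fst).mul (continuous_hidden _ le_rfl k))

lemma continuous_loss (p : ℝ) : Continuous fun z : Params N × Data N => loss p z.1 z.2 := by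
  unfold loss
  have := (continuous_net (N := N) p).comp
    (continuous_fst.prodMk (continuous_snd.fst) : Continuous fun z : Params N × Data N =>
      (z.1, z.2.1))
  exact ((this.sub continuous_snd.snd).pow 2).div_const 2

lemma continuous_empRisk (p : ℝ) {n : ℕ} (S : Fin n → Data N) :
    Continuous fun Θ : Params N => empRisk p S Θ := by
  have h : ∀ i : Fin n, Continuous fun Θ : Params N => loss p Θ (S i) := fun i =>
    (continuous_loss p).comp (g := fun w : Params N × Data N => loss p w.1 w.2)
      (f := fun Θ : Params N => (Θ, S i)) (continuous_id.prodMk continuous_const)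
  exact (continuous_finsetSum _ fun i _ => h i).div_const _

/-! ### The generalization error, uniformly over the networks -/

/-- Uniform deviations over finitely many bounded networks with product of layer norms at most
`G`. -/
lemma measure_exists_genError_le_finite {I : Type} [Fintype I] [Nonempty I] {p Cf Cy G δ : ℝ}
    {n : ℕ} (hn : 0 < n) {μ : Measure (Data N)} [IsProbabilityMeasure μ] (hCf : 0 ≤ Cf)
    (hCy : Cy ≤ 1) (hμ : ∀ᵐ z ∂μ, ‖z.1‖ ≤ 1 ∧ |z.2| ≤ Cy) (hG0 : 0 < G) (hδ : 0 < δ)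
    (hδ1 : δ ≤ 1) (Θ : I → Params N) (hG : ∀ τ, pathNorm (Θ τ) ≤ G)
    (hΘ : ∀ τ, ∀ᵐ z ∂μ, |net p (Θ τ) z.1| ≤ Cf) :
    (Measure.pi fun _ : Fin n => μ) {S | ∃ τ,
      2 * (Cf + 1) * (N.C * (G / (N.m : ℝ) ^ p)) / √n +
        (Cf + 1) ^ 2 / 2 * √(Real.log (1 / δ) / (2 * n)) < genError p μ S (Θ τ)} ≤
      ENNReal.ofReal δ := by
  have hn' : (0 : ℝ) < n := by exact_mod_cast hn
  have hgood : ∀ᵐ z ∂μ, ‖z.1‖ ≤ 1 ∧ |z.2| ≤ 1 ∧ ∀ τ, |net p (Θ τ) z.1| ≤ Cf := by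
    filter_upwards [hμ, ae_all_iff.2 hΘ] with z h1 h2
    exact ⟨h1.1, h1.2.trans hCy, h2⟩
  -- a measurable retraction onto a set of full measure where all bounds hold
  obtain ⟨z₀, hz₀⟩ := hgood.exists
  set A : Set (Data N) := {z | ‖z.1‖ ≤ 1 ∧ |z.2| ≤ 1 ∧ ∀ τ, |net p (Θ τ) z.1| ≤ Cf}
  have hnet : ∀ τ, Measurable fun z : Data N => net p (Θ τ) z.1 := fun τ =>
    ((continuous_net p).comp (continuous_const.prodMk continuous_fst)).measurable
  have hA : MeasurableSet A := by
    refine (measurableSet_le measurable_fst.norm measurable_const).inter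
      ((measurableSet_le (continuous_abs.measurable.comp measurable_snd) measurable_const).inter ?_)
    have : {z : Data N | ∀ τ, |net p (Θ τ) z.1| ≤ Cf} =
        ⋂ τ, {z : Data N | |net p (Θ τ) z.1| ≤ Cf} := by ext z; simp
    change MeasurableSet {z : Data N | ∀ τ, |net p (Θ τ) z.1| ≤ Cf}
    rw [this]
    exact MeasurableSet.iInter fun τ =>
      measurableSet_le (continuous_abs.measurable.comp (hnet τ)) measurable_const
  classical
  set r : Data N → Data N := fun z => if z ∈ A then z else z₀
  have hr : Measurable r := Measurable.ite hA measurable_id measurable_const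
  have hrA : ∀ z, r z ∈ A := fun z => by
    by_cases h : z ∈ A
    · simp only [r, if_pos h]; exact h
    · simp only [r, if_neg h]; exact hz₀
  have hr_id : ∀ᵐ z ∂μ, r z = z := hgood.mono fun z hz => if_pos hz
  set ℓ : Data N → I → ℝ := fun z τ => loss p (Θ τ) (r z)
  have hℓ : Measurable ℓ := measurable_pi_lambda _ fun τ =>
    ((continuous_loss p).comp (continuous_const.prodMk continuous_id)).measurable.comp hr
  have hb : ∀ z τ, 0 ≤ ℓ z τ ∧ ℓ z τ ≤ (Cf + 1) ^ 2 / 2 := fun z τ => by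
    obtain ⟨-, h1, h2⟩ := hrA z
    have h3 := abs_le.1 (h2 τ)
    have h4 := abs_le.1 h1
    simp only [ℓ, loss]
    have h5 : (net p (Θ τ) (r z).1 - (r z).2) ^ 2 ≤ (Cf + 1) ^ 2 :=
      sq_le_sq' (by linarith) (by linarith)
    exact ⟨by positivity, by linarith⟩
  have hR : ∀ S : Fin n → Data N, signAvg (List.ofFn fun i => ℓ (S i)) finSup 0 ≤
      (Cf + 1) * (N.C * (G / (N.m : ℝ) ^ p)) * √n := fun S => by
    have h := signAvg_loss_le Θ p hG0 hCf hG (List.ofFn fun i => r (S i)) (by simpa using hn)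
      (fun z hz => by
        obtain ⟨i, rfl⟩ := List.mem_ofFn.1 hz
        exact hrA _)
    rw [List.map_ofFn, List.length_ofFn] at h
    exact h
  have hdev := measure_exists_deviation_le μ hn hℓ (by positivity) hb hR hδ hδ1
  have hnull : ∀ᵐ S ∂(Measure.pi fun _ : Fin n => μ), ∀ i, r (S i) = S i :=
    ae_all_iff.2 fun i => (Measure.quasiMeasurePreserving_eval (fun _ : Fin n => μ) i).ae hr_id
  refine le_trans (measure_mono_ae ?_) hdev
  filter_upwards [hnull] with S hS
  rintro ⟨τ, hτ⟩
  refine ⟨τ, ?_⟩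
  have e1 : ∫ z, ℓ z τ ∂μ = popRisk p μ (Θ τ) :=
    integral_congr_ae (hr_id.mono fun z hz => by simp only [ℓ]; rw [hz])
  have e2 : ∑ i, ℓ (S i) τ = n * empRisk p S (Θ τ) := by
    rw [empRisk, mul_div_cancel₀ _ hn'.ne']
    exact Finset.sum_congr rfl fun i _ => by simp only [ℓ]; rw [hS]
  rw [e1, e2, ← mul_sub]
  have h := mul_lt_mul_of_pos_left hτ hn'
  refine lt_of_eq_of_lt ?_ h
  have hsq : (n : ℝ) = √n * √n := (Real.mul_self_sqrt hn'.le).symm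
  have e3 : √(n * Real.log (1 / δ) / 2) = n * √(Real.log (1 / δ) / (2 * n)) := by
    rw [show (n : ℝ) * Real.log (1 / δ) / 2 = n ^ 2 * (Real.log (1 / δ) / (2 * n)) by field_simp,
      Real.sqrt_mul (by positivity), Real.sqrt_sq hn'.le]
  rw [e3, mul_add]
  congr 1
  · generalize N.C * (G / (N.m : ℝ) ^ p) = Y
    have : (n : ℝ) / √n = √n := Real.div_sqrt
    linear_combination (-(2 * (Cf + 1) * Y)) * this
  · ring

/-- Uniform deviations over all bounded networks with product of layer norms at most `G`, by
approximation from a countable set of networks that is dense also with respect to the risk. -/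
lemma measure_exists_genError_le {p Cf Cy G δ : ℝ}
    {n : ℕ} (hn : 0 < n) {μ : Measure (Data N)} [IsProbabilityMeasure μ] (hCf : 0 ≤ Cf)
    (hCy : Cy ≤ 1) (hμ : ∀ᵐ z ∂μ, ‖z.1‖ ≤ 1 ∧ |z.2| ≤ Cy) (hG0 : 0 < G) (hδ : 0 < δ)
    (hδ1 : δ ≤ 1) :
    (Measure.pi fun _ : Fin n => μ) {S | ∃ Θ : Params N, pathNorm Θ ≤ G ∧
      (∀ᵐ z ∂μ, |net p Θ z.1| ≤ Cf) ∧
      2 * (Cf + 1) * (N.C * (G / (N.m : ℝ) ^ p)) / √n +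
        (Cf + 1) ^ 2 / 2 * √(Real.log (1 / δ) / (2 * n)) < genError p μ S Θ} ≤
      ENNReal.ofReal δ := by
  set bd := 2 * (Cf + 1) * (N.C * (G / (N.m : ℝ) ^ p)) / √n +
        (Cf + 1) ^ 2 / 2 * √(Real.log (1 / δ) / (2 * n))
  set 𝒦 : Set (ℝ × Params N) := {w | w.1 = popRisk p μ w.2 ∧ pathNorm w.2 ≤ G ∧
      ∀ᵐ z ∂μ, |net p w.2 z.1| ≤ Cf}
  rcases isEmpty_or_nonempty 𝒦 with hemp | hne
  · have : {S : Fin n → Data N | ∃ Θ : Params N, pathNorm Θ ≤ G ∧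
        (∀ᵐ z ∂μ, |net p Θ z.1| ≤ Cf) ∧ bd < genError p μ S Θ} = ∅ := by
      refine Set.eq_empty_of_forall_notMem fun S hS => ?_
      obtain ⟨Θ, h1, h2, -⟩ := hS
      exact hemp.false ⟨(popRisk p μ Θ, Θ), rfl, h1, h2⟩
    rw [this, measure_empty]
    exact zero_le
  · let D : ℕ → 𝒦 := TopologicalSpace.denseSeq 𝒦
    let U : ℕ → Set (Fin n → Data N) := fun k =>
      {S | ∃ j : Fin (k + 1), bd < genError p μ S (D j).1.2}
    have hsub : {S : Fin n → Data N | ∃ Θ : Params N, pathNorm Θ ≤ G ∧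
        (∀ᵐ z ∂μ, |net p Θ z.1| ≤ Cf) ∧ bd < genError p μ S Θ} ⊆ ⋃ k, U k := by
      rintro S ⟨Θ, h1, h2, h3⟩
      have hopen : IsOpen {w : 𝒦 | bd < w.1.1 - empRisk p S w.1.2} := by
        refine isOpen_lt continuous_const ?_
        exact (continuous_fst.comp continuous_subtype_val).sub
          ((continuous_empRisk p S).comp (continuous_snd.comp continuous_subtype_val))
      obtain ⟨k, hk⟩ := (TopologicalSpace.denseRange_denseSeq 𝒦).exists_mem_open hopen
        ⟨⟨(popRisk p μ Θ, Θ), rfl, h1, h2⟩, h3⟩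
      refine Set.mem_iUnion.2 ⟨k, ⟨k, k.lt_succ_self⟩, ?_⟩
      have hk' : bd < (D k).1.1 - empRisk p S (D k).1.2 := hk
      rwa [(D k).2.1] at hk'
    have hmono : Monotone U := fun k k' hk S ⟨j, hj⟩ =>
      ⟨⟨j, by omega⟩, hj⟩
    refine (measure_mono hsub).trans ?_
    rw [hmono.measure_iUnion]
    refine iSup_le fun k => ?_
    exact measure_exists_genError_le_finite hn hCf hCy hμ hG0 hδ hδ1
      (fun j : Fin (k + 1) => (D j).1.2) (fun j => (D j).2.2.1) (fun j => (D j).2.2.2)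

/-- The constant of the uniform generalization bound. -/
def genConst (Cf δ₀ : ℝ) : ℝ :=
  2 * (2 * (Cf + 1) + (Cf + 1) ^ 2) + (Cf + 1) ^ 2 / 2 +
    (2 * (Cf + 1) + (Cf + 1) ^ 2) / √(Real.log (1 / δ₀))

/-- A generalization bound that holds for all bounded networks at once, with the product of the
layer norms of the network at hand: a union bound over the dyadic scales of that product. The weight
`2 ^ (-j)` of scale `j` costs `√(j / n)`, which the complexity term `2 ^ j / √n` absorbs. -/
lemma measure_exists_genError_le_pathNorm {p Cf Cy δ₀ δ : ℝ}
    {n : ℕ} (hn : 0 < n) {μ : Measure (Data N)} [IsProbabilityMeasure μ] (hCf : 0 ≤ Cf)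
    (hCy : Cy ≤ 1) (hμ : ∀ᵐ z ∂μ, ‖z.1‖ ≤ 1 ∧ |z.2| ≤ Cy) (hδ : 0 < δ)
    (hδ1 : δ ≤ δ₀) (hδ₀ : δ₀ < 1) :
    (Measure.pi fun _ : Fin n => μ) {S | ∃ Θ : Params N, (∀ᵐ z ∂μ, |net p Θ z.1| ≤ Cf) ∧
      genConst Cf δ₀ * (N.C / ((N.m : ℝ) ^ p * √n) * pathNorm Θ + √(Real.log (1 / δ) / n)) <
        genError p μ S Θ} ≤ ENNReal.ofReal (δ / 2) := by
  have hn' : (0 : ℝ) < n := by exact_mod_cast hn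
  have hm : (0 : ℝ) < N.m := by exact_mod_cast N.m_pos
  have hmp : 0 < (N.m : ℝ) ^ p := Real.rpow_pos_of_pos hm p
  have hC := N.C_pos
  have hsn : 0 < √(n : ℝ) := Real.sqrt_pos.2 hn'
  set δs : ℕ → ℝ := fun j => δ / 2 / 2 / 2 ^ j
  set Gs : ℕ → ℝ := fun j => 2 ^ j * (N.m : ℝ) ^ p / N.C
  have hδs : ∀ j, 0 < δs j := fun j => by positivity
  have hδs1 : ∀ j, δs j ≤ 1 := fun j => by
    have h1 : (1 : ℝ) ≤ 2 ^ j := one_le_pow₀ one_le_two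
    exact (div_le_self (by positivity) h1).trans (by linarith)
  let Bad : ℕ → Set (Fin n → Data N) := fun j => {S | ∃ Θ : Params N, pathNorm Θ ≤ Gs j ∧
      (∀ᵐ z ∂μ, |net p Θ z.1| ≤ Cf) ∧
      2 * (Cf + 1) * (N.C * (Gs j / (N.m : ℝ) ^ p)) / √n +
        (Cf + 1) ^ 2 / 2 * √(Real.log (1 / δs j) / (2 * n)) < genError p μ S Θ}
  have hBad : ∀ j, (Measure.pi fun _ : Fin n => μ) (Bad j) ≤ ENNReal.ofReal (δs j) := fun j =>
    measure_exists_genError_le hn hCf hCy hμ (by positivity) (hδs j) (hδs1 j)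
  refine le_trans (measure_mono (t := ⋃ j, Bad j) ?_) ((measure_iUnion_le _).trans
    ((ENNReal.tsum_le_tsum hBad).trans (le_of_eq ?_)))
  · rintro S ⟨Θ, hΘ, hgen⟩
    set u := N.C * (pathNorm Θ / (N.m : ℝ) ^ p) with hu
    have hex : ∃ j : ℕ, u ≤ 2 ^ j := (pow_unbounded_of_one_lt u one_lt_two).imp fun _ h => h.le
    classical
    obtain ⟨j, hj1, hj2⟩ : ∃ j : ℕ, u ≤ 2 ^ j ∧ (2 : ℝ) ^ j ≤ 1 + 2 * u := by
      refine ⟨Nat.find hex, Nat.find_spec hex, ?_⟩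
      have hu0 : 0 ≤ u := mul_nonneg hC.le
        (div_nonneg (Finset.prod_nonneg fun _ _ => Real.sqrt_nonneg _) hmp.le)
      rcases Nat.eq_zero_or_pos (Nat.find hex) with h | h
      · rw [h]; linarith [pow_zero (2 : ℝ)]
      · have h1 := Nat.find_min hex (Nat.sub_lt h one_pos)
        rw [not_le] at h1
        have h2 : (2 : ℝ) ^ Nat.find hex = 2 * 2 ^ (Nat.find hex - 1) := by
          rw [← pow_succ', Nat.sub_add_cancel h]
        linarith
    refine Set.mem_iUnion.2 ⟨j, Θ, ?_, hΘ, lt_of_le_of_lt ?_ hgen⟩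
    · simp only [Gs]
      rw [le_div_iff₀ hC]
      rw [hu, mul_div_assoc', div_le_iff₀ hmp] at hj1
      linarith
    · have e1 : N.C * (Gs j / (N.m : ℝ) ^ p) = 2 ^ j := by simp only [Gs]; field_simp
      have e2 : N.C / ((N.m : ℝ) ^ p * √n) * pathNorm Θ = u / √n := by rw [hu]; field_simp
      rw [e1, e2]
      set s := √(Real.log (1 / δ) / n) with hs
      -- the union bound costs `j + 2` in the logarithm
      have hlog : Real.log (1 / δs j) = Real.log (1 / δ) + (j + 2) * Real.log 2 := by
        have : 1 / δs j = 1 / δ * 2 ^ (j + 2) := by simp only [δs]; field_simp; ring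
        rw [this, Real.log_mul (by positivity) (by positivity), Real.log_pow]
        push_cast; ring
      have hl2 : Real.log 2 ≤ 1 := by linarith [Real.log_two_lt_d9]
      have hl20 : 0 < Real.log 2 := Real.log_pos one_lt_two
      have hld : 0 < Real.log (1 / δ) := Real.log_pos (by rw [lt_div_iff₀ hδ]; linarith)
      have hld0 : 0 < Real.log (1 / δ₀) :=
        Real.log_pos (by rw [lt_div_iff₀ (by linarith)]; linarith)
      have hsqrt : √(Real.log (1 / δs j) / (2 * n)) ≤ s + 2 * 2 ^ j / √n := by
        have hj4 : ((j : ℝ) + 2) ≤ (2 * 2 ^ j) ^ 2 := by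
          have h1 : ((j : ℝ)) + 1 ≤ 2 ^ j := by exact_mod_cast Nat.lt_two_pow_self
          have h2 : (1 : ℝ) ≤ 2 ^ j := one_le_pow₀ one_le_two
          nlinarith
        have h1 : Real.log (1 / δs j) / (2 * n) ≤ Real.log (1 / δ) / n + (2 * 2 ^ j) ^ 2 / n := by
          rw [hlog, ← add_div, div_le_div_iff₀ (by positivity) hn']
          have : Real.log (1 / δ) + (j + 2) * Real.log 2 ≤
              2 * (Real.log (1 / δ) + (2 * 2 ^ j) ^ 2) := by
            have : ((j : ℝ) + 2) * Real.log 2 ≤ (j + 2) * 1 := by gcongr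
            nlinarith
          nlinarith
        have hs2 : s ^ 2 = Real.log (1 / δ) / n := Real.sq_sqrt (by positivity)
        have hr2 : (2 * 2 ^ j / √(n : ℝ)) ^ 2 = (2 * 2 ^ j) ^ 2 / n := by
          rw [div_pow, Real.sq_sqrt hn'.le]
        have hs0 : 0 ≤ s := Real.sqrt_nonneg _
        have hr0 : 0 ≤ 2 * 2 ^ j / √(n : ℝ) := by positivity
        refine Real.sqrt_le_iff.2 ⟨by positivity, h1.trans ?_⟩
        rw [← hs2, ← hr2]
        nlinarith [mul_nonneg hs0 hr0]
      have hs1 : 1 / √n ≤ s / √(Real.log (1 / δ₀)) := by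
        rw [hs, Real.sqrt_div hld.le, div_div,
          div_le_div_iff₀ hsn (mul_pos hsn (Real.sqrt_pos.2 hld0)), one_mul]
        have : √(Real.log (1 / δ₀)) ≤ √(Real.log (1 / δ)) :=
          Real.sqrt_le_sqrt (Real.log_le_log (one_div_pos.2 (hδ.trans_le hδ1)) (by gcongr))
        nlinarith
      set c₁ := 2 * (Cf + 1) + (Cf + 1) ^ 2 with hc1
      have hc₁ : 0 ≤ c₁ := by positivity
      have hu0 : 0 ≤ u / √n := by
        refine div_nonneg (mul_nonneg hC.le
          (div_nonneg (Finset.prod_nonneg fun _ _ => Real.sqrt_nonneg _) hmp.le)) hsn.le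
      have hs0 : 0 ≤ s := Real.sqrt_nonneg _
      calc 2 * (Cf + 1) * 2 ^ j / √n + (Cf + 1) ^ 2 / 2 * √(Real.log (1 / δs j) / (2 * n))
          ≤ 2 * (Cf + 1) * 2 ^ j / √n + (Cf + 1) ^ 2 / 2 * (s + 2 * 2 ^ j / √n) := by gcongr
        _ = c₁ * (2 ^ j / √n) + (Cf + 1) ^ 2 / 2 * s := by rw [hc1]; ring
        _ ≤ c₁ * ((1 + 2 * u) / √n) + (Cf + 1) ^ 2 / 2 * s := by gcongr
        _ = 2 * c₁ * (u / √n) + c₁ * (1 / √n) + (Cf + 1) ^ 2 / 2 * s := by ring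
        _ ≤ 2 * c₁ * (u / √n) + c₁ * (s / √(Real.log (1 / δ₀))) + (Cf + 1) ^ 2 / 2 * s := by
            gcongr
        _ ≤ genConst Cf δ₀ * (u / √n + s) := by
            have e : genConst Cf δ₀ * (u / √n + s) =
                2 * c₁ * (u / √n) + c₁ * (s / √(Real.log (1 / δ₀))) + (Cf + 1) ^ 2 / 2 * s +
                (2 * c₁ * s + ((Cf + 1) ^ 2 / 2 + c₁ / √(Real.log (1 / δ₀))) * (u / √n)) := by
              rw [genConst, ← hc1]; ring
            rw [e]
            have : 0 ≤ 2 * c₁ * s + ((Cf + 1) ^ 2 / 2 + c₁ / √(Real.log (1 / δ₀))) * (u / √n) := by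
              positivity
            linarith
  · rw [← ENNReal.ofReal_tsum_of_nonneg (fun j => (hδs j).le) (summable_geometric_two' _),
      tsum_geometric_two']

/-! ### Layer norms at initialization -/

lemma integral_exp_sq_gaussianReal {v : NNReal} (hv : v ≠ 0) :
    Integrable (fun x => Real.exp (x ^ 2 / (4 * v))) (gaussianReal 0 v) ∧
      ∫ x, Real.exp (x ^ 2 / (4 * v)) ∂(gaussianReal 0 v) = √2 := by
  have hv' : (0 : ℝ) < v := by exact_mod_cast pos_iff_ne_zero.2 hv
  have hpdf : ∀ x : ℝ, gaussianPDFReal 0 v x * Real.exp (x ^ 2 / (4 * v)) =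
      (√(2 * Real.pi * v))⁻¹ * Real.exp (-(1 / (4 * v)) * x ^ 2) := fun x => by
    rw [gaussianPDFReal, mul_assoc, ← Real.exp_add]
    congr 2
    field_simp
    ring
  have hint := integrable_exp_neg_mul_sq (b := 1 / (4 * (v : ℝ))) (by positivity)
  constructor
  · rw [gaussianReal_of_var_ne_zero _ hv, integrable_withDensity_iff
      (measurable_gaussianPDF 0 v) (Filter.Eventually.of_forall fun x => gaussianPDF_lt_top)]
    simp only [toReal_gaussianPDF, mul_comm (Real.exp _), hpdf]
    exact hint.const_mul _
  · rw [integral_gaussianReal_eq_integral_smul hv]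
    simp only [smul_eq_mul, hpdf]
    rw [integral_const_mul, integral_gaussian, inv_mul_eq_div, ← Real.sqrt_div' _ (by positivity)]
    congr 1
    field_simp
    norm_num

instance (κ : ℝ) : IsProbabilityMeasure (initLaw N κ) := by
  unfold initLaw; infer_instance

/-- Chernoff's bound for the squared norm of one layer, which is a multiple of a `χ²` variable. -/
lemma initLaw_layerSq_le {κ δ : ℝ} (hκ : 0 < κ) (hδ : 0 < δ) (hδ1 : δ < 1) (l : Fin (N.L + 1)) :
    (initLaw N κ).real {Θ | 8 * κ ^ 2 * (1 + Real.log ((N.L + 1) / δ) / N.q l) ≤ layerSq Θ l} ≤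
      δ / (2 * (N.L + 1)) := by
  classical
  have hq : 0 < N.q l := Arch.q_pos (Nat.lt_succ_iff.1 l.2)
  have hq' : (0 : ℝ) < N.q l := by exact_mod_cast hq
  set v : ParamIdx N → NNReal := fun i => Real.toNNReal (κ ^ 2 / N.q i.1)
  have hvl : ∀ j : Fin (N.q l), v ⟨l, j⟩ ≠ 0 := fun j => by
    simp only [v, ne_eq, Real.toNNReal_eq_zero, not_le]; positivity
  set t : ℝ := N.q l / (4 * κ ^ 2) with ht
  let f : ParamIdx N → ℝ → ℝ := fun i x => if i.1 = l then Real.exp (t * x ^ 2) else 1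
  have hf : ∀ i, i.1 = l → f i = fun x => Real.exp (x ^ 2 / (4 * v i)) := by
    rintro ⟨l', j⟩ (rfl : l' = l)
    funext x
    simp only [f, if_true]
    congr 1
    rw [Real.coe_toNNReal _ (by positivity), ht]
    field_simp
  have hfi : ∀ i, Integrable (f i) (gaussianReal 0 (v i)) := fun i => by
    by_cases h : i.1 = l
    · rw [hf i h]
      obtain ⟨l', j⟩ := i
      obtain rfl : l' = l := h
      exact (integral_exp_sq_gaussianReal (hvl j)).1
    · simp only [f, if_neg h]; exact integrable_const _
  have hfe : ∀ i, ∫ x, f i x ∂(gaussianReal 0 (v i)) = if i.1 = l then √2 else 1 := fun i => by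
    by_cases h : i.1 = l
    · rw [hf i h, if_pos h]
      obtain ⟨l', j⟩ := i
      obtain rfl : l' = l := h
      exact (integral_exp_sq_gaussianReal (hvl j)).2
    · simp [f, if_neg h]
  have hprod : ∀ Θ : Params N, Real.exp (t * layerSq Θ l) = ∏ i, f i (Θ i) := fun Θ => by
    rw [layerSq_fin, Finset.mul_sum, Real.exp_sum, Fintype.prod_sigma]
    rw [Finset.prod_eq_single l]
    · simp [f]
    · intro l' _ h; simp [f, h]
    · simp
  have hint : Integrable (fun Θ => Real.exp (t * layerSq Θ l)) (initLaw N κ) := by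
    simp only [hprod]
    exact Integrable.fintype_prod (f := f) hfi
  have hmgf : mgf (fun Θ => layerSq Θ l) (initLaw N κ) t = √2 ^ N.q l := by
    rw [mgf]
    simp only [hprod]
    rw [initLaw, integral_fintype_prod_eq_prod]
    rw [Finset.prod_congr rfl fun i _ => hfe i, Fintype.prod_sigma, Finset.prod_eq_single l]
    · simp
    · intro l' _ h; simp [h]
    · simp
  have hmain := measure_ge_le_exp_mul_mgf
    (8 * κ ^ 2 * (1 + Real.log ((N.L + 1) / δ) / N.q l)) (by positivity : 0 ≤ t) hint
  refine hmain.trans ?_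
  rw [hmgf]
  set Λ := Real.log ((N.L + 1) / δ) with hΛ
  have hLδ : 1 ≤ (N.L + 1) / δ := by
    rw [le_div_iff₀ hδ]
    have : (0 : ℝ) ≤ N.L := Nat.cast_nonneg _
    linarith
  have hΛ0 : 0 ≤ Λ := Real.log_nonneg hLδ
  have h1 : √2 ^ N.q l ≤ Real.exp (N.q l) := by
    rw [← Real.exp_one_pow]
    gcongr
    rw [Real.sqrt_le_iff]
    have := Real.add_one_le_exp (1 : ℝ)
    exact ⟨by positivity, by nlinarith⟩
  have e1 : -t * (8 * κ ^ 2 * (1 + Λ / N.q l)) = -(2 * N.q l + 2 * Λ) := by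
    rw [ht]; field_simp; ring
  have hq1 : (1 : ℝ) ≤ N.q l := by exact_mod_cast hq
  calc Real.exp (-t * (8 * κ ^ 2 * (1 + Λ / N.q l))) * √2 ^ N.q l
      ≤ Real.exp (-(2 * N.q l + 2 * Λ)) * Real.exp (N.q l) := by
        rw [e1]; gcongr
    _ ≤ Real.exp (-1 + -Λ) := by
        rw [← Real.exp_add]
        exact Real.exp_le_exp.2 (by linarith)
    _ = Real.exp (-1) * (δ / (N.L + 1)) := by
        rw [Real.exp_add, hΛ, Real.exp_neg (Real.log _), Real.exp_log (by linarith), inv_div]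
    _ ≤ 1 / 2 * (δ / (N.L + 1)) := by
        gcongr
        rw [Real.exp_neg, one_div]
        have := Real.add_one_le_exp (1 : ℝ)
        exact inv_anti₀ (by norm_num) (by linarith)
    _ = δ / (2 * (N.L + 1)) := by rw [one_div, inv_mul_eq_div, div_div, mul_comm 2]

lemma initLaw_exists_layerSq_le {κ δ : ℝ} (hκ : 0 < κ) (hδ : 0 < δ) (hδ1 : δ < 1) :
    initLaw N κ {Θ | ∃ l : Fin (N.L + 1), 8 * initScale N κ δ < layerSq Θ l} ≤
      ENNReal.ofReal (δ / 2) := by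
  have hsub : {Θ : Params N | ∃ l : Fin (N.L + 1), 8 * initScale N κ δ < layerSq Θ l} ⊆
      ⋃ l : Fin (N.L + 1),
        {Θ | 8 * κ ^ 2 * (1 + Real.log ((N.L + 1) / δ) / N.q l) ≤ layerSq Θ l} := by
    rintro Θ ⟨l, hl⟩
    refine Set.mem_iUnion.2 ⟨l, le_trans ?_ hl.le⟩
    rw [initScale, ← mul_assoc]
    have := le_iSup_fin (fun l : Fin (N.L + 1) => Real.log ((N.L + 1) / δ) / N.q l) l
    gcongr
  refine (measure_mono hsub).trans ((measure_iUnion_fintype_le _ _).trans ?_)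
  calc _ ≤ ∑ _l : Fin (N.L + 1), ENNReal.ofReal (δ / (2 * (N.L + 1))) := by
        refine Finset.sum_le_sum fun l _ => ?_
        rw [← ofReal_measureReal]
        exact ENNReal.ofReal_le_ofReal (initLaw_layerSq_le hκ hδ hδ1 l)
    _ = ENNReal.ofReal (δ / 2) := by
        rw [Finset.sum_const, Finset.card_univ, Fintype.card_fin, ← ENNReal.ofReal_nsmul]
        congr 1
        rw [nsmul_eq_mul]
        push_cast
        field_simp

lemma sq_le_initScale {κ δ : ℝ} (hδ : 0 < δ) (hδ1 : δ < 1) : κ ^ 2 ≤ initScale N κ δ := by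
  have hLδ : 1 ≤ (N.L + 1) / δ := by
    rw [le_div_iff₀ hδ]
    have : (0 : ℝ) ≤ N.L := Nat.cast_nonneg _
    linarith
  have : 0 ≤ ⨆ l : Fin (N.L + 1), Real.log ((N.L + 1) / δ) / N.q l :=
    Real.iSup_nonneg fun l => div_nonneg (Real.log_nonneg hLδ) (Nat.cast_nonneg _)
  rw [initScale]
  nlinarith [sq_nonneg κ]

lemma initScale_le {κ δ : ℝ} (hδ : 0 < δ) (hδ1 : δ < 1) :
    initScale N κ δ ≤ κ ^ 2 * (1 + Real.log ((N.L + 1) / δ)) := by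
  have hLδ : 1 ≤ (N.L + 1) / δ := by
    rw [le_div_iff₀ hδ]
    have : (0 : ℝ) ≤ N.L := Nat.cast_nonneg _
    linarith
  rw [initScale]
  gcongr
  refine ciSup_le fun l => div_le_self (Real.log_nonneg hLδ) ?_
  exact_mod_cast Arch.q_pos (Nat.lt_succ_iff.1 l.2)

/-! ### Sums of learning rates -/

lemma sum_rpow_sub_one_le {β : ℝ} (h0 : 0 < β) (h1 : β ≤ 1) (t : ℕ) :
    ∑ s ∈ Finset.range t, ((s : ℝ) + 1) ^ (β - 1) ≤ (t : ℝ) ^ β / β := by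
  induction t with
  | zero => simp [Real.zero_rpow h0.ne']
  | succ t ih =>
    rw [Finset.sum_range_succ]
    refine (add_le_add ih le_rfl).trans ?_
    push_cast
    have ht : (0 : ℝ) < (t : ℝ) + 1 := by positivity
    have hb := rpow_one_add_le_one_add_mul_self (s := -(1 / ((t : ℝ) + 1))) (p := β)
      (by
        have : 1 / ((t : ℝ) + 1) ≤ 1 := by rw [div_le_one ht]; linarith [Nat.cast_nonneg (α := ℝ) t]
        linarith) h0.le h1
    have e : 1 + -(1 / ((t : ℝ) + 1)) = t / (t + 1) := by field_simp; ring
    rw [e, Real.div_rpow (Nat.cast_nonneg _) ht.le, div_le_iff₀ (Real.rpow_pos_of_pos ht β)] at hb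
    have e2 : ((t : ℝ) + 1) ^ (β - 1) = (t + 1) ^ β * (1 / (t + 1)) := by
      rw [Real.rpow_sub_one ht.ne']; ring
    rw [e2, le_div_iff₀ h0, add_mul, div_mul_cancel₀ _ h0.ne']
    linarith

lemma sum_rpow_neg_le {ε : ℝ} (h0 : 0 < ε) (h1 : ε ≤ 1) (t : ℕ) :
    ∑ s ∈ Finset.range t, ((s : ℝ) + 1) ^ (-(1 + ε)) ≤ 2 / ε := by
  have key : ∀ t : ℕ, ∑ s ∈ Finset.range (t + 1), ((s : ℝ) + 1) ^ (-(1 + ε)) ≤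
      1 + 1 / ε - ((t : ℝ) + 1) ^ (-ε) / ε := by
    intro t
    induction t with
    | zero => simp
    | succ t ih =>
      rw [Finset.sum_range_succ]
      refine (add_le_add ih le_rfl).trans ?_
      push_cast
      have ht : (0 : ℝ) < (t : ℝ) + 1 := by positivity
      have ht2 : (0 : ℝ) < (t : ℝ) + 1 + 1 := by positivity
      set u : ℝ := 1 / ((t : ℝ) + 1 + 1) with hu
      have hu0 : 0 < u := by positivity
      have hu1 : u ≤ 1 := by rw [hu, div_le_one ht2]; linarith
      have hb := rpow_one_add_le_one_add_mul_self (s := -u) (p := ε) (by linarith) h0.le h1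
      have e : 1 + -u = (t + 1) / (t + 1 + 1) := by rw [hu]; field_simp; ring
      rw [e, Real.div_rpow ht.le ht2.le] at hb
      set X := ((t : ℝ) + 1) ^ ε
      set Y := ((t : ℝ) + 1 + 1) ^ ε
      have hX : 0 < X := Real.rpow_pos_of_pos ht ε
      have hY : 0 < Y := Real.rpow_pos_of_pos ht2 ε
      rw [show -(1 + ε) = -ε - 1 by ring, Real.rpow_sub_one ht2.ne', Real.rpow_neg ht.le,
        Real.rpow_neg ht2.le]
      have h2 : Y⁻¹ * (1 + ε * u) ≤ X⁻¹ := by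
        rw [inv_mul_le_iff₀ hY, ← div_eq_mul_inv, le_div_iff₀ hX]
        have h3 : X ≤ Y * (1 + ε * -u) := by rwa [div_le_iff₀' hY] at hb
        nlinarith [mul_pos h0 hu0, mul_pos hX hY, mul_pos (mul_pos h0 hu0) (mul_pos h0 hu0)]
      have e3 : Y⁻¹ / ((t : ℝ) + 1 + 1) = Y⁻¹ * (ε * u) / ε := by
        rw [hu]; field_simp
      rw [e3]
      have h4 : (Y⁻¹ * (1 + ε * u)) / ε ≤ X⁻¹ / ε := by gcongr
      rw [mul_add, mul_one, add_div] at h4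
      linarith
  have hε : 1 ≤ 1 / ε := by rw [le_div_iff₀ h0]; linarith
  rcases t with _ | t
  · simp; positivity
  · refine (key t).trans ?_
    have : 0 ≤ ((t : ℝ) + 1) ^ (-ε) / ε := by positivity
    have e : 2 / ε = 1 / ε + 1 / ε := by ring
    linarith

/-- The number of the block of length `T₀` that contains step `t`. -/
def blockNum (T₀ t : ℕ) : ℝ := (⌈((t : ℝ) + 1) / T₀⌉₊ : ℝ)

lemma le_blockNum (T₀ t : ℕ) : ((t : ℝ) + 1) / T₀ ≤ blockNum T₀ t := Nat.le_ceil _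

lemma one_le_blockNum {T₀ : ℕ} (h : 1 ≤ T₀) (t : ℕ) : 1 ≤ blockNum T₀ t := by
  unfold blockNum
  exact Nat.one_le_cast.2 (Nat.ceil_pos.2 (by positivity))

lemma learningRate_eq (η α : ℝ) (T₀ t : ℕ) :
    learningRate η α T₀ t = η / blockNum T₀ t ^ α := rfl

lemma sum_learningRate_le {η α β : ℝ} {T₀ : ℕ} (hη : 0 ≤ η) (hT : 1 ≤ T₀) (h0 : 0 < β)
    (h1 : β ≤ 1) (hα : 1 - α ≤ β) (t : ℕ) :
    ∑ s ∈ Finset.range t, learningRate η α T₀ s ≤ η * T₀ * blockNum T₀ t ^ β / β := by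
  have hT' : (0 : ℝ) < T₀ := by exact_mod_cast hT
  have hpt : ∀ s : ℕ, learningRate η α T₀ s ≤
      η * ((T₀ : ℝ) ^ (1 - β) * ((s : ℝ) + 1) ^ (β - 1)) := fun s => by
    rw [learningRate_eq, div_eq_mul_inv]
    refine mul_le_mul_of_nonneg_left ?_ hη
    have hk := one_le_blockNum hT s
    rw [← Real.rpow_neg (by linarith)]
    have hx : (0 : ℝ) < ((s : ℝ) + 1) / T₀ := by positivity
    calc blockNum T₀ s ^ (-α) ≤ blockNum T₀ s ^ (β - 1) :=
          Real.rpow_le_rpow_of_exponent_le hk (by linarith)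
      _ ≤ (((s : ℝ) + 1) / T₀) ^ (β - 1) :=
          Real.rpow_le_rpow_of_nonpos hx (le_blockNum _ _) (by linarith)
      _ = _ := by
          rw [Real.div_rpow (by positivity) hT'.le, div_eq_mul_inv, ← Real.rpow_neg hT'.le,
            neg_sub, mul_comm]
  refine (Finset.sum_le_sum fun s _ => hpt s).trans ?_
  rw [← Finset.mul_sum, ← Finset.mul_sum]
  have h2 := sum_rpow_sub_one_le h0 h1 t
  have h3 : (T₀ : ℝ) ^ (1 - β) * (t : ℝ) ^ β ≤ T₀ * blockNum T₀ t ^ β := by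
    have : ((t : ℝ) / T₀) ^ β ≤ blockNum T₀ t ^ β := by
      refine Real.rpow_le_rpow (by positivity) (le_trans ?_ (le_blockNum _ _)) h0.le
      gcongr; linarith
    rw [Real.div_rpow (Nat.cast_nonneg _) hT'.le, div_le_iff₀ (Real.rpow_pos_of_pos hT' _)] at this
    rw [Real.rpow_sub hT', Real.rpow_one, div_mul_eq_mul_div,
      div_le_iff₀ (Real.rpow_pos_of_pos hT' _), mul_assoc]
    gcongr
  calc _ ≤ η * ((T₀ : ℝ) ^ (1 - β) * ((t : ℝ) ^ β / β)) := by gcongr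
    _ = η * ((T₀ : ℝ) ^ (1 - β) * (t : ℝ) ^ β) / β := by ring
    _ ≤ η * (T₀ * blockNum T₀ t ^ β) / β := by gcongr
    _ = _ := by ring

lemma sum_blockNum_rpow_neg_le {ε : ℝ} {T₀ : ℕ} (hT : 1 ≤ T₀) (h0 : 0 < ε) (h1 : ε ≤ 1) (t : ℕ) :
    ∑ s ∈ Finset.range t, blockNum T₀ s ^ (-(1 + ε)) ≤ (T₀ : ℝ) ^ (1 + ε) * (2 / ε) := by
  have hT' : (0 : ℝ) < T₀ := by exact_mod_cast hT
  refine (Finset.sum_le_sum fun s _ => ?_).trans ((Finset.mul_sum _ _ _).symm.le.trans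
    (mul_le_mul_of_nonneg_left (sum_rpow_neg_le h0 h1 t) (by positivity)))
  have hx : (0 : ℝ) < ((s : ℝ) + 1) / T₀ := by positivity
  refine (Real.rpow_le_rpow_of_nonpos hx (le_blockNum _ _) (by linarith)).trans (le_of_eq ?_)
  rw [Real.div_rpow (by positivity) hT'.le, Real.rpow_neg hT'.le, div_inv_eq_mul, mul_comm]

/-! ### Growth of the layer norms along stochastic gradient descent -/

/-- Twice the inner product of the parameters of a layer with the negative gradient of the loss; by
Euler's identity it is the same for all layers. -/
def descent (p : ℝ) (Θ : Params N) (z : Data N) : ℝ := -2 * ((net p Θ z.1 - z.2) * net p Θ z.1)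

/-- The first order increment of the squared layer norms in step `t`. -/
def descentStep (p : ℝ) (rate : ℕ → ℝ) {n B T : ℕ} (S : Fin n → Data N) (Θ₀ : Params N)
    (γ : Batches n B T) (t : ℕ) : ℝ :=
  if h : t < T then
    rate t / B * ∑ b : Fin B, descent p (sgd p rate S Θ₀ γ t) (S (γ ⟨t, h⟩ b))
  else 0

lemma sum_param_mul_lossGrad (p : ℝ) (Θ : Params N) (z : Data N) (l : Fin (N.L + 1)) :
    ∑ j : Fin (N.q l), Θ ⟨l, j⟩ * lossGrad p Θ z ⟨l, j⟩ = (net p Θ z.1 - z.2) * net p Θ z.1 := by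
  calc _ = (net p Θ z.1 - z.2) * ∑ j : Fin (N.q l), Θ ⟨l, j⟩ * netGrad p Θ z.1 ⟨l, j⟩ := by
        rw [Finset.mul_sum]
        exact Finset.sum_congr rfl fun j _ => by rw [lossGrad]; ring
    _ = _ := by rw [sum_param_mul_netGrad]

lemma layerSq_sgd_succ_le (p : ℝ) (rate : ℕ → ℝ) {n B T : ℕ} (hB : 1 ≤ B) (S : Fin n → Data N)
    (Θ₀ : Params N) (γ : Batches n B T) {t : ℕ} (ht : t < T) (l : Fin (N.L + 1)) {D : ℝ}
    (hD : ∀ i, ∑ j : Fin (N.q l), lossGrad p (sgd p rate S Θ₀ γ t) (S i) ⟨l, j⟩ ^ 2 ≤ D) :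
    layerSq (sgd p rate S Θ₀ γ (t + 1)) l ≤
      layerSq (sgd p rate S Θ₀ γ t) l + descentStep p rate S Θ₀ γ t + rate t ^ 2 * D := by
  have hB' : (0 : ℝ) < B := by exact_mod_cast hB
  set Θ := sgd p rate S Θ₀ γ t with hΘ
  set c := rate t / B with hc
  have hstep : ∀ i, sgd p rate S Θ₀ γ (t + 1) i =
      Θ i - c * ∑ b : Fin B, lossGrad p Θ (S (γ ⟨t, ht⟩ b)) i := fun i => by
    simp only [sgd]
    rw [dif_pos ht]
  set g : Fin B → Fin (N.q l) → ℝ := fun b j => lossGrad p Θ (S (γ ⟨t, ht⟩ b)) ⟨l, j⟩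
  have e1 : layerSq (sgd p rate S Θ₀ γ (t + 1)) l = layerSq Θ l -
      2 * c * ∑ b, ∑ j, Θ ⟨l, j⟩ * g b j + c ^ 2 * ∑ j, (∑ b, g b j) ^ 2 := by
    rw [layerSq_fin, layerSq_fin, Finset.sum_comm, Finset.mul_sum, Finset.mul_sum,
      ← Finset.sum_sub_distrib, ← Finset.sum_add_distrib]
    refine Finset.sum_congr rfl fun j _ => ?_
    rw [hstep, ← Finset.mul_sum]
    ring
  have e2 : descentStep p rate S Θ₀ γ t = - (2 * c * ∑ b, ∑ j, Θ ⟨l, j⟩ * g b j) := by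
    rw [descentStep, dif_pos ht, ← hc, ← hΘ]
    simp only [g, sum_param_mul_lossGrad, descent, ← Finset.mul_sum]
    ring
  have e3 : ∑ j, (∑ b, g b j) ^ 2 ≤ B * (B * D) := by
    calc ∑ j, (∑ b, g b j) ^ 2 ≤ ∑ j, (B : ℝ) * ∑ b, g b j ^ 2 := by
          refine Finset.sum_le_sum fun j _ => ?_
          have := sq_sum_le_card_mul_sum_sq (s := (Finset.univ : Finset (Fin B)))
            (f := fun b => g b j)
          simpa using this
      _ = B * ∑ b, ∑ j, g b j ^ 2 := by rw [← Finset.mul_sum, Finset.sum_comm]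
      _ ≤ B * ∑ _b : Fin B, D := by
          gcongr with b
          exact hD _
      _ = _ := by simp
  have e4 : c ^ 2 * (B * (B * D)) = rate t ^ 2 * D := by rw [hc]; field_simp
  have := mul_le_mul_of_nonneg_left e3 (sq_nonneg c)
  rw [e1, e2]
  linarith

lemma descent_le (p : ℝ) (Θ : Params N) (z : Data N) {Cy : ℝ} (hz : |z.2| ≤ Cy) :
    descent p Θ z ≤ Cy ^ 2 / 2 := by
  have h1 : z.2 ^ 2 ≤ Cy ^ 2 := sq_le_sq' (abs_le.1 hz).1 (abs_le.1 hz).2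
  rw [descent]
  nlinarith [sq_nonneg (2 * net p Θ z.1 - z.2)]

lemma descentStep_le (p : ℝ) {rate : ℕ → ℝ} {n B T : ℕ} {S : Fin n → Data N} {Cy : ℝ}
    (hS : ∀ i, |(S i).2| ≤ Cy) (hrate : ∀ t, 0 ≤ rate t) (hB : 1 ≤ B) (Θ₀ : Params N)
    (γ : Batches n B T) (t : ℕ) : descentStep p rate S Θ₀ γ t ≤ rate t * (Cy ^ 2 / 2) := by
  have hB' : (0 : ℝ) < B := by exact_mod_cast hB
  unfold descentStep
  split_ifs with h
  · calc _ ≤ rate t / B * ∑ _b : Fin B, Cy ^ 2 / 2 := by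
          have := hrate t
          gcongr with b
          exact descent_le p _ _ (hS _)
      _ = _ := by simp; field_simp
  · have := hrate t
    positivity

/-- The factor by which the squared layer norms at initialization exceed `κ²`, with a margin for
their growth. -/
def growthFactor (L : ℕ) (δ : ℝ) : ℝ := 8 * (1 + |Real.log ((L + 1) / δ)|) + 2

/-- The constant `c_η` in the condition on the learning rate. The factor `L + 2` controls the first
order growth of the squared layer norms (`etaConst_mul_le`), the other factors the second order one
(`etaConst_mul_rpow_sq_le`). -/
def etaConst (L : ℕ) (δ : ℝ) : ℝ :=
  1 / ((L + 2) * ((L : ℝ) ^ (((L : ℝ) - 1) / 2) + 1) * (2 ^ (L + 1) * growthFactor L δ ^ L))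

lemma one_le_growthFactor (L : ℕ) (δ : ℝ) : 1 ≤ growthFactor L δ := by
  unfold growthFactor
  linarith [abs_nonneg (Real.log ((L + 1) / δ))]

lemma etaConst_pos (L : ℕ) (δ : ℝ) : 0 < etaConst L δ := by
  have := one_le_growthFactor L δ
  unfold etaConst
  positivity

lemma etaConst_mul_le (L : ℕ) (δ : ℝ) : etaConst L δ * (L + 2) ≤ 1 := by
  have h1 := one_le_growthFactor L δ
  have h2 : 1 ≤ (2 : ℝ) ^ (L + 1) * growthFactor L δ ^ L :=
    one_le_mul_of_one_le_of_one_le (one_le_pow₀ one_le_two) (one_le_pow₀ h1)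
  have h3 : 1 ≤ (L : ℝ) ^ (((L : ℝ) - 1) / 2) + 1 := by
    have : 0 ≤ (L : ℝ) ^ (((L : ℝ) - 1) / 2) := by positivity
    linarith
  have h4 := one_le_mul_of_one_le_of_one_le h3 h2
  rw [etaConst, one_div, inv_mul_le_iff₀ (by positivity), mul_one, mul_assoc]
  exact le_mul_of_one_le_right (by positivity) h4

lemma etaConst_mul_rpow_sq_le (L : ℕ) (δ : ℝ) :
    (etaConst L δ * (L : ℝ) ^ (((L : ℝ) - 1) / 2)) ^ 2 * (2 ^ (L + 1) * growthFactor L δ ^ L) ≤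
      1 := by
  have h1 := one_le_growthFactor L δ
  set Z := (2 : ℝ) ^ (L + 1) * growthFactor L δ ^ L with hZ
  have h2 : 1 ≤ Z := one_le_mul_of_one_le_of_one_le (one_le_pow₀ one_le_two) (one_le_pow₀ h1)
  set X := (L : ℝ) ^ (((L : ℝ) - 1) / 2) with hX
  have hX0 : 0 ≤ X := by positivity
  have h3 : etaConst L δ * X ≤ 1 / Z := by
    rw [etaConst, ← hZ, ← hX, div_mul_eq_mul_div, one_mul, div_le_div_iff₀ (by positivity)
      (by positivity), one_mul]
    have : (0 : ℝ) ≤ L := Nat.cast_nonneg _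
    have h5 : X ≤ (L + 2) * (X + 1) := by nlinarith
    exact mul_le_mul_of_nonneg_right h5 (by positivity)
  have h4 : 0 ≤ etaConst L δ * X := mul_nonneg (etaConst_pos L δ).le hX0
  calc (etaConst L δ * X) ^ 2 * Z ≤ (1 / Z) ^ 2 * Z := by gcongr
    _ = 1 / Z := by field_simp
    _ ≤ 1 := (div_le_one (by positivity)).2 h2

/-- Along stochastic gradient descent the squared norms of all layers are bounded by their initial
value plus the first order increments, up to a second order error of at most `κ ^ 2`. The crude
bound `growthFactor * κ ^ 2 * blockNum ^ β` with `β = (1 - ε) / (L + 2)` makes the second order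
terms summable and is in turn reproduced by them. -/
lemma layerSq_sgd_le {p κ Cf Cy δ α ε η : ℝ} {n B T T₀ : ℕ} {S : Fin n → Data N} {Θ₀ : Params N}
    (γ : Batches n B T) {R₀ : ℝ}
    (hL : 1 ≤ N.L) (hB : 1 ≤ B) (hT₀ : 1 ≤ T₀) (hκ : 0 < κ) (hCf : 0 < Cf) (hCy : 0 ≤ Cy)
    (hε : 0 < ε) (hε1 : ε < 1) (hεα : ε ≤ (N.L + 2) * α - (N.L + 1)) (hη : 0 < η)
    (hη1 : η ≤ etaConst N.L δ * ((N.m : ℝ) ^ p * (N.L : ℝ) ^ (((N.L : ℝ) - 1) / 2) * √ε /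
          ((Cf + Cy) * (T₀ : ℝ) ^ ((1 + ε) / 2) * κ ^ (N.L - 1))))
    (hη2 : η * (Cy ^ 2 * T₀) ≤ etaConst N.L δ * (κ ^ 2 * (1 - ε)))
    (hS : ∀ i, ‖(S i).1‖ ≤ 1 ∧ |(S i).2| ≤ Cy)
    (hbd : ∀ t ≤ T, ∀ i, |net p (sgd p (learningRate η α T₀) S Θ₀ γ t) (S i).1| ≤ Cf)
    (hR₀ : R₀ + 2 * κ ^ 2 ≤ growthFactor N.L δ * κ ^ 2) (hinit : ∀ l ≤ N.L, layerSq Θ₀ l ≤ R₀)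
    {t : ℕ} (ht : t ≤ T) {l : ℕ} (hl : l ≤ N.L) :
    layerSq (sgd p (learningRate η α T₀) S Θ₀ γ t) l ≤
      R₀ + ∑ s ∈ Finset.range t, descentStep p (learningRate η α T₀) S Θ₀ γ s + κ ^ 2 := by
  set rate := learningRate η α T₀ with hrate
  set A := growthFactor N.L δ with hA
  have hA1 : 1 ≤ A := one_le_growthFactor _ _
  set k : ℕ → ℝ := blockNum T₀ with hk
  have hk1 : ∀ s, 1 ≤ k s := one_le_blockNum hT₀
  have hk0 : ∀ s, 0 < k s := fun s => one_pos.trans_le (hk1 s)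
  have hL2 : (0 : ℝ) < N.L + 2 := by positivity
  set β : ℝ := (1 - ε) / (N.L + 2) with hβ
  have hβ0 : 0 < β := div_pos (by linarith) hL2
  have hβ1 : β ≤ 1 := by
    rw [hβ, div_le_one hL2]
    have : (0 : ℝ) ≤ N.L := Nat.cast_nonneg _
    linarith
  have hβα : 1 - α ≤ β := by rw [hβ, le_div_iff₀ hL2]; linarith
  have hm : (0 : ℝ) < N.m := by exact_mod_cast N.m_pos
  have hmp : 0 < (N.m : ℝ) ^ p := Real.rpow_pos_of_pos hm p
  have hT' : (0 : ℝ) < T₀ := by exact_mod_cast hT₀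
  have hrate0 : ∀ s, 0 ≤ rate s := fun s => by
    rw [hrate, learningRate_eq]
    have := hk0 s
    positivity
  have hkβ : ∀ s, 1 ≤ k s ^ β := fun s => Real.one_le_rpow (hk1 s) hβ0.le
  -- the bound for the squared gradients
  set D : ℝ := (Cf + Cy) ^ 2 * ((1 / (N.m : ℝ) ^ p) ^ 2 * 2 ^ N.L) with hD
  set e : ℕ → ℝ := fun s => rate s ^ 2 * (D * (A * κ ^ 2 * k s ^ β) ^ N.L) with he
  have he_le : ∀ s, e s ≤ η ^ 2 * (D * (A * κ ^ 2) ^ N.L) * k s ^ (-(1 + ε)) := fun s => by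
    have h1 : rate s ^ 2 * (k s ^ β) ^ N.L ≤ η ^ 2 * k s ^ (-(1 + ε)) := by
      rw [hrate, learningRate_eq, div_pow, div_mul_eq_mul_div, mul_div_assoc]
      gcongr
      rw [← Real.rpow_natCast (k s ^ β), ← Real.rpow_mul (hk0 s).le, ← Real.rpow_natCast _ 2,
        ← Real.rpow_mul (hk0 s).le, ← Real.rpow_sub (hk0 s)]
      refine Real.rpow_le_rpow_of_exponent_le (hk1 s) ?_
      have h2 : β * (N.L + 2) = 1 - ε := by rw [hβ]; field_simp
      push_cast
      linarith
    have h2 : 0 ≤ D * (A * κ ^ 2) ^ N.L := by positivity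
    have h3 := mul_le_mul_of_nonneg_left h1 h2
    calc e s = D * (A * κ ^ 2) ^ N.L * (rate s ^ 2 * (k s ^ β) ^ N.L) := by
          simp only [he, mul_pow]; ring
      _ ≤ _ := h3
      _ = _ := by ring
  have hsum_e : ∀ t, ∑ s ∈ Finset.range t, e s ≤ κ ^ 2 := fun t => by
    refine (Finset.sum_le_sum fun s _ => he_le s).trans ?_
    rw [← Finset.mul_sum]
    have h1 := sum_blockNum_rpow_neg_le hT₀ hε hε1.le t
    have h2 : 0 ≤ η ^ 2 * (D * (A * κ ^ 2) ^ N.L) := by positivity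
    refine (mul_le_mul_of_nonneg_left h1 h2).trans ?_
    set X := (N.L : ℝ) ^ (((N.L : ℝ) - 1) / 2) with hX
    set P := (T₀ : ℝ) ^ ((1 + ε) / 2) with hP
    have hP0 : 0 < P := Real.rpow_pos_of_pos hT' _
    have hP2 : (T₀ : ℝ) ^ (1 + ε) = P ^ 2 := by
      rw [hP, ← Real.rpow_natCast, ← Real.rpow_mul hT'.le]; congr 1; push_cast; ring
    have hCC : 0 < Cf + Cy := by linarith
    have hsε : 0 < √ε := Real.sqrt_pos.2 hε
    have hsε2 : √ε ^ 2 = ε := Real.sq_sqrt hε.le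
    obtain ⟨L', hL'⟩ : ∃ L', N.L = L' + 1 := ⟨N.L - 1, by omega⟩
    set Y := (Cf + Cy) * P * κ ^ (N.L - 1) / ((N.m : ℝ) ^ p * √ε) with hY
    have hY0 : 0 < Y := by positivity
    have hηY : η * Y ≤ etaConst N.L δ * X := by
      rw [← le_div_iff₀ hY0]
      refine hη1.trans (le_of_eq ?_)
      rw [hY]; field_simp
    have h3 : (η * Y) ^ 2 ≤ (etaConst N.L δ * X) ^ 2 := by gcongr
    have h4 := etaConst_mul_rpow_sq_le N.L δ
    rw [← hX, ← hA] at h4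
    have h5 : η ^ 2 * (D * (A * κ ^ 2) ^ N.L) * ((T₀ : ℝ) ^ (1 + ε) * (2 / ε)) =
        (η * Y) ^ 2 * (2 ^ (N.L + 1) * A ^ N.L) * κ ^ 2 := by
      have hε2 : 2 / ε = 2 / √ε ^ 2 := by rw [hsε2]
      have hκ2 : (κ ^ 2) ^ N.L = (κ ^ (N.L - 1)) ^ 2 * κ ^ 2 := by
        rw [hL', Nat.add_sub_cancel]; ring
      rw [hP2, hD, hY, mul_pow A, hκ2, pow_succ 2 N.L, hε2]
      field_simp
    rw [h5]
    have h6 : (η * Y) ^ 2 * (2 ^ (N.L + 1) * A ^ N.L) ≤ 1 :=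
      (mul_le_mul_of_nonneg_right h3 (by positivity)).trans h4
    calc _ ≤ 1 * κ ^ 2 := by gcongr
      _ = κ ^ 2 := one_mul _
  have hsum_rate : ∀ t, (∑ s ∈ Finset.range t, rate s) * (Cy ^ 2 / 2) ≤
      κ ^ 2 * k t ^ β := fun t => by
    have h1 := sum_learningRate_le hη.le hT₀ hβ0 hβ1 hβα t
    have h2 := etaConst_mul_le N.L δ
    refine (mul_le_mul_of_nonneg_right h1 (by positivity)).trans ?_
    have h3 : η * T₀ * k t ^ β / β * (Cy ^ 2 / 2) =
        (η * (Cy ^ 2 * T₀)) * (k t ^ β * (N.L + 2) / (2 * (1 - ε))) := by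
      have : 1 - ε ≠ 0 := by linarith
      rw [hβ]; field_simp
    rw [h3]
    have h4 : 0 ≤ k t ^ β * (N.L + 2) / (2 * (1 - ε)) :=
      div_nonneg (mul_nonneg (by linarith [hkβ t]) hL2.le) (by linarith)
    refine (mul_le_mul_of_nonneg_right hη2 h4).trans ?_
    have h5 : etaConst N.L δ * (κ ^ 2 * (1 - ε)) * (k t ^ β * (N.L + 2) / (2 * (1 - ε))) =
        (etaConst N.L δ * (N.L + 2)) * (κ ^ 2 * k t ^ β) / 2 := by
      have : 1 - ε ≠ 0 := by linarith
      field_simp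
    rw [h5]
    have h6 : 0 ≤ κ ^ 2 * k t ^ β := mul_nonneg (sq_nonneg _) (by linarith [hkβ t])
    nlinarith
  have main : ∀ t ≤ T, ∀ l ≤ N.L, layerSq (sgd p rate S Θ₀ γ t) l ≤
      R₀ + ∑ s ∈ Finset.range t, descentStep p rate S Θ₀ γ s + ∑ s ∈ Finset.range t, e s := by
    intro t
    induction t with
    | zero => intro _ l hl; simpa [sgd] using hinit l hl
    | succ t ih =>
      intro ht l hl
      have ih := ih (by omega)
      have hcrude : ∀ l' ≤ N.L, layerSq (sgd p rate S Θ₀ γ t) l' ≤ A * κ ^ 2 * k t ^ β := by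
        intro l' hl'
        have h1 := ih l' hl'
        have h2 : ∑ s ∈ Finset.range t, descentStep p rate S Θ₀ γ s ≤
            (∑ s ∈ Finset.range t, rate s) * (Cy ^ 2 / 2) := by
          rw [Finset.sum_mul]
          exact Finset.sum_le_sum fun s _ =>
            descentStep_le p (fun i => (hS i).2) hrate0 hB Θ₀ γ s
        have h3 := hsum_rate t
        have h4 := hsum_e t
        have h5 := hkβ t
        have hR : R₀ + 2 * κ ^ 2 ≤ A * κ ^ 2 := hR₀
        have hRn : 0 ≤ A * κ ^ 2 - κ ^ 2 := by nlinarith [sq_nonneg κ]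
        nlinarith
      rw [Finset.sum_range_succ, Finset.sum_range_succ]
      have hgrad : ∀ i, ∑ j : Fin (N.q l), lossGrad p (sgd p rate S Θ₀ γ t) (S i)
          ⟨⟨l, Nat.lt_succ_of_le hl⟩, j⟩ ^ 2 ≤ D * (A * κ ^ 2 * k t ^ β) ^ N.L := fun i => by
        have h1 := sum_netGrad_sq_le p (sgd p rate S Θ₀ γ t) (S i).1 (hS i).1
          ⟨l, Nat.lt_succ_of_le hl⟩ hcrude
        simp only [lossGrad, mul_pow, ← Finset.mul_sum]
        have h2 : (net p (sgd p rate S Θ₀ γ t) (S i).1 - (S i).2) ^ 2 ≤ (Cf + Cy) ^ 2 := by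
          have a1 := abs_le.1 (hbd t (by omega) i)
          have a2 := abs_le.1 (hS i).2
          exact sq_le_sq' (by linarith) (by linarith)
        refine (mul_le_mul h2 h1 (Finset.sum_nonneg fun _ _ => sq_nonneg _)
          (sq_nonneg _)).trans (le_of_eq ?_)
        rw [hD, mul_pow, mul_pow]
        ring
      have h1 := layerSq_sgd_succ_le p rate hB S Θ₀ γ (Nat.lt_of_succ_le ht)
        ⟨l, Nat.lt_succ_of_le hl⟩ hgrad
      have h2 := ih l hl
      simp only at h1
      simp only [he] at h2 ⊢
      linarith
  exact (main t ht l hl).trans (by linarith [hsum_e t])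

/-! ### Averages over the mini-batches -/

/-- The parameters at time `t` depend only on the mini-batches used before time `t`. -/
lemma sgd_congr (p : ℝ) (rate : ℕ → ℝ) {n B T : ℕ} (S : Fin n → Data N) (Θ₀ : Params N)
    {γ γ' : Batches n B T} {t : ℕ} (h : ∀ s : Fin T, (s : ℕ) < t → γ s = γ' s) :
    sgd p rate S Θ₀ γ t = sgd p rate S Θ₀ γ' t := by
  induction t with
  | zero => rfl
  | succ t ih =>
    have ih := ih fun s hs => h s (by omega)
    funext i
    simp only [sgd]
    rw [ih]
    split_ifs with ht
    · rw [h ⟨t, ht⟩ (Nat.lt_succ_self t)]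
    · rfl

lemma isProbabilityMeasure_batchLaw {n : ℕ} (hn : 0 < n) (B T : ℕ) :
    IsProbabilityMeasure (batchLaw n B T) := by
  have : Nonempty (Batches n B T) := ⟨fun _ _ => ⟨0, hn⟩⟩
  exact isProbabilityMeasure_uniformOn Set.finite_univ Set.univ_nonempty

lemma integral_batchLaw {n B T : ℕ} (f : Batches n B T → ℝ) :
    ∫ γ, f γ ∂(batchLaw n B T) = (∑ γ, f γ) / Fintype.card (Batches n B T) := by
  have : IsFiniteMeasure (batchLaw n B T) := by unfold batchLaw; infer_instance
  rw [integral_fintype Integrable.of_finite, Finset.sum_div]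
  refine Finset.sum_congr rfl fun γ _ => ?_
  rw [Measure.real, batchLaw, uniformOn_univ, Measure.count_singleton, ENNReal.toReal_div,
    smul_eq_mul, ENNReal.toReal_one, ENNReal.toReal_natCast]
  ring

/-- A fresh entry of a mini-batch may be replaced by the average over the whole training set. -/
lemma integral_batchLaw_entry {n B T : ℕ} (hn : 0 < n) (t : Fin T) (b : Fin B)
    (φ : Batches n B T → Fin n → ℝ)
    (hφ : ∀ γ γ', (∀ s : Fin T, (s : ℕ) < t → γ s = γ' s) → φ γ = φ γ') :
    ∫ γ, φ γ (γ t b) ∂(batchLaw n B T) = ∫ γ, (∑ i, φ γ i) / n ∂(batchLaw n B T) := by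
  have : NeZero n := ⟨hn.ne'⟩
  classical
  -- adding `c` to the entry `b` of the mini-batch `t` is a bijection
  set e : Fin n → Batches n B T ≃ Batches n B T := fun c =>
    Equiv.piCongrRight fun s => Equiv.piCongrRight fun b' =>
      if s = t ∧ b' = b then Equiv.addRight c else Equiv.refl _
  have he : ∀ c γ, e c γ t b = γ t b + c := fun c γ => by simp [e]
  have he' : ∀ c γ, φ (e c γ) = φ γ := fun c γ => hφ _ _ fun s hs => by
    have : s ≠ t := by rintro rfl; exact lt_irrefl _ hs
    funext b'
    simp [e, this]
  have hn' : (n : ℝ) ≠ 0 := by exact_mod_cast hn.ne'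
  rw [integral_batchLaw, integral_batchLaw, ← Finset.sum_div]
  congr 1
  rw [eq_div_iff hn']
  calc (∑ γ, φ γ (γ t b)) * n = ∑ _c : Fin n, ∑ γ, φ γ (γ t b) := by simp [mul_comm]
    _ = ∑ c : Fin n, ∑ γ, φ γ (γ t b + c) := by
        refine Finset.sum_congr rfl fun c _ => ?_
        rw [← Equiv.sum_comp (e c)]
        exact Finset.sum_congr rfl fun γ _ => by rw [he', he]
    _ = ∑ γ, ∑ i, φ γ i := by
        rw [Finset.sum_comm]
        exact Finset.sum_congr rfl fun γ _ => Equiv.sum_comp (Equiv.addLeft (γ t b)) (φ γ)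

lemma avg_descent_le (p : ℝ) (Θ : Params N) {n : ℕ} (hn : 0 < n) {S : Fin n → Data N} {Cy : ℝ}
    (hCy : 0 ≤ Cy) (hS : ∀ i, |(S i).2| ≤ Cy) :
    (∑ i, descent p Θ (S i)) / n ≤
      2 * √(2 * empRisk p S Θ) * (Cy - √(2 * empRisk p S Θ)) := by
  have hn' : (0 : ℝ) < n := by exact_mod_cast hn
  set r : Fin n → ℝ := fun i => net p Θ (S i).1 - (S i).2
  have hrisk : 2 * empRisk p S Θ = (∑ i, r i ^ 2) / n := by
    simp only [empRisk, loss, ← Finset.sum_div, r]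
    field_simp
  have h0 : 0 ≤ 2 * empRisk p S Θ := by
    rw [hrisk]; exact div_nonneg (Finset.sum_nonneg fun _ _ => sq_nonneg _) hn'.le
  have h1 : ∀ i, descent p Θ (S i) ≤ -2 * r i ^ 2 + 2 * Cy * |r i| := fun i => by
    have h2 : -((S i).2 * r i) ≤ Cy * |r i| :=
      (neg_le_abs _).trans (by rw [abs_mul]; exact mul_le_mul_of_nonneg_right (hS i) (abs_nonneg _))
    have h3 : descent p Θ (S i) = -2 * r i ^ 2 - 2 * ((S i).2 * r i) := by
      simp only [descent, r]; ring
    linarith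
  have h2 : (∑ i, |r i|) / n ≤ √(2 * empRisk p S Θ) := by
    refine Real.le_sqrt_of_sq_le ?_
    rw [hrisk, div_pow, div_le_div_iff₀ (by positivity) hn']
    have := sq_sum_le_card_mul_sum_sq (s := (Finset.univ : Finset (Fin n))) (f := fun i => |r i|)
    simp only [sq_abs, Finset.card_univ, Fintype.card_fin] at this
    nlinarith
  have h3 : √(2 * empRisk p S Θ) * √(2 * empRisk p S Θ) = (∑ i, r i ^ 2) / n := by
    rw [Real.mul_self_sqrt h0, hrisk]
  calc (∑ i, descent p Θ (S i)) / n ≤ (∑ i, (-2 * r i ^ 2 + 2 * Cy * |r i|)) / n := by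
        gcongr with i; exact h1 i
    _ = -2 * ((∑ i, r i ^ 2) / n) + 2 * Cy * ((∑ i, |r i|) / n) := by
        rw [Finset.sum_add_distrib, ← Finset.mul_sum, ← Finset.mul_sum]; ring
    _ ≤ -2 * (√(2 * empRisk p S Θ) * √(2 * empRisk p S Θ)) + 2 * Cy * √(2 * empRisk p S Θ) := by
        rw [h3]; gcongr
    _ = _ := by ring

/-- In expectation the first order increments of the squared layer norms are bounded by the
cumulative loss. -/
lemma integral_sum_descentStep_le (p : ℝ) {rate : ℕ → ℝ} (hrate : ∀ t, 0 ≤ rate t) {n B T : ℕ}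
    (hn : 0 < n) (hB : 0 < B) {S : Fin n → Data N} {Cy : ℝ} (hCy : 0 ≤ Cy)
    (hS : ∀ i, |(S i).2| ≤ Cy) (Θ₀ : Params N) :
    ∫ γ, ∑ t ∈ Finset.range T, descentStep p rate S Θ₀ γ t ∂(batchLaw n B T) ≤
      meanCumLoss p Cy rate B T S Θ₀ := by
  have := isProbabilityMeasure_batchLaw hn B T
  have hB' : (0 : ℝ) < B := by exact_mod_cast hB
  unfold meanCumLoss cumLoss
  rw [integral_finsetSum _ fun _ _ => Integrable.of_finite,
    integral_finsetSum _ fun _ _ => Integrable.of_finite]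
  refine Finset.sum_le_sum fun t ht => ?_
  have ht := Finset.mem_range.1 ht
  have h1 : ∀ b : Fin B, ∫ γ : Batches n B T, descent p (sgd p rate S Θ₀ γ t) (S (γ ⟨t, ht⟩ b))
      ∂(batchLaw n B T) = ∫ γ, (∑ i, descent p (sgd p rate S Θ₀ γ t) (S i)) / n
        ∂(batchLaw n B T) := fun b =>
    integral_batchLaw_entry hn ⟨t, ht⟩ b (fun γ i => descent p (sgd p rate S Θ₀ γ t) (S i))
      fun γ γ' h => by simp only [sgd_congr p rate S Θ₀ h]
  simp only [descentStep, dif_pos ht]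
  rw [integral_const_mul, integral_finsetSum _ fun _ _ => Integrable.of_finite]
  simp only [h1, Finset.sum_const, Finset.card_univ, Fintype.card_fin, nsmul_eq_mul]
  rw [← mul_assoc, div_mul_cancel₀ _ hB'.ne', ← integral_const_mul]
  refine integral_mono Integrable.of_finite Integrable.of_finite fun γ => ?_
  have := mul_le_mul_of_nonneg_left
    (avg_descent_le p (sgd p rate S Θ₀ γ t) hn hCy hS) (hrate t)
  refine this.trans (le_of_eq (by ring))

/-- Markov's inequality, stated so that the bound involves the reciprocal of `1 + ρ`. -/
lemma measure_mul_lt_le {Ω : Type*} [MeasurableSpace Ω] {P : Measure Ω} [IsProbabilityMeasure P]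
    {W : Ω → ℝ} (hW : Integrable W P) (h0 : ∀ ω, 0 ≤ W ω) {a ρ : ℝ} (hρ : 0 < ρ)
    (ha : 0 < a) (h : ∫ ω, W ω ∂P ≤ a) :
    P {ω | (1 + ρ) * a < W ω} ≤ ENNReal.ofReal (1 / (1 + ρ)) := by
  rw [← ofReal_measureReal]
  refine ENNReal.ofReal_le_ofReal ?_
  have h1 := mul_meas_ge_le_integral_of_nonneg (Filter.Eventually.of_forall h0) hW ((1 + ρ) * a)
  have h2 : P.real {ω | (1 + ρ) * a < W ω} ≤ P.real {ω | (1 + ρ) * a ≤ W ω} :=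
    measureReal_mono fun ω (hω : (1 + ρ) * a < W ω) => hω.le
  have h3 : (1 + ρ) * a * P.real {ω | (1 + ρ) * a < W ω} ≤ a :=
    (mul_le_mul_of_nonneg_left h2 (by positivity)).trans (h1.trans h)
  rw [le_div_iff₀ (by positivity)]
  have h4 : a * (P.real {ω | (1 + ρ) * a < W ω} * (1 + ρ)) ≤ a * 1 := by linarith
  exact le_of_mul_le_mul_left h4 ha

/-! ### Measurability of the iterates -/

lemma measurable_coef {Ω : Type*} [MeasurableSpace Ω] {Θ : Ω → Params N} (hΘ : Measurable Θ)
    (l j : ℕ) : Measurable fun ω => coef (Θ ω) l j :=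
  (continuous_coef l j).measurable.comp hΘ

lemma measurable_preact {Ω : Type*} [MeasurableSpace Ω] {Θ : Ω → Params N} (hΘ : Measurable Θ)
    (l : ℕ) {z : Ω → ℕ → ℝ} (hz : ∀ k, Measurable fun ω => z ω k) (k : ℕ) :
    Measurable fun ω => preact (Θ ω) l (z ω) k := by
  unfold preact
  split_ifs
  · exact Finset.measurable_fun_sum _ fun a _ => (measurable_coef hΘ l a).mul (hz _)
  · exact Finset.measurable_fun_sum _ fun a _ => (measurable_coef hΘ l _).mul (hz _)

lemma measurable_relu' : Measurable relu' :=
  Measurable.ite measurableSet_Ioi measurable_const measurable_const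

lemma measurable_poolWeight {Ω : Type*} [MeasurableSpace Ω] (l : ℕ) {y : Ω → ℕ → ℝ}
    (hy : ∀ k, Measurable fun ω => y ω k) (k b : ℕ) :
    Measurable fun ω => poolWeight N l (y ω) k b := by
  unfold poolWeight
  split_ifs
  · refine Measurable.ite ?_ measurable_const measurable_const
    simp only [Set.ofPred_and, Set.ofPred_forall]
    exact (MeasurableSet.iInter fun b' => MeasurableSet.iInter fun _ =>
      measurableSet_le (hy _) (hy _)).inter (MeasurableSet.iInter fun b' =>
        MeasurableSet.iInter fun _ => measurableSet_lt (hy _) (hy _))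
  · exact measurable_const

lemma measurable_frozenHidden {Ω : Type*} [MeasurableSpace Ω] {Θ₀ Θ : Ω → Params N}
    {x : Ω → EuclideanSpace ℝ (Fin N.d)} (hΘ₀ : Measurable Θ₀) (hΘ : Measurable Θ)
    (hx : Measurable x) (l : ℕ) (hl : l ≤ N.L) (k : ℕ) :
    Measurable fun ω => frozenHidden (Θ₀ ω) (Θ ω) (x ω) l k := by
  induction l generalizing k with
  | zero => exact (continuous_input k).measurable.comp hx
  | succ l ih =>
    have hu : ∀ k, Measurable fun ω => preact (Θ₀ ω) l (hidden (Θ₀ ω) (x ω) l) k :=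
      measurable_preact hΘ₀ l fun k =>
        (continuous_hidden l (by omega) k).measurable.comp (hΘ₀.prodMk hx)
    have hv : ∀ k, Measurable fun ω => preact (Θ ω) l (frozenHidden (Θ₀ ω) (Θ ω) (x ω) l) k :=
      measurable_preact hΘ l fun k => ih (by omega) k
    simp only [frozenHidden_succ, frozenStep]
    split_ifs
    · exact Finset.measurable_fun_sum _ fun b _ =>
        (measurable_poolWeight l (fun k => continuous_relu.measurable.comp (hu k)) k b).mul
          ((measurable_relu'.comp (hu _)).mul (hv _))
    · exact (measurable_relu'.comp (hu _)).mul (hv _)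

lemma measurable_netGrad {Ω : Type*} [MeasurableSpace Ω] (p : ℝ) {Θ : Ω → Params N}
    {x : Ω → EuclideanSpace ℝ (Fin N.d)} (hΘ : Measurable Θ) (hx : Measurable x)
    (i : ParamIdx N) : Measurable fun ω => netGrad p (Θ ω) (x ω) i := by
  simp only [netGrad_eq]
  have hmix : Measurable fun ω => mix i.1 (Θ ω) (Pi.single i 1) := by
    refine measurable_pi_lambda _ fun j => ?_
    unfold mix
    split_ifs
    · exact measurable_const
    · exact (measurable_pi_apply j).comp hΘ
  change Measurable fun ω => frozenNet p (Θ ω) (mix i.1 (Θ ω) (Pi.single i 1)) (x ω)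
  unfold frozenNet
  exact (Finset.measurable_fun_sum _ fun k _ => (measurable_coef hmix _ k).mul
    (measurable_frozenHidden hΘ hmix hx _ le_rfl k)).const_mul _

lemma measurable_net {Ω : Type*} [MeasurableSpace Ω] (p : ℝ) {Θ : Ω → Params N}
    {x : Ω → EuclideanSpace ℝ (Fin N.d)} (hΘ : Measurable Θ) (hx : Measurable x) :
    Measurable fun ω => net p (Θ ω) (x ω) := by
  have h : Measurable fun w : Params N × EuclideanSpace ℝ (Fin N.d) => net p w.1 w.2 :=
    (continuous_net p).measurable
  exact h.comp (f := fun ω => (Θ ω, x ω)) (hΘ.prodMk hx)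

lemma measurable_sgd {Ω : Type*} [MeasurableSpace Ω] (p : ℝ) (rate : ℕ → ℝ) {n B T : ℕ}
    {S : Ω → Fin n → Data N} {Θ₀ : Ω → Params N} (hS : Measurable S) (hΘ₀ : Measurable Θ₀)
    (γ : Batches n B T) (t : ℕ) : Measurable fun ω => sgd p rate (S ω) (Θ₀ ω) γ t := by
  have hSi : ∀ i, Measurable fun ω => S ω i := fun i => (measurable_pi_apply i).comp hS
  induction t with
  | zero => exact hΘ₀
  | succ t ih =>
    refine measurable_pi_lambda _ fun i => ?_
    simp only [sgd]
    split_ifs with h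
    · refine ((measurable_pi_apply i).comp ih).sub
        ((Finset.measurable_fun_sum _ fun b _ => ?_).const_mul _)
      exact ((measurable_net p ih (hSi _).fst).sub (hSi _).snd).mul
        (measurable_netGrad p ih (hSi _).fst i)
    · exact (measurable_pi_apply i).comp ih

lemma measurable_descentStep {Ω : Type*} [MeasurableSpace Ω] (p : ℝ) (rate : ℕ → ℝ) {n B T : ℕ}
    {S : Ω → Fin n → Data N} {Θ₀ : Ω → Params N} (hS : Measurable S) (hΘ₀ : Measurable Θ₀)
    (γ : Batches n B T) (t : ℕ) : Measurable fun ω => descentStep p rate (S ω) (Θ₀ ω) γ t := by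
  have hSi : ∀ i, Measurable fun ω => S ω i := fun i => (measurable_pi_apply i).comp hS
  have hΘ := measurable_sgd p rate hS hΘ₀ γ t
  unfold descentStep descent
  split_ifs with h
  · refine (Finset.measurable_fun_sum _ fun b _ => ?_).const_mul _
    exact (((measurable_net p hΘ (hSi _).fst).sub (hSi _).snd).mul
      (measurable_net p hΘ (hSi _).fst)).const_mul _
  · exact measurable_const

lemma measurable_meanCumLoss {Ω : Type*} [MeasurableSpace Ω] (p Cy : ℝ) (rate : ℕ → ℝ)
    {n B T : ℕ} {S : Ω → Fin n → Data N} {Θ₀ : Ω → Params N} (hS : Measurable S)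
    (hΘ₀ : Measurable Θ₀) :
    Measurable fun ω => meanCumLoss p Cy rate B T (S ω) (Θ₀ ω) := by
  have hSi : ∀ i, Measurable fun ω => S ω i := fun i => (measurable_pi_apply i).comp hS
  have hrisk : ∀ (γ : Batches n B T) t,
      Measurable fun ω => √(2 * empRisk p (S ω) (sgd p rate (S ω) (Θ₀ ω) γ t)) := fun γ t => by
    unfold empRisk
    refine Real.continuous_sqrt.measurable.comp (Measurable.const_mul (Measurable.div_const
      (Finset.measurable_fun_sum _ fun i _ => ?_) _) _)
    have h : Measurable fun w : Params N × Data N => loss p w.1 w.2 :=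
      (continuous_loss p).measurable
    exact h.comp (f := fun ω => (sgd p rate (S ω) (Θ₀ ω) γ t, S ω i))
      ((measurable_sgd p rate hS hΘ₀ γ t).prodMk (hSi i))
  simp only [meanCumLoss, integral_batchLaw, cumLoss]
  exact (Finset.measurable_fun_sum _ fun γ _ => Finset.measurable_fun_sum _ fun t _ =>
    ((hrisk γ t).const_mul _).mul (measurable_const.sub (hrisk γ t))).div_const _

/-! ### The joint law of data, initialization and mini-batches -/

/-- An almost sure bound for a network extends to the support of the data distribution, so that it
holds at almost every data point simultaneously for all networks. -/
lemma ae_forall_abs_net_le (p Cf : ℝ) (μ : Measure (Data N)) :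
    ∀ᵐ z ∂μ, ∀ Θ : Params N, (∀ᵐ z' ∂μ, |net p Θ z'.1| ≤ Cf) → |net p Θ z.1| ≤ Cf := by
  have hsupp : ∀ᵐ z ∂μ, z ∈ μ.support := Measure.support_mem_ae
  filter_upwards [hsupp] with z hz Θ h
  by_contra hlt
  have hcont : Continuous fun z' : Data N => |net p Θ z'.1| :=
    ((continuous_net p).comp (continuous_const.prodMk continuous_fst)).abs
  have hopen : IsOpen {z' : Data N | Cf < |net p Θ z'.1|} := isOpen_lt continuous_const hcont
  have hpos := (Measure.mem_support_iff_forall z).1 hz _ (hopen.mem_nhds (not_le.1 hlt))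
  refine hpos.ne' ?_
  rw [ae_iff] at h
  simpa only [not_le] using h

lemma pathNorm_le_rpow {Θ : Params N} {R : ℝ} (h : ∀ l ≤ N.L, layerSq Θ l ≤ R) :
    pathNorm Θ ≤ R ^ (((N.L : ℝ) + 1) / 2) := by
  have hR : 0 ≤ R := (layerSq_nonneg Θ 0).trans (h 0 (Nat.zero_le _))
  calc pathNorm Θ ≤ ∏ _l ∈ Finset.range (N.L + 1), √R :=
        Finset.prod_le_prod (fun _ _ => Real.sqrt_nonneg _) fun l hl =>
          Real.sqrt_le_sqrt (h l (Nat.lt_succ_iff.1 (Finset.mem_range.1 hl)))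
    _ = √R ^ (N.L + 1) := by simp
    _ = R ^ (((N.L : ℝ) + 1) / 2) := by
        rw [Real.sqrt_eq_rpow, ← Real.rpow_natCast, ← Real.rpow_mul hR]
        congr 1
        push_cast
        ring

/-- A function of data, initialization and mini-batches is measurable if it is so for fixed
mini-batches. -/
lemma measurable_of_forall_batches {n B T : ℕ} {β : Type*} [MeasurableSpace β]
    {F : (Fin n → Data N) → Params N → Batches n B T → β}
    (hF : ∀ γ, Measurable fun q : (Fin n → Data N) × Params N => F q.1 q.2 γ) :
    Measurable fun ω : (Fin n → Data N) × Params N × Batches n B T => F ω.1 ω.2.1 ω.2.2 := by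
  have h : Measurable fun q : ((Fin n → Data N) × Params N) × Batches n B T =>
      F q.1.1 q.1.2 q.2 := measurable_from_prod_countable_left hF
  exact h.comp (f := fun ω : (Fin n → Data N) × Params N × Batches n B T => ((ω.1, ω.2.1), ω.2.2))
    ((measurable_fst.prodMk measurable_snd.fst).prodMk measurable_snd.snd)

/-- A measurable event whose conditional probability, given data and initialization, is at most
`c`. -/
lemma trainLaw_le_of_forall {κ : ℝ} {μ : Measure (Data N)} [IsProbabilityMeasure μ] {n B T : ℕ}
    (hn : 0 < n) {A : Set ((Fin n → Data N) × Params N × Batches n B T)} (hA : MeasurableSet A)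
    {c : ENNReal} (h : ∀ S Θ₀, batchLaw n B T {γ | (S, Θ₀, γ) ∈ A} ≤ c) :
    trainLaw κ μ n B T A ≤ c := by
  have := isProbabilityMeasure_batchLaw hn B T
  rw [trainLaw, Measure.prod_apply hA]
  calc _ ≤ ∫⁻ _S, c ∂(Measure.pi fun _ : Fin n => μ) := by
        refine lintegral_mono fun S => ?_
        rw [Measure.prod_apply (measurable_prodMk_left hA)]
        calc _ ≤ ∫⁻ _Θ₀, c ∂(initLaw N κ) := lintegral_mono fun Θ₀ => h S Θ₀
          _ = c := by simp
    _ = c := by simp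

lemma trainLaw_data {κ : ℝ} {μ : Measure (Data N)} [IsProbabilityMeasure μ] {n B T : ℕ}
    (hn : 0 < n) (A : Set (Fin n → Data N)) :
    trainLaw κ μ n B T {ω | ω.1 ∈ A} = (Measure.pi fun _ : Fin n => μ) A := by
  have := isProbabilityMeasure_batchLaw hn B T
  have e : {ω : (Fin n → Data N) × Params N × Batches n B T | ω.1 ∈ A} = A ×ˢ Set.univ := by
    ext ω; simp
  rw [e, trainLaw, Measure.prod_prod, measure_univ, mul_one]

lemma trainLaw_init {κ : ℝ} {μ : Measure (Data N)} [IsProbabilityMeasure μ] {n B T : ℕ}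
    (hn : 0 < n) (A : Set (Params N)) :
    trainLaw κ μ n B T {ω | ω.2.1 ∈ A} = initLaw N κ A := by
  have := isProbabilityMeasure_batchLaw hn B T
  have e : {ω : (Fin n → Data N) × Params N × Batches n B T | ω.2.1 ∈ A} =
      Set.univ ×ˢ (A ×ˢ Set.univ) := by
    ext ω; simp
  rw [e, trainLaw, Measure.prod_prod, Measure.prod_prod, measure_univ, measure_univ, mul_one,
    one_mul]

/-- The event on which the growth of the layer norms is controlled: bounded training data, outputs
on the training data bounded along all runs of stochastic gradient descent, and squared layer norms
at most `R₀` at initialization. Only finitely many conditions are involved,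
each of them measurable in data and initialization. -/
def IsTame (p Cf Cy R₀ : ℝ) (rate : ℕ → ℝ) {n : ℕ} (B T : ℕ) (S : Fin n → Data N)
    (Θ₀ : Params N) : Prop :=
  (∀ i, ‖(S i).1‖ ≤ 1 ∧ |(S i).2| ≤ Cy) ∧
    (∀ γ : Batches n B T, ∀ t ≤ T, ∀ i, |net p (sgd p rate S Θ₀ γ t) (S i).1| ≤ Cf) ∧
    ∀ l ≤ N.L, layerSq Θ₀ l ≤ R₀

lemma measurableSet_isTame (p Cf Cy R₀ : ℝ) (rate : ℕ → ℝ) (n B T : ℕ) :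
    MeasurableSet {q : (Fin n → Data N) × Params N | IsTame p Cf Cy R₀ rate B T q.1 q.2} := by
  have hSi : ∀ i, Measurable fun q : (Fin n → Data N) × Params N => q.1 i := fun i =>
    (measurable_pi_apply i).comp measurable_fst
  unfold IsTame
  simp only [Set.ofPred_and, Set.ofPred_forall]
  refine (MeasurableSet.iInter fun i => ?_).inter ((MeasurableSet.iInter fun γ =>
    MeasurableSet.iInter fun t => MeasurableSet.iInter fun _ =>
      MeasurableSet.iInter fun i => ?_).inter (MeasurableSet.iInter fun l => MeasurableSet.iInter fun _ => ?_))
  · exact (measurableSet_le (hSi i).fst.norm measurable_const).inter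
      (measurableSet_le (continuous_abs.measurable.comp (hSi i).snd) measurable_const)
  · exact measurableSet_le (continuous_abs.measurable.comp
      (measurable_net p (measurable_sgd p rate measurable_fst measurable_snd γ t) (hSi i).fst))
      measurable_const
  · unfold layerSq
    exact measurableSet_le (Finset.measurable_fun_sum _ fun j _ =>
      (measurable_coef measurable_snd l j).pow_const 2) measurable_const

/-! ### Generalization of stochastic gradient descent -/

/-- Markov's inequality, conditionally on data and initialization, for the bound of the squared
layer norms at the end of the training. -/
lemma trainLaw_isTame_growth_le {p κ Cf Cy R₀ ρ : ℝ} {rate : ℕ → ℝ} {n B T : ℕ}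
    {μ : Measure (Data N)} [IsProbabilityMeasure μ] (hn : 0 < n) (hB : 0 < B) (hκ : 0 < κ)
    (hCy : 0 ≤ Cy) (hρ : 0 < ρ) (hrate : ∀ t, 0 ≤ rate t)
    (hgrow : ∀ (S : Fin n → Data N) (Θ₀ : Params N), IsTame p Cf Cy R₀ rate B T S Θ₀ →
      ∀ γ : Batches n B T, ∀ l ≤ N.L, layerSq (sgd p rate S Θ₀ γ T) l ≤
        R₀ + ∑ s ∈ Finset.range T, descentStep p rate S Θ₀ γ s + κ ^ 2) :
    trainLaw κ μ n B T {ω | IsTame p Cf Cy R₀ rate B T ω.1 ω.2.1 ∧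
        (1 + ρ) * (R₀ + 2 * κ ^ 2 + meanCumLoss p Cy rate B T ω.1 ω.2.1) <
          R₀ + ∑ s ∈ Finset.range T, descentStep p rate ω.1 ω.2.1 ω.2.2 s + κ ^ 2} ≤
      ENNReal.ofReal (1 / (1 + ρ)) := by
  have := isProbabilityMeasure_batchLaw hn B T
  refine trainLaw_le_of_forall hn ?_ fun S Θ₀ => ?_
  · have h1 : Measurable fun ω : (Fin n → Data N) × Params N × Batches n B T => (ω.1, ω.2.1) :=
      measurable_fst.prodMk measurable_snd.fst
    have h2 : Measurable fun ω : (Fin n → Data N) × Params N × Batches n B T =>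
        ∑ s ∈ Finset.range T, descentStep p rate ω.1 ω.2.1 ω.2.2 s :=
      Finset.measurable_fun_sum _ fun s _ =>
        measurable_of_forall_batches (F := fun S Θ₀ γ => descentStep p rate S Θ₀ γ s) fun γ =>
          measurable_descentStep p rate measurable_fst measurable_snd γ s
    have h3 : Measurable fun ω : (Fin n → Data N) × Params N × Batches n B T =>
        meanCumLoss p Cy rate B T ω.1 ω.2.1 :=
      measurable_meanCumLoss p Cy rate measurable_fst measurable_snd.fst
    exact ((measurableSet_isTame p Cf Cy R₀ rate n B T).preimage h1).inter
      (measurableSet_lt ((h3.const_add _).const_mul _) ((h2.const_add _).add_const _))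
  · by_cases ht : IsTame p Cf Cy R₀ rate B T S Θ₀
    · set W : Batches n B T → ℝ := fun γ =>
        R₀ + ∑ s ∈ Finset.range T, descentStep p rate S Θ₀ γ s + κ ^ 2 with hW
      have hW0 : ∀ γ, 0 ≤ W γ := fun γ =>
        (layerSq_nonneg _ 0).trans (hgrow S Θ₀ ht γ 0 (Nat.zero_le _))
      have hint : ∫ γ, W γ ∂(batchLaw n B T) = R₀ +
          ∫ γ, ∑ s ∈ Finset.range T, descentStep p rate S Θ₀ γ s ∂(batchLaw n B T) + κ ^ 2 := by
        rw [hW, integral_add Integrable.of_finite Integrable.of_finite,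
          integral_add Integrable.of_finite Integrable.of_finite]
        simp
      have h1 := integral_sum_descentStep_le p hrate (T := T) hn hB hCy (fun i => (ht.1 i).2) Θ₀
      have h2 : 0 ≤ ∫ γ, W γ ∂(batchLaw n B T) := integral_nonneg hW0
      have hκ2 : 0 < κ ^ 2 := by positivity
      simp only [Set.mem_ofPred_eq, ht, true_and]
      exact measure_mul_lt_le Integrable.of_finite hW0 hρ (by linarith) (by linarith)
    · simp [ht]

lemma genConst_pos {Cf : ℝ} (hCf : 0 ≤ Cf) (δ₀ : ℝ) : 0 < genConst Cf δ₀ := by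
  unfold genConst
  positivity

end DeepNet

end

theorem theorem3 :
    ∃ (K : ℝ) (cη : ℕ → ℝ → ℝ) (c : ℝ → ℝ → ℕ → ℝ),
      0 < K ∧ (∀ L δ, 0 < cη L δ) ∧ (∀ Cf δ₀ k, 0 < c Cf δ₀ k) ∧
      ∀ (N : DeepNet.Arch) (p κ Cf Cy δ₀ δ ρ α ε η : ℝ) (n B T T₀ : ℕ)
        (μ : Measure (DeepNet.Data N)) (_ : IsProbabilityMeasure μ),
        1 ≤ N.L → 1 ≤ n → 1 ≤ B → 1 ≤ T₀ →
        0 ≤ p → 0 < κ → 0 < Cf → Cy ≤ 1 →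
        0 < δ → δ ≤ δ₀ → δ₀ < 1 → 0 < ρ →
        -- the data are bounded
        (∀ᵐ z ∂μ, ‖z.1‖ ≤ 1 ∧ |z.2| ≤ Cy) →
        -- the learning rate schedule
        ((N.L : ℝ) + 1) / (N.L + 2) < α → α ≤ 1 →
        0 < ε → ε < 1 → ε ≤ (N.L + 2) * α - (N.L + 1) →
        0 < η →
        η ≤ cη N.L δ * ((N.m : ℝ) ^ p * (N.L : ℝ) ^ (((N.L : ℝ) - 1) / 2) * √ε /
          ((Cf + Cy) * (T₀ : ℝ) ^ ((1 + ε) / 2) * κ ^ (N.L - 1))) →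
        η * (Cy ^ 2 * T₀) ≤ cη N.L δ * (κ ^ 2 * (1 - ε)) →
        ENNReal.ofReal (ρ / (1 + ρ) - δ) ≤
          DeepNet.trainLaw κ μ n B T {ω : (Fin n → DeepNet.Data N) × DeepNet.Params N ×
              DeepNet.Batches n B T |
            DeepNet.BoundedOutputs p Cf (DeepNet.learningRate η α T₀) μ B T ω.1 ω.2.1 →
              0 ≤ DeepNet.sqRadius K ρ κ δ p Cy (DeepNet.learningRate η α T₀) B T ω.1 ω.2.1 ∧
              DeepNet.genError p μ ω.1
                  (DeepNet.sgd p (DeepNet.learningRate η α T₀) ω.1 ω.2.1 ω.2.2 T) ≤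
                c Cf δ₀ N.maxPoolDepth *
                  (N.C / ((N.m : ℝ) ^ p * √n) *
                      DeepNet.sqRadius K ρ κ δ p Cy (DeepNet.learningRate η α T₀) B T ω.1 ω.2.1
                        ^ (((N.L : ℝ) + 1) / 2)
                    + √(Real.log (1 / δ) / n))} := by
  open DeepNet in
  -- `10 = 8 + 2`: the factor of Chernoff's bound at initialization, and `2 * κ ^ 2` of slack;
  -- the absolute value makes the constant positive for all arguments
  refine ⟨10, etaConst, fun Cf δ₀ _ => genConst |Cf| δ₀, by norm_num, etaConst_pos,
    fun Cf δ₀ _ => genConst_pos (abs_nonneg Cf) δ₀, ?_⟩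
  intro N p κ Cf Cy δ₀ δ ρ α ε η n B T T₀ μ _ hL hn hB hT₀ _ hκ hCf hCy1 hδ hδ1 hδ₀ hρ hμ _ _ hε
    hε1 hεα hη hη1 hη2
  have hδ' : δ < 1 := hδ1.trans_lt hδ₀
  have hCy : 0 ≤ Cy := by
    obtain ⟨z, hz⟩ := hμ.exists
    exact (abs_nonneg _).trans hz.2
  have := isProbabilityMeasure_batchLaw hn B T
  set rate := learningRate η α T₀ with hrate
  have hrate0 : ∀ t, 0 ≤ rate t := fun t => by
    rw [hrate, learningRate]
    positivity
  set s₀ := initScale N κ δ with hs₀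
  have hs1 : κ ^ 2 ≤ s₀ := sq_le_initScale hδ hδ'
  have hR₀ : 8 * s₀ + 2 * κ ^ 2 ≤ growthFactor N.L δ * κ ^ 2 := by
    have h1 : s₀ ≤ κ ^ 2 * (1 + Real.log ((N.L + 1) / δ)) := initScale_le hδ hδ'
    have h2 := mul_le_mul_of_nonneg_left (le_abs_self (Real.log ((N.L + 1) / δ))) (sq_nonneg κ)
    rw [growthFactor]
    linarith
  have hgrow : ∀ (S : Fin n → Data N) (Θ₀ : Params N), IsTame p Cf Cy (8 * s₀) rate B T S Θ₀ →
      ∀ γ : Batches n B T, ∀ l ≤ N.L, layerSq (sgd p rate S Θ₀ γ T) l ≤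
        8 * s₀ + ∑ s ∈ Finset.range T, descentStep p rate S Θ₀ γ s + κ ^ 2 :=
    fun S Θ₀ h γ l hl => layerSq_sgd_le γ hL hB hT₀ hκ hCf hCy hε hε1 hεα hη hη1 hη2 h.1 (h.2.1 γ)
      hR₀ h.2.2 le_rfl hl
  -- The null set on which a trained network exceeds `Cf` depends on the sample through the
  -- network, so the training data are required to respect the bound for all parameters at once.
  set D : Set (Fin n → Data N) := {S | ∀ i, (‖(S i).1‖ ≤ 1 ∧ |(S i).2| ≤ Cy) ∧
    ∀ Θ : Params N, (∀ᵐ z ∂μ, |net p Θ z.1| ≤ Cf) → |net p Θ (S i).1| ≤ Cf} with hD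
  set E₁ : Set (Fin n → Data N) := {S | ∃ Θ : Params N, (∀ᵐ z ∂μ, |net p Θ z.1| ≤ Cf) ∧
    genConst Cf δ₀ * (N.C / ((N.m : ℝ) ^ p * √n) * pathNorm Θ + √(Real.log (1 / δ) / n)) <
      genError p μ S Θ} with hE₁
  set E₂ : Set (Params N) := {Θ | ∃ l : Fin (N.L + 1), 8 * s₀ < layerSq Θ l} with hE₂
  set E₃ : Set ((Fin n → Data N) × Params N × Batches n B T) :=
    {ω | IsTame p Cf Cy (8 * s₀) rate B T ω.1 ω.2.1 ∧
      (1 + ρ) * (8 * s₀ + 2 * κ ^ 2 + meanCumLoss p Cy rate B T ω.1 ω.2.1) <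
        8 * s₀ + ∑ s ∈ Finset.range T, descentStep p rate ω.1 ω.2.1 ω.2.2 s + κ ^ 2} with hE₃
  have hPD : trainLaw κ μ n B T {ω | ω.1 ∈ Dᶜ} = 0 := by
    rw [trainLaw_data hn]
    have h : ∀ᵐ z ∂μ, (‖z.1‖ ≤ 1 ∧ |z.2| ≤ Cy) ∧
        ∀ Θ : Params N, (∀ᵐ z ∂μ, |net p Θ z.1| ≤ Cf) → |net p Θ z.1| ≤ Cf :=
      hμ.and (ae_forall_abs_net_le p Cf μ)
    exact ae_iff.1 (ae_all_iff.2 fun i =>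
      (Measure.quasiMeasurePreserving_eval (fun _ : Fin n => μ) i).ae h)
  have hP₁ : trainLaw κ μ n B T {ω | ω.1 ∈ E₁} ≤ ENNReal.ofReal (δ / 2) := by
    rw [trainLaw_data hn]
    exact measure_exists_genError_le_pathNorm hn hCf.le hCy1 hμ hδ hδ1 hδ₀
  have hP₂ : trainLaw κ μ n B T {ω | ω.2.1 ∈ E₂} ≤ ENNReal.ofReal (δ / 2) := by
    rw [trainLaw_init hn]
    exact initLaw_exists_layerSq_le hκ hδ hδ'
  have hP₃ : trainLaw κ μ n B T E₃ ≤ ENNReal.ofReal (1 / (1 + ρ)) :=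
    trainLaw_isTame_growth_le hn hB hκ hCy hρ hrate0 hgrow
  set G : Set ((Fin n → Data N) × Params N × Batches n B T) := {ω |
    BoundedOutputs p Cf rate μ B T ω.1 ω.2.1 →
      0 ≤ sqRadius 10 ρ κ δ p Cy rate B T ω.1 ω.2.1 ∧
      genError p μ ω.1 (sgd p rate ω.1 ω.2.1 ω.2.2 T) ≤ genConst |Cf| δ₀ *
        (N.C / ((N.m : ℝ) ^ p * √n) *
          sqRadius 10 ρ κ δ p Cy rate B T ω.1 ω.2.1 ^ (((N.L : ℝ) + 1) / 2) +
            √(Real.log (1 / δ) / n))} with hG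
  have hcover : (Set.univ : Set ((Fin n → Data N) × Params N × Batches n B T)) ⊆
      G ∪ ({ω | ω.1 ∈ Dᶜ} ∪ ({ω | ω.1 ∈ E₁} ∪ ({ω | ω.2.1 ∈ E₂} ∪ E₃))) := by
    rintro ⟨S, Θ₀, γ⟩ -
    by_contra hnot
    simp only [Set.mem_union, not_or, Set.mem_ofPred_eq, Set.mem_compl_iff, not_not] at hnot
    obtain ⟨hG', hD', h₁, h₂, h₃⟩ := hnot
    refine hG' fun hbd => ?_
    have htame : IsTame p Cf Cy (8 * s₀) rate B T S Θ₀ :=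
      ⟨fun i => (hD' i).1, fun γ t ht i => (hD' i).2 _ (hbd γ t ht), fun l hl =>
        not_lt.1 fun hlt => h₂ ⟨⟨l, Nat.lt_succ_of_le hl⟩, hlt⟩⟩
    have h₃' := not_lt.1 fun hlt => h₃ ⟨htame, hlt⟩
    set Q := sqRadius 10 ρ κ δ p Cy rate B T S Θ₀ with hQ
    have hlayer : ∀ l ≤ N.L, layerSq (sgd p rate S Θ₀ γ T) l ≤ Q := fun l hl => by
      refine (hgrow S Θ₀ htame γ l hl).trans (h₃'.trans ?_)
      have := mul_le_mul_of_nonneg_left hs1 (by positivity : 0 ≤ 2 * (1 + ρ))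
      rw [hQ, sqRadius, ← hs₀]
      linarith
    refine ⟨(layerSq_nonneg _ 0).trans (hlayer 0 (Nat.zero_le _)), ?_⟩
    rw [abs_of_pos hCf]
    refine (not_lt.1 fun hlt => h₁ ⟨_, hbd γ T le_rfl, hlt⟩).trans ?_
    have hC := N.C_pos
    have hc := genConst_pos hCf.le δ₀
    gcongr
    exact pathNorm_le_rpow hlayer
  have hprob : IsProbabilityMeasure (trainLaw κ μ n B T) := by unfold trainLaw; infer_instance
  -- the events need not be measurable here, since only subadditivity is used
  have hone : (1 : ENNReal) ≤ trainLaw κ μ n B T G + ENNReal.ofReal (δ + 1 / (1 + ρ)) := by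
    calc (1 : ENNReal) = trainLaw κ μ n B T Set.univ := measure_univ.symm
      _ ≤ trainLaw κ μ n B T G + (trainLaw κ μ n B T {ω | ω.1 ∈ Dᶜ} +
          (trainLaw κ μ n B T {ω | ω.1 ∈ E₁} + (trainLaw κ μ n B T {ω | ω.2.1 ∈ E₂} +
            trainLaw κ μ n B T E₃))) := by
          refine (measure_mono hcover).trans ((measure_union_le _ _).trans ?_)
          gcongr
          refine (measure_union_le _ _).trans ?_
          gcongr
          refine (measure_union_le _ _).trans ?_
          gcongr
          exact measure_union_le _ _
      _ ≤ trainLaw κ μ n B T G + (0 + (ENNReal.ofReal (δ / 2) + (ENNReal.ofReal (δ / 2) +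
            ENNReal.ofReal (1 / (1 + ρ))))) := by
          rw [hPD]; gcongr
      _ = _ := by
          rw [zero_add, ← ENNReal.ofReal_add (by positivity) (by positivity),
            ← ENNReal.ofReal_add (by positivity) (by positivity)]
          congr 2
          ring
  have hval : ρ / (1 + ρ) - δ = 1 - (δ + 1 / (1 + ρ)) := by
    field_simp
    ring
  rw [hval, ENNReal.ofReal_sub _ (by positivity), ENNReal.ofReal_one]
  exact tsub_le_iff_right.2 hone
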